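/- **Setting.** Let $d,m\ge1$, let $(\Omega,\mathcal F,\mathbb P)$ be a probability space, $X$ an $\mathbb R^d$-valued random variable, $f:\mathbb R^d\times\mathbb R^m\to\mathbb R$ with $f(X,\theta)\in L^1(\mathbb P)$ for all $\theta$, and $F(\theta)=\mathbb E[f(X,\theta)]$. Let $g:\mathbb R^d\times\mathbb R^m\to\mathbb R^m$ be measurable, $b(\theta)=\mathbb E[g(X,\theta)]$, $(X_n)_{n\ge1}$ i.i.d. copies of $X$, $\theta_0\in L^2(\mathbb P)$ independent of $(X_n)_{n\ge1}$, and $$\theta_n=\theta_{n-1}-\gamma_n\,g(X_n,\theta_{n-1}),\qquad n\ge1.$$ Write $\Sigma_n=\sum_{k=1}^n\gamma_k$, $a\vee b=\max(a,b)$, $a\wedge b=\min(a,b)$, $\mathcal L_\ell=\{F\le\ell\}$, and let $\mathcal A$ be the (random) set of accumulation points of $(\theta_n)_{n\ge0}$. Assume: 1. $F$ is lower bounded and differentiable, and $\|\nabla F(\theta')-\nabla F(\theta)\|\le L\|\theta'-\theta\|^\alpha$ for all $\theta,\theta'$, with $L>0$, $\alpha\in(0,1]$. 2. There are $C_0>0$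 and $0<\kappa\le c$ such that for all $\theta$: $\mathbb E\|g(X,\theta)\|^2\le C_0(F(\theta)-\inf F+1)$, $b(\theta)^\top\nabla F(\theta)\ge\kappa\|\nabla F(\theta)\|^2$, $\|b(\theta)\|\le c\|\nabla F(\theta)\|$. 3. $\gamma_n>0$ for $n\ge1$, $\sum_n\gamma_n=\infty$, $\sum_n\gamma_n^{1+\alpha}<\infty$. 4. $F(\theta)\to\infty$ as $\|\theta\|\to\infty$. 5. $F$ is Łojasiewicz: it is $C^1$ and for every stationary point $\theta'$ of $F$ there are an open neighborhood $\mathcal V$ of $\theta'$, $\beta\in(0,1)$ and $\zeta>0$ with $|F(\theta)-F(\theta')|^\beta\le\zeta\|\nabla F(\theta)\|$ on $\mathcal V$. ($F$ is called globally Łojasiewicz if one can always take $\mathcal V=\mathbb R^m$.) 6. Either $\ln(\gamma_{n-1}/\gamma_n)=o(\gamma_n)$, or $\ln(\gamma_{n-1}/\gamma_n)\sim\gamma_n/\gamma_\star$, for a constant $\gamma_\star>0$; moreover $\sum_n\gamma_n/\Sigma_n=\infty$ and $\gamma_n=O(\Sigma_n^{-\rho})$. 7. $\gamma_n=\Theta(n^{-s})$,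 where $\rho>3\vee\frac2\alpha$ and $s\in[\frac{\rho}{1+\rho},1]$, and $\kappa\gamma_\star>\frac12\vee\alpha$ if $s=1$. Then $(\theta_n)$ converges a.s. to a random variable $\theta_\star$ with $\nabla F(\theta_\star)=0$ and $F(\theta_n)\to F(\theta_\star)$ a.s., and the following holds, where $$\underline\sigma=\tfrac1{2(2s-1)}\vee\tfrac{\alpha s}{2((1+\alpha)s-1)},\qquad e_0=\tfrac{2s-1}2\wedge((1+\alpha)s-1).$$ **(i) Local case.** For every $\delta\in(0,1)$ there is $\ell_\delta>\inf F$ with $\mathbb P(\mathcal A\subset\mathcal L_{\ell_\delta})\ge1-\delta$. For parameters $(\beta,\zeta)$ consider the property $$(\star)\quad\text{every stationary point }\theta'\in\mathcal L_{\ell_\delta}\text{ has an open neighborhood on which }|F(\theta)-F(\theta')|^{\beta}\le\zeta\|\nabla F(\theta)\|.$$ (a) There are $\beta_\delta\in(0,1)$ and $\zeta_\delta>0$ satisfying $(\star)$. (b) There is $\beta_\delta\in(0,1)$ satisfying $(\star)$ with $\zeta=1$. For every choice of $(\beta_\delta,\zeta_\delta)$ as in (a), respectively of $\beta_\delta$ as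 in (b), there is $C_\delta>0$ (independent of $\sigma$ and $n$) such that, with $r_\delta=\frac1{2\beta_\delta-1}\wedge(\alpha\rho-1)\wedge\frac{\rho-1}2$: * if $\beta_\delta\le\frac12$ and, in case (a) with $s=1$, moreover $\kappa\gamma_\star>\zeta_\delta^{1/\beta_\delta}(\alpha\vee\frac12)$, then for all $\sigma\in\big[\underline\sigma\vee\frac{1-((1-\alpha)\vee\frac12)s}{2(\alpha\wedge\frac12)s},1\big)$ and $n\ge1$, with probability at least $1-\delta$, $$\|\theta_n-\theta_\star\|\le\frac{C_\delta}{1-\sigma}n^{-((\alpha\wedge\frac12)s\,\wedge\,e_0)(1-\sigma)};$$ * if $\beta_\delta>\frac12$ and $s<1$, then $r_\delta>1$ and for all $\sigma\in\big[\underline\sigma\vee\frac{1+r_\delta}{2r_\delta},1\big)$ and $n\ge1$, with probability at least $1-\delta$, $$\|\theta_n-\theta_\star\|\le\frac{C_\delta}{1-\sigma}n^{-(r_\delta(1-s)\,\wedge\,e_0)(1-\sigma)};$$ * if $\beta_\delta>\frac12$ and $s=1$, then $r_\delta>1$ and for all $\sigma\in\big[\frac{1+r_\delta}{2r_\delta},1\big)$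 and $n\ge2$, with probability at least $1-\delta$, $$\|\theta_n-\theta_\star\|\le\frac{C_\delta}{1-\sigma}(\ln n)^{-r_\delta(1-\sigma)}.$$ **(ii) Global case.** If $F$ is globally Łojasiewicz, there are $\beta\in[\frac\alpha{1+\alpha},1)$ and $\zeta>0$ with $(F(\theta)-\inf F)^\beta\le\zeta\|\nabla F(\theta)\|$ for all $\theta\in\mathbb R^m$. For every such pair with $\beta\in(\frac\alpha{1+\alpha},1)\cup\{\frac12\}$ there is $C>0$ (independent of $\delta$, $\sigma$ and $n$) such that for all $\delta\in(0,1)$, with $r=\frac1{2\beta-1}\wedge(\alpha\rho-1)$: * if $\beta\le\frac12$ and, when $s=1$, moreover $\kappa\gamma_\star>\zeta^{2+\lambda\frac{1+\alpha}\alpha}\big(\frac{(1+\alpha)L^{1/\alpha}}\alpha\big)^\lambda\alpha$, where $\lambda=\frac{1-2\beta}{\frac{1+\alpha}\alpha\beta-1}$ if $\beta<\frac12$ and $\lambda=0$ if $\beta=\frac12$, then for all $\sigma\in[\underline\sigma,1)$ and $n\ge1$, with probability at least $1-\delta$, $$\|\theta_n-\theta_\star\|\le\frac{C}{\delta(1-\sigma)}n^{-(\alpha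 s\,\wedge\,e_0)(1-\sigma)};$$ * if $\beta>\frac12$ and $s<1$, then $r>1$ and for all $\sigma\in\big[\underline\sigma\vee\frac{1+r}{2r},1\big)$ and $n\ge1$, with probability at least $1-\delta$, $$\|\theta_n-\theta_\star\|\le\frac{C}{\delta(1-\sigma)}n^{-(r(1-s)\,\wedge\,e_0)(1-\sigma)};$$ * if $\beta>\frac12$ and $s=1$, then $r>1$ and for all $\sigma\in\big[\frac{1+r}{2r},1\big)$ and $n\ge2$, with probability at least $1-\delta$, $$\|\theta_n-\theta_\star\|\le\frac{C}{\delta(1-\sigma)}(\ln n)^{-r(1-\sigma)}.$$ In each case the interval of admissible $\sigma$ is nonempty, and the largest exponent is obtained for the smallest admissible $\sigma$. -/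

import Mathlib

open MeasureTheory ProbabilityTheory Filter Topology Asymptotics Set

noncomputable section

namespace BiasedSGD

/-- `ℝᵏ` with the Euclidean norm. -/
abbrev Vec (k : ℕ) : Type := EuclideanSpace ℝ (Fin k)

variable {Ω : Type*} [MeasurableSpace Ω] {d m : ℕ}

/-- The objective `F(θ) = 𝔼[f(X, θ)]`. -/
def objective (P : Measure Ω) (X : Ω → Vec d) (f : Vec d → Vec m → ℝ) (θ : Vec m) : ℝ :=
  ∫ ω, f (X ω) θ ∂P

/-- The mean `b(θ) = 𝔼[g(X, θ)]` of the stochastic gradient oracle. -/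
def meanOracle (P : Measure Ω) (X : Ω → Vec d) (g : Vec d → Vec m → Vec m) (θ : Vec m) : Vec m :=
  ∫ ω, g (X ω) θ ∂P

/-- The SGD iterates `θₙ = θₙ₋₁ - γₙ g(Xₙ, θₙ₋₁)`, `n ≥ 1`. The values `γ 0` and `Xs 0` are never
used. -/
def sgd (γ : ℕ → ℝ) (g : Vec d → Vec m → Vec m) (Xs : ℕ → Ω → Vec d) (θ₀ : Ω → Vec m) :
    ℕ → Ω → Vec m
  | 0 => θ₀
  | n + 1 => fun ω =>
      sgd γ g Xs θ₀ n ω - γ (n + 1) • g (Xs (n + 1) ω) (sgd γ g Xs θ₀ n ω)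

/-- The partial sums `∑_{k=1}^n γₖ`. -/
def stepSum (γ : ℕ → ℝ) (n : ℕ) : ℝ := ∑ k ∈ Finset.Icc 1 n, γ k

/-- `F` is lower bounded and differentiable, and `∇F` is `(L, α)`-Hölder continuous. -/
def HolderSmooth (F : Vec m → ℝ) (L α : ℝ) : Prop :=
  BddBelow (range F) ∧ Differentiable ℝ F ∧
    ∀ θ θ' : Vec m, ‖gradient F θ' - gradient F θ‖ ≤ L * ‖θ' - θ‖ ^ α

/-- The conditions on the oracle `g`: growth of its second moment (which is in particular finite),
and comparison of its mean with the gradient of `F`. -/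
def OracleCondition (P : Measure Ω) (X : Ω → Vec d) (g : Vec d → Vec m → Vec m)
    (F : Vec m → ℝ) (C κ c : ℝ) : Prop :=
  ∀ θ : Vec m,
    MemLp (fun ω => g (X ω) θ) 2 P ∧
    ∫ ω, ‖g (X ω) θ‖ ^ 2 ∂P ≤ C * ((F θ - ⨅ θ', F θ') + 1) ∧
    κ * ‖gradient F θ‖ ^ 2 ≤ inner ℝ (meanOracle P X g θ) (gradient F θ) ∧
    ‖meanOracle P X g θ‖ ≤ c * ‖gradient F θ‖

/-- `γₙ > 0` for `n ≥ 1`, `∑ γₙ = ∞` and `∑ γₙ^{1+α} < ∞`. -/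
def StepSummability (γ : ℕ → ℝ) (α : ℝ) : Prop :=
  (∀ n ≥ 1, 0 < γ n) ∧ Tendsto (stepSum γ) atTop atTop ∧
    Summable fun n : ℕ => γ (n + 1) ^ (1 + α)

/-- `F(θ) → ∞` as `‖θ‖ → ∞`. -/
def Coercive (F : Vec m → ℝ) : Prop :=
  Tendsto F (Bornology.cobounded (Vec m)) atTop

/-- `F` is Łojasiewicz: a Łojasiewicz inequality holds around every stationary point, with
parameters that may depend on this point. -/
def Lojasiewicz (F : Vec m → ℝ) : Prop :=
  ContDiff ℝ 1 F ∧ ∀ θs : Vec m, gradient F θs = 0 →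
    ∃ V : Set (Vec m), IsOpen V ∧ θs ∈ V ∧ ∃ β ∈ Ioo (0 : ℝ) 1, ∃ ζ > 0,
      ∀ θ ∈ V, |F θ - F θs| ^ β ≤ ζ * ‖gradient F θ‖

/-- `F` is globally Łojasiewicz: the neighborhoods can be taken equal to the whole space. -/
def GloballyLojasiewicz (F : Vec m → ℝ) : Prop :=
  ContDiff ℝ 1 F ∧ ∀ θs : Vec m, gradient F θs = 0 → ∃ β ∈ Ioo (0 : ℝ) 1, ∃ ζ > 0,
    ∀ θ : Vec m, |F θ - F θs| ^ β ≤ ζ * ‖gradient F θ‖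

/-- The Łojasiewicz inequality with the common parameters `(β, ζ)` around every stationary point
of `F` in `K`. -/
def UniformLojasiewiczOn (F : Vec m → ℝ) (K : Set (Vec m)) (β ζ : ℝ) : Prop :=
  ∀ θs ∈ K, gradient F θs = 0 → ∃ V : Set (Vec m), IsOpen V ∧ θs ∈ V ∧
    ∀ θ ∈ V, |F θ - F θs| ^ β ≤ ζ * ‖gradient F θ‖

/-- `(F(θ) - inf F)^β ≤ ζ ‖∇F(θ)‖` for all `θ`. -/
def GlobalLojasiewiczIneq (F : Vec m → ℝ) (β ζ : ℝ) : Prop :=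
  ∀ θ : Vec m, (F θ - ⨅ θ', F θ') ^ β ≤ ζ * ‖gradient F θ‖

/-- Regularity of the step sequence:
(i) `ln(γₙ₋₁/γₙ) = o(γₙ)` or `ln(γₙ₋₁/γₙ) ∼ γₙ/γ⋆`; (ii) `∑ₙ γₙ / ∑_{k ≤ n} γₖ = ∞`;
(iii) `γₙ = O((∑_{k ≤ n} γₖ)^{-ρ})`. -/
def StepRegularity (γ : ℕ → ℝ) (γs ρ : ℝ) : Prop :=
  (IsLittleO atTop (fun n : ℕ => Real.log (γ n / γ (n + 1))) (fun n => γ (n + 1)) ∨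
    IsEquivalent atTop (fun n : ℕ => Real.log (γ n / γ (n + 1))) (fun n => γ (n + 1) / γs)) ∧
  Tendsto (fun N : ℕ => ∑ n ∈ Finset.Icc 1 N, γ n / stepSum γ n) atTop atTop ∧
  IsBigO atTop γ (fun n => stepSum γ n ^ (-ρ))

/-- The sublevel set `{F ≤ ℓ}`. -/
def sublevel (F : Vec m → ℝ) (ℓ : ℝ) : Set (Vec m) := {θ | F θ ≤ ℓ}

/-- The set of accumulation points of a sequence. -/
def accPoints (u : ℕ → Vec m) : Set (Vec m) := {x | MapClusterPt x atTop u}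

/-- `r = 1/(2β-1) ∧ (αρ-1) ∧ (ρ-1)/2`. -/
def rLocal (α ρ β : ℝ) : ℝ := min (1 / (2 * β - 1)) (min (α * ρ - 1) ((ρ - 1) / 2))

/-- `r = 1/(2β-1) ∧ (αρ-1)`. -/
def rGlobal (α ρ β : ℝ) : ℝ := min (1 / (2 * β - 1)) (α * ρ - 1)

/-- `1/(2(2s-1)) ∨ αs/(2((1+α)s-1))`. -/
def sigmaBase (α s : ℝ) : ℝ := max (1 / (2 * (2 * s - 1))) (α * s / (2 * ((1 + α) * s - 1)))

/-- `(2s-1)/2 ∧ ((1+α)s-1)`. -/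
def expBase (α s : ℝ) : ℝ := min ((2 * s - 1) / 2) ((1 + α) * s - 1)

/-- The number `λ` of the globally Łojasiewicz case. -/
def lam (α β : ℝ) : ℝ := if β < 1 / 2 then (1 - 2 * β) / ((1 + α) / α * β - 1) else 0

/-- For every `σ ∈ [σmin, 1)` and every `n ≥ n₀`, the bound
`err n ≤ K / (1 - σ) * (scale n) ^ (-e (1 - σ))` holds with probability at least `1 - δ`; and the
best exponent `e (1 - σ)` is the one at the smallest value `σ = σmin`, which is admissible. -/
def RateFamily (P : Measure Ω) (err : ℕ → Ω → ℝ) (δ K σmin e : ℝ) (n₀ : ℕ)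
    (scale : ℕ → ℝ) : Prop :=
  IsGreatest ((fun σ => e * (1 - σ)) '' Ico σmin 1) (e * (1 - σmin)) ∧
  ∀ σ ∈ Ico σmin 1, ∀ n ≥ n₀,
    1 - δ ≤ P.real {ω | err n ω ≤ K / (1 - σ) * scale n ^ (-(e * (1 - σ)))}

/-- The three rates of the local case, with exponent `β`, constant `K` and confidence `1 - δ`;
`small` is the extra requirement on the step size when `β ≤ 1/2`. -/
def LocalRates (P : Measure Ω) (err : ℕ → Ω → ℝ) (α s ρ δ β K : ℝ) (small : Prop) : Prop :=
  (β ≤ 1 / 2 → small →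
    RateFamily P err δ K
      (max (sigmaBase α s)
        ((1 - max (1 - α) (1 / 2) * s) / (2 * min α (1 / 2) * s)))
      (min (min α (1 / 2) * s) (expBase α s)) 1 (fun n => (n : ℝ))) ∧
  (1 / 2 < β → s < 1 →
    1 < rLocal α ρ β ∧
    RateFamily P err δ K
      (max (sigmaBase α s) ((1 + rLocal α ρ β) / (2 * rLocal α ρ β)))
      (min (rLocal α ρ β * (1 - s)) (expBase α s)) 1 (fun n => (n : ℝ))) ∧
  (1 / 2 < β → s = 1 →
    1 < rLocal α ρ β ∧
    RateFamily P err δ K ((1 + rLocal α ρ β) / (2 * rLocal α ρ β)) (rLocal α ρ β)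
      2 (fun n => Real.log n))

/-- The three rates of the globally Łojasiewicz case, with exponent `β`, constant `K` and
confidence `1 - δ`; `small` is the extra requirement on the step size when `β ≤ 1/2`. -/
def GlobalRates (P : Measure Ω) (err : ℕ → Ω → ℝ) (α s ρ δ β K : ℝ) (small : Prop) : Prop :=
  (β ≤ 1 / 2 → small →
    RateFamily P err δ K (sigmaBase α s) (min (α * s) (expBase α s)) 1 (fun n => (n : ℝ))) ∧
  (1 / 2 < β → s < 1 →
    1 < rGlobal α ρ β ∧
    RateFamily P err δ K
      (max (sigmaBase α s) ((1 + rGlobal α ρ β) / (2 * rGlobal α ρ β)))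
      (min (rGlobal α ρ β * (1 - s)) (expBase α s)) 1 (fun n => (n : ℝ))) ∧
  (1 / 2 < β → s = 1 →
    1 < rGlobal α ρ β ∧
    RateFamily P err δ K ((1 + rGlobal α ρ β) / (2 * rGlobal α ρ β)) (rGlobal α ρ β)
      2 (fun n => Real.log n))

end BiasedSGD

end

noncomputable section

namespace BiasedSGD

section

/-! ### Elementary inequalities for real powers -/

/-! The iteration is a perturbed gradient descent. By Hölder smoothness (`HolderSmooth.le_add`) and
the drift condition, one step lowers `F` by `κ γ ‖∇F‖²` up to an error made of a martingale
increment `γ ⟨g - b, ∇F⟩` and a remainder of size `γ^(1+α) ‖g‖^(1+α)`. When the series of errors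
converges with tails `O(n^(-τ))`, adding its tail `T` to `F(θₙ) - lim F(θₙ)` gives a nonnegative
sequence `W` with `κ a x² ≤ Wₙ - Wₙ₊₁`, where `a` is the step and `x = ‖∇F(θₙ)‖` (`Lyapunov`,
`exists_lyapunov`). Convergence and rates become deterministic questions about `W`.

Convergence: near a critical accumulation point, the Łojasiewicz inequality bounds `a x` by the
decrease of a power `1 - β` wherever `W` dominates `T`; elsewhere `W` is itself `O(n^(-τ))`, and
`sum_mul_le_of_decrease` bounds the sum of `a x`. The path therefore has small remaining length and
cannot leave the neighborhood (`Lyapunov.length_le`, `exists_tendsto_critical`).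

Rates: `|W - T|^(2β) ≤ ζ² x²` turns the decrease into a differential inequality, so that `W =
O(φ^(-w))` (`decay_of_pow`, `decay_of_linear`), and the remaining length is `O(φ^(-(w-(1-s))/2))`.
The clock `φ` is `k + 1`, or `log (k + 2)` when `s = 1` and `β > 1/2`. The distance to the limit is
at most a multiple of this length plus a noise tail `O(n^(-(s-3/4)))`.

Probability: given the past, the innovation is integrated out with the state frozen
(`Innovation.condExp_comp`). Mean gaps are bounded by a Grönwall argument, gaps along paths by a
supermartingale, and weighted L² martingales give the tails of the errors (`Model.ae_path`). In the
local case the deterministic analysis is run on each path, with `τ ≤ s/2` because of the martingale,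
and the random constant is made deterministic at a small cost in probability. In the global case it
is run on the mean gap and the root mean square gradient, where the martingale disappears and `τ =
(1+α)s - 1`; Markov's inequality then yields the factor `1/δ`. In both cases a single bound, at the
smallest `σ`, implies the whole family (`rateFamily_of_forall`). -/

lemma one_add_mul_one_sub_le_rpow_neg {t ε : ℝ} (ht : 0 < t) (hε : 0 ≤ ε) :
    1 + ε * (1 - t) ≤ t ^ (-ε) := by
  rw [Real.rpow_def_of_pos ht]
  have h1 := Real.add_one_le_exp (Real.log t * -ε)
  have h2 := Real.log_le_sub_one_of_pos ht
  nlinarith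

/-- The right side is the integral of `x ^ (-(1 + ε))` over `[a, b]`, whose integrand is at least
its value at `b`; the tangent inequality above replaces the integral. -/
lemma sub_mul_rpow_le_sub_rpow_neg {a b ε : ℝ} (ha : 0 < a) (hab : a ≤ b) (hε : 0 < ε) :
    (b - a) * b ^ (-(1 + ε)) ≤ (a ^ (-ε) - b ^ (-ε)) / ε := by
  have hb : 0 < b := ha.trans_le hab
  have h := one_add_mul_one_sub_le_rpow_neg (div_pos ha hb) hε.le
  rw [Real.div_rpow ha.le hb.le, le_div_iff₀ (Real.rpow_pos_of_pos hb _)] at h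
  rw [le_div_iff₀ hε, show -(1 + ε) = -ε - 1 by ring, Real.rpow_sub_one hb.ne']
  have : (1 + ε * (1 - a / b)) * b ^ (-ε) = b ^ (-ε) + (b - a) * (b ^ (-ε) / b) * ε := by
    field_simp
  linarith

/-- The same comparison for `x ^ (-θ)` on `[b, a]`. Since `θ < 1` the integral converges at `0`, so
`b = 0` is allowed. -/
lemma sub_mul_rpow_neg_le_sub_rpow {a b θ : ℝ} (ha : 0 ≤ a) (hb : 0 ≤ b) (hba : b ≤ a)
    (hθ : 0 < θ) (hθ1 : θ < 1) :
    (a - b) * a ^ (-θ) ≤ (a ^ (1 - θ) - b ^ (1 - θ)) / (1 - θ) := by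
  rcases ha.eq_or_lt with rfl | ha
  · have : b = 0 := le_antisymm hba hb
    subst this; simp
  have h := rpow_one_add_le_one_add_mul_self (s := b / a - 1) (p := 1 - θ)
    (by have := div_nonneg hb ha.le; linarith) (by linarith) (by linarith)
  rw [show 1 + (b / a - 1) = b / a by ring, Real.div_rpow hb ha.le,
    div_le_iff₀ (Real.rpow_pos_of_pos ha _)] at h
  rw [le_div_iff₀ (by linarith)]
  have h2 : a ^ (1 - θ) = a * a ^ (-θ) := by
    rw [sub_eq_add_neg, Real.rpow_add ha, Real.rpow_one]
  have : (1 + (1 - θ) * (b / a - 1)) * a ^ (1 - θ)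
      = a ^ (1 - θ) - (a - b) * a ^ (-θ) * (1 - θ) := by
    rw [h2]; field_simp; ring
  linarith

lemma sum_Ico_sub_mul_rpow_le {φ : ℕ → ℝ} {N : ℕ} (hφ : ∀ k ≥ N, 0 < φ k)
    (hm : ∀ k ≥ N, φ k ≤ φ (k + 1)) {ε : ℝ} (hε : 0 < ε) {n : ℕ} (hn : N ≤ n) (m : ℕ) :
    ∑ k ∈ Finset.Ico n m, (φ (k + 1) - φ k) * φ (k + 1) ^ (-(1 + ε)) ≤ φ n ^ (-ε) / ε := by
  have hp : ∀ k ≥ N, 0 < φ k ^ (-ε) := fun k hk => Real.rpow_pos_of_pos (hφ k hk) _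
  rcases le_total m n with h | h
  · rw [Finset.Ico_eq_empty_of_le h, Finset.sum_empty]
    exact div_nonneg (hp n hn).le hε.le
  · calc _ ≤ ∑ k ∈ Finset.Ico n m, (φ k ^ (-ε) / ε - φ (k + 1) ^ (-ε) / ε) := by
          refine Finset.sum_le_sum fun k hk => ?_
          have hk' : N ≤ k := hn.trans (Finset.mem_Ico.1 hk).1
          rw [← sub_div]
          exact sub_mul_rpow_le_sub_rpow_neg (hφ k hk') (hm k hk') hε
      _ = φ n ^ (-ε) / ε - φ m ^ (-ε) / ε := by
          rw [Finset.sum_Ico_eq_sub _ h, Finset.sum_range_sub', Finset.sum_range_sub']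
          ring
      _ ≤ _ := by
          have := div_nonneg (hp m (hn.trans h)).le hε.le
          linarith

lemma sum_Ico_sub_mul_rpow_neg_le {W : ℕ → ℝ} {N : ℕ} (hW0 : ∀ k ≥ N, 0 ≤ W k)
    (hW : ∀ k ≥ N, W (k + 1) ≤ W k) {θ : ℝ} (hθ : 0 < θ) (hθ1 : θ < 1) {n : ℕ} (hn : N ≤ n)
    (m : ℕ) :
    ∑ k ∈ Finset.Ico n m, (W k - W (k + 1)) * W k ^ (-θ) ≤ W n ^ (1 - θ) / (1 - θ) := by
  have hp : ∀ k ≥ N, 0 ≤ W k ^ (1 - θ) / (1 - θ) := fun k hk =>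
    div_nonneg (Real.rpow_nonneg (hW0 k hk) _) (by linarith)
  rcases le_total m n with h | h
  · rw [Finset.Ico_eq_empty_of_le h, Finset.sum_empty]
    exact hp n hn
  · calc _ ≤ ∑ k ∈ Finset.Ico n m, (W k ^ (1 - θ) / (1 - θ) - W (k + 1) ^ (1 - θ) / (1 - θ)) := by
          refine Finset.sum_le_sum fun k hk => ?_
          have hk' : N ≤ k := hn.trans (Finset.mem_Ico.1 hk).1
          rw [← sub_div]
          exact sub_mul_rpow_neg_le_sub_rpow (hW0 k hk') (hW0 _ (by omega)) (hW k hk') hθ hθ1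
      _ = W n ^ (1 - θ) / (1 - θ) - W m ^ (1 - θ) / (1 - θ) := by
          rw [Finset.sum_Ico_eq_sub _ h, Finset.sum_range_sub', Finset.sum_range_sub']
          ring
      _ ≤ _ := by linarith [hp m (hn.trans h)]

/-! ### Summation and decay along a clock -/

/-- A clock: a positive nondecreasing sequence that at most doubles in one step. -/
structure IsClock (φ : ℕ → ℝ) (N : ℕ) : Prop where
  one_le : ∀ k ≥ N, 1 ≤ φ k
  mono : ∀ k ≥ N, φ k ≤ φ (k + 1)
  le_two_mul : ∀ k ≥ N, φ (k + 1) ≤ 2 * φ k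

lemma IsClock.pos {φ : ℕ → ℝ} {N : ℕ} (h : IsClock φ N) {k : ℕ} (hk : N ≤ k) : 0 < φ k :=
  one_pos.trans_le (h.one_le k hk)

/-- If `aₖ yₖ²` is dominated by the decrease of a sequence `W` of order `φ^{-w}`, then the tail sums
of `aₖ yₖ` are of order `φ^{-(w-(1-s))/2}`. -/
lemma sum_mul_le_of_decrease {a y W φ : ℕ → ℝ} {s w K C₁ C₂ : ℝ} {N : ℕ} (hs : s ≤ 1)
    (hw : 1 - s < w) (hφ : IsClock φ N) (hK : 0 ≤ K) (hC₁ : 0 ≤ C₁) (hC₂ : 0 < C₂)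
    (ha0 : ∀ k ≥ N, 0 ≤ a k)
    (ha : ∀ k ≥ N, a k ≤ C₁ * φ (k + 1) ^ (-s) * (φ (k + 1) - φ k))
    (hW0 : ∀ k ≥ N, 0 ≤ W k) (hWa : ∀ k ≥ N, W (k + 1) ≤ W k)
    (hWu : ∀ k ≥ N, W k ≤ C₂ * φ k ^ (-w))
    (hd : ∀ k ≥ N, a k * y k ^ 2 ≤ K * (W k - W (k + 1))) :
    ∃ C, 0 ≤ C ∧ ∀ n ≥ N, ∀ m, ∑ k ∈ Finset.Ico n m, a k * y k ≤
      C * φ n ^ (-((w - (1 - s)) / 2)) := by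
  have hw0 : 0 < w := by linarith
  set ε : ℝ := (w - (1 - s)) / 2 with hε
  have hε0 : 0 < ε := by rw [hε]; linarith
  -- `θ` is chosen so that `w (1 - θ) = ε` and `s + w θ = 1 + ε`: both telescoping sums below are
  -- then of order `φ ^ (-ε)`.
  set θ : ℝ := (w + (1 - s)) / (2 * w) with hθ
  have hθ0 : 0 < θ := by rw [hθ]; exact div_pos (by linarith) (by linarith)
  have hθ1 : θ < 1 := by rw [hθ, div_lt_one (by linarith)]; linarith
  have hwθ : w * θ = (w + (1 - s)) / 2 := by rw [hθ]; field_simp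
  have hw1θ : w * (1 - θ) = ε := by rw [mul_sub, hwθ, hε]; ring
  set H : ℕ → ℝ := fun k => C₂ * φ k ^ (-w) with hH
  have hHpos : ∀ k ≥ N, 0 < H k := fun k hk =>
    mul_pos hC₂ (Real.rpow_pos_of_pos (hφ.pos hk) _)
  have key : ∀ k ≥ N, a k * y k ≤ K * ((W k - W (k + 1)) * W k ^ (-θ)) +
      (C₁ * C₂ ^ θ * 2 ^ (w * θ)) * ((φ (k + 1) - φ k) * φ (k + 1) ^ (-(1 + ε))) := by
    intro k hk
    have hp := hφ.pos hk
    have hp1 : 0 < φ (k + 1) := hφ.pos (by omega)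
    have hHθ : 0 < H k ^ θ := Real.rpow_pos_of_pos (hHpos k hk) _
    -- AM-GM with weight `H ^ θ`: the quadratic part is paid by the decrease of `W`, the other part
    -- by the size of the step.
    have h1 : a k * y k ≤ a k * y k ^ 2 * H k ^ (-θ) + a k * H k ^ θ := by
      rw [Real.rpow_neg (hHpos k hk).le]
      have e1 : y k ≤ y k ^ 2 * (H k ^ θ)⁻¹ + H k ^ θ := by
        have : y k ^ 2 * (H k ^ θ)⁻¹ + H k ^ θ - y k
            = ((y k - H k ^ θ / 2) ^ 2 + 3 / 4 * (H k ^ θ) ^ 2) * (H k ^ θ)⁻¹ := by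
          field_simp; ring
        have h2 : 0 ≤ ((y k - H k ^ θ / 2) ^ 2 + 3 / 4 * (H k ^ θ) ^ 2) * (H k ^ θ)⁻¹ := by
          positivity
        linarith
      calc a k * y k ≤ a k * (y k ^ 2 * (H k ^ θ)⁻¹ + H k ^ θ) :=
            mul_le_mul_of_nonneg_left e1 (ha0 k hk)
        _ = _ := by ring
    have h2 : a k * y k ^ 2 * H k ^ (-θ) ≤ K * ((W k - W (k + 1)) * W k ^ (-θ)) := by
      -- At `W k = 0` the convention `0 ^ (-θ) = 0` breaks the comparison of powers, but then `W`
      -- can no longer decrease and `a k * y k ^ 2` vanishes.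
      rcases (hW0 k hk).eq_or_lt with h0 | h0
      · have : a k * y k ^ 2 = 0 := by
          apply le_antisymm _ (mul_nonneg (ha0 k hk) (sq_nonneg _))
          have h3 := hW0 (k + 1) (by omega)
          have h4 := hWa k hk
          have h5 : W k - W (k + 1) = 0 := by linarith
          have := hd k hk
          rwa [h5, mul_zero] at this
        rw [this, ← h0, Real.zero_rpow (by linarith)]; simp
      · have h3 : H k ^ (-θ) ≤ W k ^ (-θ) :=
          Real.rpow_le_rpow_of_nonpos h0 (hWu k hk) (by linarith)
        calc _ ≤ (K * (W k - W (k + 1))) * W k ^ (-θ) :=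
              mul_le_mul (hd k hk) h3 (Real.rpow_nonneg (hHpos k hk).le _)
                (mul_nonneg hK (by linarith [hWa k hk]))
          _ = _ := by ring
    have h3 : a k * H k ^ θ ≤ (C₁ * C₂ ^ θ * 2 ^ (w * θ)) *
        ((φ (k + 1) - φ k) * φ (k + 1) ^ (-(1 + ε))) := by
      have e1 : H k ^ θ ≤ C₂ ^ θ * (2 ^ (w * θ) * φ (k + 1) ^ (-(w * θ))) := by
        rw [hH]; dsimp only
        rw [Real.mul_rpow hC₂.le (Real.rpow_nonneg hp.le _), ← Real.rpow_mul hp.le]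
        refine mul_le_mul_of_nonneg_left ?_ (Real.rpow_nonneg hC₂.le _)
        rw [show -w * θ = -(w * θ) by ring]
        have : φ k ^ (-(w * θ)) ≤ (φ (k + 1) / 2) ^ (-(w * θ)) :=
          Real.rpow_le_rpow_of_nonpos (by linarith) (by linarith [hφ.le_two_mul k hk])
            (by have := mul_pos hw0 hθ0; linarith)
        refine this.trans (le_of_eq ?_)
        rw [Real.div_rpow hp1.le (by norm_num), Real.rpow_neg (by norm_num : (0 : ℝ) ≤ 2)]
        field_simp
      calc a k * H k ^ θ ≤ (C₁ * φ (k + 1) ^ (-s) * (φ (k + 1) - φ k)) *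
            (C₂ ^ θ * (2 ^ (w * θ) * φ (k + 1) ^ (-(w * θ)))) :=
            mul_le_mul (ha k hk) e1 hHθ.le ((ha0 k hk).trans (ha k hk))
        _ = _ := by
            rw [show -(1 + ε) = -s + -(w * θ) by rw [hwθ, hε]; ring, Real.rpow_add hp1]
            ring
    linarith
  refine ⟨K * (C₂ ^ (1 - θ) / (1 - θ)) + (C₁ * C₂ ^ θ * 2 ^ (w * θ)) / ε, ?_, fun n hn m => ?_⟩
  · have : 0 < 1 - θ := by linarith
    positivity
  calc _ ≤ ∑ k ∈ Finset.Ico n m, (K * ((W k - W (k + 1)) * W k ^ (-θ)) +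
      (C₁ * C₂ ^ θ * 2 ^ (w * θ)) * ((φ (k + 1) - φ k) * φ (k + 1) ^ (-(1 + ε)))) :=
        Finset.sum_le_sum fun k hk => key k (hn.trans (Finset.mem_Ico.1 hk).1)
    _ = K * ∑ k ∈ Finset.Ico n m, ((W k - W (k + 1)) * W k ^ (-θ)) +
      (C₁ * C₂ ^ θ * 2 ^ (w * θ)) *
        ∑ k ∈ Finset.Ico n m, ((φ (k + 1) - φ k) * φ (k + 1) ^ (-(1 + ε))) := by
        rw [Finset.sum_add_distrib, Finset.mul_sum, Finset.mul_sum]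
    _ ≤ K * (W n ^ (1 - θ) / (1 - θ)) + (C₁ * C₂ ^ θ * 2 ^ (w * θ)) * (φ n ^ (-ε) / ε) := by
        gcongr
        · exact sum_Ico_sub_mul_rpow_neg_le hW0 hWa hθ0 hθ1 hn m
        · exact sum_Ico_sub_mul_rpow_le (fun k hk => hφ.pos hk) hφ.mono hε0 hn m
    _ ≤ K * (C₂ ^ (1 - θ) * φ n ^ (-ε) / (1 - θ)) +
        (C₁ * C₂ ^ θ * 2 ^ (w * θ)) * (φ n ^ (-ε) / ε) := by
        gcongr
        · calc W n ^ (1 - θ) ≤ (C₂ * φ n ^ (-w)) ^ (1 - θ) :=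
              Real.rpow_le_rpow (hW0 n hn) (hWu n hn) (by linarith)
            _ = _ := by
              rw [Real.mul_rpow hC₂.le (Real.rpow_nonneg (hφ.pos hn).le _),
                ← Real.rpow_mul (hφ.pos hn).le, neg_mul, hw1θ]
    _ = _ := by ring

/-- Decay of a sequence that satisfies a perturbed nonlinear differential inequality. -/
lemma decay_of_pow {a W T φ : ℕ → ℝ} {s w p κ c A : ℝ} {N : ℕ}
    (hφ : IsClock φ N) (hκ : 0 < κ) (hc : 0 < c) (hw : 0 < w) (hp : 1 < p)
    (hpw : w * (p - 1) ≤ 1 - s)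
    (ha : ∀ k ≥ N, c * φ (k + 1) ^ (-s) * (φ (k + 1) - φ k) ≤ a k) (hs : 0 ≤ s)
    (hT : ∀ k ≥ N, |T k| ≤ A * φ k ^ (-w))
    (hWa : ∀ k ≥ N, W (k + 1) ≤ W k)
    (hd : ∀ k ≥ N, κ * a k * |W k - T k| ^ p ≤ W k - W (k + 1)) :
    ∃ B > 0, ∀ k ≥ N, W k ≤ B * φ k ^ (-w) := by
  obtain ⟨B₀, hB₀⟩ : ∃ B₀, B₀ = w * 2 ^ w * 2 ^ s * (2 ^ w * 2) ^ p / (κ * c) := ⟨_, rfl⟩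
  have hB₀pos : 0 ≤ B₀ := by rw [hB₀]; positivity
  -- Besides `1`, the entries serve to dominate the perturbation `T`, to start the induction, and to
  -- let the drift beat the decrease of `φ ^ (-w)`.
  set B := max (max 1 (2 * 2 ^ w * A)) (max (W N * φ N ^ w) (B₀ ^ (1 / (p - 1)))) with hB
  have hB1 : 1 ≤ B := (le_max_left _ _).trans (le_max_left _ _)
  have hBpos : 0 < B := one_pos.trans_le hB1
  have hBA : 2 * 2 ^ w * A ≤ B := (le_max_right _ _).trans (le_max_left _ _)
  have hBW : W N * φ N ^ w ≤ B := (le_max_left _ _).trans (le_max_right _ _)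
  have hBB : B₀ ≤ B ^ (p - 1) := by
    have h1 : B₀ ^ (1 / (p - 1)) ≤ B := (le_max_right _ _).trans (le_max_right _ _)
    calc B₀ = (B₀ ^ (1 / (p - 1))) ^ (p - 1) := by
          rw [← Real.rpow_mul hB₀pos, one_div, inv_mul_cancel₀ (by linarith), Real.rpow_one]
      _ ≤ _ := Real.rpow_le_rpow (Real.rpow_nonneg hB₀pos _) h1 (by linarith)
  refine ⟨B, hBpos, fun k hk => ?_⟩
  induction k, hk using Nat.le_induction with
  | base =>
    rw [Real.rpow_neg (hφ.pos le_rfl).le, ← div_eq_mul_inv,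
      le_div_iff₀ (Real.rpow_pos_of_pos (hφ.pos le_rfl) _)]
    exact hBW
  | succ k hk ih =>
    have hp0 := hφ.pos hk
    have hp1 : 0 < φ (k + 1) := hφ.pos (by omega)
    set D := φ k ^ (-w) with hD
    have hDpos : 0 < D := Real.rpow_pos_of_pos hp0 _
    set D' := φ (k + 1) ^ (-w) with hD'
    have hDD : D ≤ 2 ^ w * D' := by
      have : D ≤ (φ (k + 1) / 2) ^ (-w) :=
        Real.rpow_le_rpow_of_nonpos (by linarith) (by linarith [hφ.le_two_mul k hk])
          (by linarith)
      refine this.trans (le_of_eq ?_)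
      rw [Real.div_rpow hp1.le (by norm_num), Real.rpow_neg (by norm_num : (0 : ℝ) ≤ 2), hD']
      field_simp
    have h2w : (0 : ℝ) < 2 ^ w := by positivity
    -- If `W k` is already `2 ^ w` times below its bound, monotonicity suffices, since one step of
    -- the clock divides `φ ^ (-w)` by at most `2 ^ w`.
    rcases le_or_gt (2 ^ w * W k) (B * D) with h | h
    · have h1 : 2 ^ w * W k ≤ 2 ^ w * (B * D') := by
        calc _ ≤ B * D := h
          _ ≤ B * (2 ^ w * D') := by gcongr
          _ = _ := by ring
      exact (hWa k hk).trans (le_of_mul_le_mul_left h1 h2w)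
    · -- the drift dominates the perturbation
      have hTk := hT k hk
      have hWT : 2 * |T k| ≤ W k := by
        have : 2 ^ w * (2 * |T k|) ≤ 2 ^ w * W k := by
          calc 2 ^ w * (2 * |T k|) ≤ 2 ^ w * (2 * (A * D)) := by gcongr
            _ = (2 * 2 ^ w * A) * D := by ring
            _ ≤ B * D := by gcongr
            _ ≤ _ := h.le
        exact le_of_mul_le_mul_left this h2w
      have hWT2 : B * D / (2 ^ w * 2) ≤ |W k - T k| := by
        have h1 : W k / 2 ≤ |W k - T k| := by
          have := le_abs_self (W k - T k)
          have := le_abs_self (T k)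
          have := abs_nonneg (T k)
          linarith
        refine le_trans ?_ h1
        rw [div_le_div_iff₀ (by positivity) (by norm_num)]
        linarith
      have hdrop : B * (D - D') ≤ κ * a k * |W k - T k| ^ p := by
        have e1 : D - D' ≤ w * ((φ (k + 1) - φ k) * (2 ^ w * D' / φ k)) := by
          have hb := one_add_mul_one_sub_le_rpow_neg (t := φ (k + 1) / φ k) (div_pos hp1 hp0) hw.le
          rw [Real.div_rpow hp1.le hp0.le] at hb
          change _ ≤ D' / D at hb
          rw [le_div_iff₀ hDpos] at hb
          have : D - D' ≤ w * ((φ (k + 1) - φ k) * (D / φ k)) := by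
            have : (1 + w * (1 - φ (k + 1) / φ k)) * D
                = D - w * ((φ (k + 1) - φ k) * (D / φ k)) := by
              field_simp; ring
            linarith
          refine this.trans ?_
          have : 0 ≤ φ (k + 1) - φ k := by linarith [hφ.mono k hk]
          gcongr
        have e2 : (B * D / (2 ^ w * 2)) ^ p ≤ |W k - T k| ^ p :=
          Real.rpow_le_rpow (by positivity) hWT2 (by linarith)
        have hΔ : 0 ≤ φ (k + 1) - φ k := by linarith [hφ.mono k hk]
        have e3 : 2 ^ w * D' / φ k ≤ 2 ^ w * (D / φ k) := by
          rw [mul_div_assoc]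
          have : D' ≤ D := Real.rpow_le_rpow_of_nonpos hp0 (hφ.mono k hk) (by linarith)
          gcongr
        -- Here `w (p - 1) ≤ 1 - s` enters: the target `φ ^ (-w)` decreases no faster than the
        -- drift, of order `φ ^ (-s) * φ ^ (-w p)` per unit of clock.
        have e4 : D / φ k ≤ 2 ^ s * φ (k + 1) ^ (-s) * D ^ p := by
          have f1 : φ k ^ (-s) ≤ 2 ^ s * φ (k + 1) ^ (-s) := by
            have : φ k ^ (-s) ≤ (φ (k + 1) / 2) ^ (-s) :=
              Real.rpow_le_rpow_of_nonpos (by linarith) (by linarith [hφ.le_two_mul k hk])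
                (by linarith)
            refine this.trans (le_of_eq ?_)
            rw [Real.div_rpow hp1.le (by norm_num), Real.rpow_neg (by norm_num : (0 : ℝ) ≤ 2)]
            field_simp
          calc D / φ k = φ k ^ (-w - 1) := by rw [Real.rpow_sub_one hp0.ne']
            _ ≤ φ k ^ (-s + -w * p) :=
                Real.rpow_le_rpow_of_exponent_le (hφ.one_le k hk) (by linarith)
            _ = φ k ^ (-s) * D ^ p := by
                rw [Real.rpow_add hp0, hD, ← Real.rpow_mul hp0.le]
            _ ≤ _ := by gcongr
        have e5 : (B * D / (2 ^ w * 2)) ^ p = B * B ^ (p - 1) * D ^ p / (2 ^ w * 2) ^ p := by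
          rw [Real.div_rpow (by positivity) (by positivity), Real.mul_rpow hBpos.le hDpos.le,
            Real.rpow_sub_one hBpos.ne']
          field_simp
        calc B * (D - D') ≤ B * (w * ((φ (k + 1) - φ k) * (2 ^ w *
              (2 ^ s * φ (k + 1) ^ (-s) * D ^ p)))) := by
                gcongr
                refine e1.trans ?_
                gcongr
                refine e3.trans ?_
                gcongr
          _ = B * B₀ * (κ * (c * φ (k + 1) ^ (-s) * (φ (k + 1) - φ k))) *
                D ^ p / (2 ^ w * 2) ^ p := by
                rw [hB₀]; field_simp
          _ ≤ B * B ^ (p - 1) * (κ * a k) * D ^ p / (2 ^ w * 2) ^ p := by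
                gcongr
                exact ha k hk
          _ = κ * a k * (B * D / (2 ^ w * 2)) ^ p := by rw [e5]; ring
          _ ≤ _ := by
                have : 0 ≤ a k := le_trans (by positivity) (ha k hk)
                gcongr
      have := hd k hk
      nlinarith

/-- Decay of a sequence that satisfies a perturbed linear differential inequality, for steps
of order `1/k`. -/
lemma decay_of_linear {a W T : ℕ → ℝ} {τ c g A : ℝ} (hτ : 0 < τ) (hA : 0 ≤ A)
    (ha : Tendsto (fun k : ℕ => ((k : ℝ) + 1) * a k) atTop (𝓝 g)) (hg : τ < c * g)
    (hT : ∀ᶠ k : ℕ in atTop, |T k| ≤ A * ((k : ℝ) + 1) ^ (-τ))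
    (hW0 : ∀ᶠ k : ℕ in atTop, 0 ≤ W k)
    (hd : ∀ᶠ k : ℕ in atTop, c * a k * (W k - |T k|) ≤ W k - W (k + 1)) :
    ∃ B > 0, ∀ᶠ k : ℕ in atTop, W k ≤ B * ((k : ℝ) + 1) ^ (-τ) := by
  -- The excess of `c * g` over `τ` must pay for the perturbation, after `τ / (k + 1)` has paid for
  -- the relative decrease of the target power; `η` measures this slack.
  obtain ⟨η, hη, hηg⟩ : ∃ η > 0, τ + 2 * η < c * g :=
    ⟨(c * g - τ) / 4, by linarith, by linarith⟩
  have h1 : Tendsto (fun k : ℕ => c * (((k : ℝ) + 1) * a k)) atTop (𝓝 (c * g)) :=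
    ha.const_mul c
  have h2 : ∀ᶠ k : ℕ in atTop, τ + 2 * η < c * (((k : ℝ) + 1) * a k) :=
    h1.eventually (lt_mem_nhds hηg)
  have h3 : ∀ᶠ k : ℕ in atTop, c * (((k : ℝ) + 1) * a k) < c * g + 1 :=
    h1.eventually (gt_mem_nhds (by linarith))
  have h4 : ∀ᶠ k : ℕ in atTop, c * g + 1 < (k : ℝ) + 1 := by
    have : Tendsto (fun k : ℕ => (k : ℝ) + 1) atTop atTop :=
      tendsto_atTop_add_const_right _ _ tendsto_natCast_atTop_atTop
    exact this.eventually_gt_atTop _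
  obtain ⟨N, hN⟩ := eventually_atTop.1 ((((h2.and h3).and h4).and hT).and (hW0.and hd))
  set B := max (max 1 ((c * g + 1) * A / η)) (W N * ((N : ℝ) + 1) ^ τ) with hB
  have hB1 : 1 ≤ B := (le_max_left _ _).trans (le_max_left _ _)
  have hBA : (c * g + 1) * A / η ≤ B := (le_max_right _ _).trans (le_max_left _ _)
  have hBW : W N * ((N : ℝ) + 1) ^ τ ≤ B := le_max_right _ _
  refine ⟨B, one_pos.trans_le hB1, eventually_atTop.2 ⟨N, fun k hk => ?_⟩⟩
  induction k, hk using Nat.le_induction with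
  | base =>
    have : (0 : ℝ) < (N : ℝ) + 1 := by positivity
    rw [Real.rpow_neg this.le, ← div_eq_mul_inv, le_div_iff₀ (Real.rpow_pos_of_pos this _)]
    exact hBW
  | succ k hk ih =>
    obtain ⟨⟨⟨⟨f1, f2⟩, f3⟩, f4⟩, f5, f6⟩ := hN k hk
    have hk0 : (0 : ℝ) < (k : ℝ) + 1 := by positivity
    set D := ((k : ℝ) + 1) ^ (-τ) with hD
    have hDpos : 0 < D := Real.rpow_pos_of_pos hk0 _
    set u := c * a k with hu
    have hu1 : (τ + 2 * η) / (k + 1) < u := by rw [div_lt_iff₀ hk0]; linarith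
    have hu2 : u < (c * g + 1) / (k + 1) := by rw [lt_div_iff₀ hk0]; linarith
    have hu3 : u < 1 := hu2.trans ((div_lt_one hk0).2 f3)
    have hu0 : 0 < u := lt_trans (by positivity) hu1
    -- Since `0 < u < 1`, the new value is below a convex combination of `W k` and `|T k|`, and both
    -- bounds can be inserted.
    have e1 : W (k + 1) ≤ (1 - u) * (B * D) + u * (A * D) := by
      have : W (k + 1) ≤ (1 - u) * W k + u * |T k| := by nlinarith
      refine this.trans ?_
      gcongr
    have e2 : D * (1 - τ / (k + 1)) ≤ (((k + 1 : ℕ) : ℝ) + 1) ^ (-τ) := by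
      have hk1 : (0 : ℝ) < ((k + 1 : ℕ) : ℝ) + 1 := by positivity
      have hb := one_add_mul_one_sub_le_rpow_neg
        (t := (((k + 1 : ℕ) : ℝ) + 1) / ((k : ℝ) + 1)) (div_pos hk1 hk0) hτ.le
      rw [Real.div_rpow hk1.le hk0.le, le_div_iff₀ hDpos] at hb
      refine le_trans (le_of_eq ?_) hb
      push_cast
      field_simp
      ring
    refine e1.trans (le_trans ?_ (mul_le_mul_of_nonneg_left e2 (by linarith)))
    have e3 : u * A ≤ B * η / (k + 1) := by
      calc u * A ≤ (c * g + 1) / (k + 1) * A := by gcongr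
        _ = ((c * g + 1) * A / η) * (η / (k + 1)) := by field_simp
        _ ≤ B * (η / (k + 1)) := by gcongr
        _ = _ := by ring
    have e4 : B * ((τ + 2 * η) / (k + 1)) ≤ B * u := by gcongr
    have e5 : (1 - u) * B + u * A ≤ B * (1 - τ / (k + 1)) := by
      have : B * ((τ + 2 * η) / (k + 1)) = B * (τ / (k + 1)) + 2 * (B * η / (k + 1)) := by ring
      have : 0 ≤ B * η / (k + 1) := by positivity
      nlinarith
    calc _ = ((1 - u) * B + u * A) * D := by ring
      _ ≤ B * (1 - τ / (k + 1)) * D := by gcongr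
      _ = _ := by ring

end

section

/-! ### Clocks and steps -/

/-- Steps of exact order `(k+1)^{-s}`. -/
structure StepBounds (a : ℕ → ℝ) (s c₁ c₂ : ℝ) : Prop where
  pos : 0 < c₁
  lower : ∀ k : ℕ, c₁ * ((k : ℝ) + 1) ^ (-s) ≤ a k
  upper : ∀ k : ℕ, a k ≤ c₂ * ((k : ℝ) + 1) ^ (-s)

lemma StepBounds.step_pos {a : ℕ → ℝ} {s c₁ c₂ : ℝ} (h : StepBounds a s c₁ c₂) (k : ℕ) :
    0 < a k :=
  lt_of_lt_of_le (mul_pos h.pos (Real.rpow_pos_of_pos (by positivity) _)) (h.lower k)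

lemma StepBounds.upper_pos {a : ℕ → ℝ} {s c₁ c₂ : ℝ} (h : StepBounds a s c₁ c₂) : 0 < c₂ := by
  have h1 := (h.step_pos 0).trans_le (h.upper 0)
  simpa using h1

lemma isClock_add_one : IsClock (fun k : ℕ => (k : ℝ) + 1) 0 where
  one_le k _ := by simp
  mono k _ := by push_cast; linarith
  le_two_mul k _ := by push_cast; have : (0 : ℝ) ≤ k := by positivity
                       linarith

lemma isClock_log : IsClock (fun k : ℕ => Real.log ((k : ℝ) + 2)) 1 where
  one_le k hk := by
    have hk' : (1 : ℝ) ≤ k := by exact_mod_cast hk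
    rw [Real.le_log_iff_exp_le (by linarith)]
    linarith [Real.exp_one_lt_d9]
  mono k _ := Real.log_le_log (by positivity) (by push_cast; linarith)
  le_two_mul k hk := by
    have hk' : (1 : ℝ) ≤ k := by exact_mod_cast hk
    rw [show 2 * Real.log ((k : ℝ) + 2) = Real.log (((k : ℝ) + 2) ^ 2) by
      rw [Real.log_pow]; norm_num]
    refine Real.log_le_log (by positivity) ?_
    push_cast
    nlinarith

/-- The last factor is the unit increment of the clock `k + 1`, kept in the shape that
`sum_mul_le_of_decrease` requires; `2 ^ s` pays for the shift of the index. -/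
lemma StepBounds.le_add_one {a : ℕ → ℝ} {s c₁ c₂ : ℝ} (h : StepBounds a s c₁ c₂) (hs : 0 ≤ s)
    (k : ℕ) : a k ≤ (c₂ * 2 ^ s) * (((k + 1 : ℕ) : ℝ) + 1) ^ (-s) *
      ((((k + 1 : ℕ) : ℝ) + 1) - ((k : ℝ) + 1)) := by
  have e : (((k + 1 : ℕ) : ℝ) + 1) - ((k : ℝ) + 1) = 1 := by push_cast; ring
  rw [e, mul_one]
  refine (h.upper k).trans ?_
  rw [mul_assoc]
  refine mul_le_mul_of_nonneg_left ?_ h.upper_pos.le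
  have h1 : ((k : ℝ) + 1) ^ (-s) ≤ ((((k + 1 : ℕ) : ℝ) + 1) / 2) ^ (-s) :=
    Real.rpow_le_rpow_of_nonpos (by positivity)
      (by push_cast; have : (0 : ℝ) ≤ k := by positivity
          linarith) (by linarith)
  refine h1.trans (le_of_eq ?_)
  rw [Real.div_rpow (by positivity) (by norm_num), Real.rpow_neg (by norm_num : (0 : ℝ) ≤ 2)]
  field_simp

lemma StepBounds.add_one_le {a : ℕ → ℝ} {s c₁ c₂ : ℝ} (h : StepBounds a s c₁ c₂) (hs : 0 ≤ s)
    (k : ℕ) : c₁ * (((k + 1 : ℕ) : ℝ) + 1) ^ (-s) *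
      ((((k + 1 : ℕ) : ℝ) + 1) - ((k : ℝ) + 1)) ≤ a k := by
  have e : (((k + 1 : ℕ) : ℝ) + 1) - ((k : ℝ) + 1) = 1 := by push_cast; ring
  rw [e, mul_one]
  refine le_trans ?_ (h.lower k)
  refine mul_le_mul_of_nonneg_left ?_ h.pos.le
  exact Real.rpow_le_rpow_of_nonpos (by positivity) (by push_cast; linarith) (by linarith)

/-- Steps of order `1 / k` are comparable to the increments of the clock `log (k + 2)`: on this
clock the case `s = 1` plays the role of the exponent `0`. -/
lemma log_sub_log_bounds (k : ℕ) :
    1 / ((k : ℝ) + 3) ≤ Real.log (((k + 1 : ℕ) : ℝ) + 2) - Real.log ((k : ℝ) + 2) ∧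
    Real.log (((k + 1 : ℕ) : ℝ) + 2) - Real.log ((k : ℝ) + 2) ≤ 1 / ((k : ℝ) + 2) := by
  have h2 : (0 : ℝ) < (k : ℝ) + 2 := by positivity
  have h3 : (0 : ℝ) < ((k + 1 : ℕ) : ℝ) + 2 := by positivity
  rw [← Real.log_div h3.ne' h2.ne']
  constructor
  · have := Real.one_sub_inv_le_log_of_pos (div_pos h3 h2)
    refine le_trans (le_of_eq ?_) this
    push_cast
    field_simp
    ring
  · have := Real.log_le_sub_one_of_pos (div_pos h3 h2)
    refine this.trans (le_of_eq ?_)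
    push_cast
    field_simp
    ring

lemma StepBounds.le_log {a : ℕ → ℝ} {c₁ c₂ : ℝ} (h : StepBounds a 1 c₁ c₂) (k : ℕ) :
    a k ≤ (3 * c₂) * Real.log (((k + 1 : ℕ) : ℝ) + 2) ^ (-(0 : ℝ)) *
      (Real.log (((k + 1 : ℕ) : ℝ) + 2) - Real.log ((k : ℝ) + 2)) := by
  rw [neg_zero, Real.rpow_zero, mul_one]
  have h1 := (log_sub_log_bounds k).1
  have h2 := h.upper k
  have h3 := h.upper_pos
  rw [Real.rpow_neg_one] at h2
  refine h2.trans (le_trans ?_ (mul_le_mul_of_nonneg_left h1 (by positivity)))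
  have : (0 : ℝ) ≤ k := by positivity
  rw [← div_eq_mul_inv, mul_one_div, div_le_div_iff₀ (by positivity) (by positivity)]
  nlinarith

lemma StepBounds.log_le {a : ℕ → ℝ} {c₁ c₂ : ℝ} (h : StepBounds a 1 c₁ c₂) (k : ℕ) :
    c₁ * Real.log (((k + 1 : ℕ) : ℝ) + 2) ^ (-(0 : ℝ)) *
      (Real.log (((k + 1 : ℕ) : ℝ) + 2) - Real.log ((k : ℝ) + 2)) ≤ a k := by
  rw [neg_zero, Real.rpow_zero, mul_one]
  have h1 := (log_sub_log_bounds k).2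
  have h2 := h.lower k
  rw [Real.rpow_neg_one] at h2
  refine le_trans (mul_le_mul_of_nonneg_left h1 h.pos.le) (le_trans ?_ h2)
  refine mul_le_mul_of_nonneg_left ?_ h.pos.le
  rw [one_div]
  exact inv_anti₀ (by positivity) (by linarith)

/-- Powers of `k + 1` decay faster than powers of `log (k + 2)`. -/
lemma exists_rpow_neg_le_log {τ w : ℝ} (hτ : 0 < τ) (hw : 0 < w) :
    ∃ C > 0, ∀ k : ℕ, ((k : ℝ) + 1) ^ (-τ) ≤ C * Real.log ((k : ℝ) + 2) ^ (-w) := by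
  refine ⟨(2 / (τ / w)) ^ w * 2 ^ τ, by positivity, fun k => ?_⟩
  have hk0 : (0 : ℝ) < (k : ℝ) + 1 := by positivity
  have hk2 : (0 : ℝ) < (k : ℝ) + 2 := by positivity
  have hl : 0 < Real.log ((k : ℝ) + 2) := Real.log_pos (by linarith)
  have h1 : Real.log ((k : ℝ) + 2) ≤ ((k : ℝ) + 2) ^ (τ / w) / (τ / w) :=
    Real.log_le_rpow_div hk2.le (by positivity)
  have h2 : Real.log ((k : ℝ) + 2) ^ w ≤ (1 / (τ / w)) ^ w * ((k : ℝ) + 2) ^ τ := by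
    calc _ ≤ (((k : ℝ) + 2) ^ (τ / w) / (τ / w)) ^ w := Real.rpow_le_rpow hl.le h1 hw.le
      _ = _ := by
        rw [div_eq_inv_mul, Real.mul_rpow (by positivity) (by positivity),
          ← Real.rpow_mul hk2.le, div_mul_cancel₀ _ hw.ne', one_div]
  have h3 : ((k : ℝ) + 2) ^ τ ≤ 2 ^ τ * ((k : ℝ) + 1) ^ τ := by
    rw [← Real.mul_rpow (by norm_num) hk0.le]
    refine Real.rpow_le_rpow hk2.le ?_ hτ.le
    have : (0 : ℝ) ≤ k := by positivity
    linarith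
  have h4 : (1 / (τ / w)) ^ w ≤ (2 / (τ / w)) ^ w := by gcongr; norm_num
  rw [Real.rpow_neg hk0.le, Real.rpow_neg hl.le, ← div_eq_mul_inv,
    le_div_iff₀ (Real.rpow_pos_of_pos hl _), inv_mul_le_iff₀ (Real.rpow_pos_of_pos hk0 _)]
  calc _ ≤ (1 / (τ / w)) ^ w * ((k : ℝ) + 2) ^ τ := h2
    _ ≤ (2 / (τ / w)) ^ w * (2 ^ τ * ((k : ℝ) + 1) ^ τ) := by gcongr
    _ = _ := by ring

/-! ### Series with a rate of convergence -/

/-- The series `∑ aₖ` converges and its tails are of order `n^{-τ}`. -/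
def HasTail (a : ℕ → ℝ) (τ : ℝ) : Prop :=
  ∃ l C : ℝ, ∀ n : ℕ, |∑ k ∈ Finset.range n, a k - l| ≤ C * ((n : ℝ) + 1) ^ (-τ)

lemma tendsto_add_one_rpow_neg {τ : ℝ} (hτ : 0 < τ) :
    Tendsto (fun n : ℕ => ((n : ℝ) + 1) ^ (-τ)) atTop (𝓝 0) :=
  (tendsto_rpow_neg_atTop hτ).comp
    (tendsto_atTop_add_const_right _ _ tendsto_natCast_atTop_atTop)

lemma HasTail.add {a b : ℕ → ℝ} {τ : ℝ} (ha : HasTail a τ) (hb : HasTail b τ) :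
    HasTail (fun k => a k + b k) τ := by
  obtain ⟨l, C, h⟩ := ha
  obtain ⟨l', C', h'⟩ := hb
  refine ⟨l + l', C + C', fun n => ?_⟩
  rw [Finset.sum_add_distrib, add_mul]
  calc _ = |(∑ k ∈ Finset.range n, a k - l) + (∑ k ∈ Finset.range n, b k - l')| := by
        congr 1; ring
    _ ≤ _ := (abs_add_le _ _).trans (add_le_add (h n) (h' n))

lemma HasTail.const_mul {a : ℕ → ℝ} {τ : ℝ} (ha : HasTail a τ) (c : ℝ) :
    HasTail (fun k => c * a k) τ := by
  obtain ⟨l, C, h⟩ := ha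
  refine ⟨c * l, |c| * C, fun n => ?_⟩
  rw [← Finset.mul_sum, ← mul_sub, abs_mul, mul_assoc]
  exact mul_le_mul_of_nonneg_left (h n) (abs_nonneg _)

lemma HasTail.abs_sum_Ico_le {a : ℕ → ℝ} {τ : ℝ} (hτ : 0 ≤ τ) (ha : HasTail a τ) :
    ∃ C > 0, ∀ n m : ℕ, n ≤ m → |∑ k ∈ Finset.Ico n m, a k| ≤ C * ((n : ℝ) + 1) ^ (-τ) := by
  obtain ⟨l, C, h⟩ := ha
  refine ⟨2 * |C| + 1, by positivity, fun n m hnm => ?_⟩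
  have hm : ((m : ℝ) + 1) ^ (-τ) ≤ ((n : ℝ) + 1) ^ (-τ) :=
    Real.rpow_le_rpow_of_nonpos (by positivity) (by gcongr) (by linarith)
  have hn0 : 0 ≤ ((n : ℝ) + 1) ^ (-τ) := Real.rpow_nonneg (by positivity) _
  have hm0 : 0 ≤ ((m : ℝ) + 1) ^ (-τ) := Real.rpow_nonneg (by positivity) _
  rw [Finset.sum_Ico_eq_sub _ hnm]
  have h1 : |∑ k ∈ Finset.range n, a k - l| ≤ |C| * ((n : ℝ) + 1) ^ (-τ) :=
    (h n).trans (mul_le_mul_of_nonneg_right (le_abs_self _) hn0)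
  have h2 : |∑ k ∈ Finset.range m, a k - l| ≤ |C| * ((n : ℝ) + 1) ^ (-τ) :=
    (h m).trans ((mul_le_mul_of_nonneg_right (le_abs_self _) hm0).trans
      (mul_le_mul_of_nonneg_left hm (abs_nonneg _)))
  calc _ = |(∑ k ∈ Finset.range m, a k - l) - (∑ k ∈ Finset.range n, a k - l)| := by
        congr 1; ring
    _ ≤ _ := abs_sub _ _
    _ ≤ _ := by nlinarith

/-- Cauchy's criterion; the limit exists because the bound tends to zero, and the tail estimate
follows by sending the upper end to infinity. -/
lemma hasTail_of_abs_sum_Ico_le {a : ℕ → ℝ} {τ C : ℝ} (hτ : 0 < τ)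
    (h : ∀ n m : ℕ, n ≤ m → |∑ k ∈ Finset.Ico n m, a k| ≤ C * ((n : ℝ) + 1) ^ (-τ)) :
    HasTail a τ := by
  have h0 : Tendsto (fun n : ℕ => C * ((n : ℝ) + 1) ^ (-τ)) atTop (𝓝 0) := by
    simpa using (tendsto_add_one_rpow_neg hτ).const_mul C
  have hC : CauchySeq fun n => ∑ k ∈ Finset.range n, a k := by
    refine cauchySeq_of_le_tendsto_0' _ (fun n m hnm => ?_) h0
    rw [dist_comm, Real.dist_eq, ← Finset.sum_Ico_eq_sub _ hnm]
    exact h n m hnm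
  obtain ⟨l, hl⟩ := cauchySeq_tendsto_of_complete hC
  refine ⟨l, C, fun n => ?_⟩
  have h1 : Tendsto (fun m => |∑ k ∈ Finset.range n, a k - ∑ k ∈ Finset.range m, a k|) atTop
      (𝓝 |∑ k ∈ Finset.range n, a k - l|) := (tendsto_const_nhds.sub hl).abs
  refine le_of_tendsto h1 (eventually_atTop.2 ⟨n, fun m hnm => ?_⟩)
  rw [abs_sub_comm, ← Finset.sum_Ico_eq_sub _ hnm]
  exact h n m hnm

lemma HasTail.of_abs_le {a b : ℕ → ℝ} {τ : ℝ} (hτ : 0 < τ) (hb : HasTail b τ)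
    (h : ∀ k, |a k| ≤ b k) : HasTail a τ := by
  obtain ⟨C, -, hC⟩ := hb.abs_sum_Ico_le hτ.le
  refine hasTail_of_abs_sum_Ico_le (C := C) hτ fun n m hnm => ?_
  calc _ ≤ ∑ k ∈ Finset.Ico n m, |a k| := Finset.abs_sum_le_sum_abs _ _
    _ ≤ ∑ k ∈ Finset.Ico n m, b k := Finset.sum_le_sum fun k _ => h k
    _ ≤ _ := (le_abs_self _).trans (hC n m hnm)

lemma hasTail_rpow {τ : ℝ} (hτ : 0 < τ) : HasTail (fun k : ℕ => ((k : ℝ) + 1) ^ (-(1 + τ))) τ := by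
  refine hasTail_of_abs_sum_Ico_le (C := 2 ^ (1 + τ) / τ) hτ fun n m _ => ?_
  rw [abs_of_nonneg (Finset.sum_nonneg fun k _ => Real.rpow_nonneg (by positivity) _)]
  have h1 := sum_Ico_sub_mul_rpow_le (φ := fun k : ℕ => (k : ℝ) + 1) (N := 0)
    (fun k hk => by positivity) (fun k hk => by push_cast; linarith) hτ (Nat.zero_le n) m
  calc _ ≤ ∑ k ∈ Finset.Ico n m, 2 ^ (1 + τ) * (((((k + 1 : ℕ) : ℝ) + 1) - ((k : ℝ) + 1)) *
        (((k + 1 : ℕ) : ℝ) + 1) ^ (-(1 + τ))) := by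
        refine Finset.sum_le_sum fun k _ => ?_
        have e : (((k + 1 : ℕ) : ℝ) + 1) - ((k : ℝ) + 1) = 1 := by push_cast; ring
        rw [e, one_mul]
        have h1 : ((k : ℝ) + 1) ^ (-(1 + τ)) ≤ ((((k + 1 : ℕ) : ℝ) + 1) / 2) ^ (-(1 + τ)) :=
          Real.rpow_le_rpow_of_nonpos (by positivity)
            (by push_cast; have : (0 : ℝ) ≤ k := by positivity
                linarith) (by linarith)
        refine h1.trans (le_of_eq ?_)
        rw [Real.div_rpow (by positivity) (by norm_num),
          Real.rpow_neg (by norm_num : (0 : ℝ) ≤ 2)]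
        field_simp
    _ ≤ 2 ^ (1 + τ) * (((n : ℝ) + 1) ^ (-τ) / τ) := by
        rw [← Finset.mul_sum]
        gcongr
    _ = _ := by ring

/-- Abel summation: the sum is rewritten with the partial sums of `b` and the nonnegative decrements
of `p`, which together with the last weight add up to `p n`. -/
lemma abs_sum_Ico_mul_le {p b : ℕ → ℝ} {n : ℕ} {D : ℝ} (hp : ∀ k, 0 ≤ p k)
    (hpa : ∀ k, p (k + 1) ≤ p k) (hD : ∀ j, |∑ k ∈ Finset.Ico n j, b k| ≤ D) {m : ℕ} (hnm : n ≤ m) :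
    |∑ k ∈ Finset.Ico n m, p k * b k| ≤ D * p n := by
  have key : ∑ k ∈ Finset.Ico n m, p k * b k = p m * ∑ k ∈ Finset.Ico n m, b k +
      ∑ k ∈ Finset.Ico n m, (p k - p (k + 1)) * ∑ i ∈ Finset.Ico n (k + 1), b i := by
    induction m, hnm using Nat.le_induction with
    | base => simp
    | succ m hm ih =>
      rw [Finset.sum_Ico_succ_top hm, ih, Finset.sum_Ico_succ_top hm (fun k =>
        (p k - p (k + 1)) * ∑ i ∈ Finset.Ico n (k + 1), b i), Finset.sum_Ico_succ_top hm b]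
      ring
  rw [key]
  calc _ ≤ |p m * ∑ k ∈ Finset.Ico n m, b k| +
        |∑ k ∈ Finset.Ico n m, (p k - p (k + 1)) * ∑ i ∈ Finset.Ico n (k + 1), b i| :=
        abs_add_le _ _
    _ ≤ p m * D + ∑ k ∈ Finset.Ico n m, (p k - p (k + 1)) * D := by
        refine add_le_add ?_ ((Finset.abs_sum_le_sum_abs _ _).trans
          (Finset.sum_le_sum fun k _ => ?_))
        · rw [abs_mul, abs_of_nonneg (hp m)]
          exact mul_le_mul_of_nonneg_left (hD m) (hp m)
        · rw [abs_mul, abs_of_nonneg (by linarith [hpa k])]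
          exact mul_le_mul_of_nonneg_left (hD _) (by linarith [hpa k])
    _ = D * p n := by
        rw [← Finset.sum_mul, Finset.sum_Ico_eq_sub _ hnm, Finset.sum_range_sub',
          Finset.sum_range_sub']
        ring

/-- Source of the tail rates of the random series: convergence is proved with the weights `(k + 1) ^
τ`, and Abel summation removes them. -/
lemma hasTail_of_tendsto {a : ℕ → ℝ} {τ l : ℝ} (hτ : 0 < τ)
    (h : Tendsto (fun n => ∑ k ∈ Finset.range n, ((k : ℝ) + 1) ^ τ * a k) atTop (𝓝 l)) :
    HasTail a τ := by
  obtain ⟨R, hR⟩ := (Metric.isBounded_range_of_tendsto _ h).exists_norm_le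
  have hR' : ∀ n, |∑ k ∈ Finset.range n, ((k : ℝ) + 1) ^ τ * a k| ≤ R := fun n =>
    hR _ (mem_range_self n)
  refine hasTail_of_abs_sum_Ico_le (C := 2 * R) hτ fun n m hnm => ?_
  have := abs_sum_Ico_mul_le (p := fun k : ℕ => ((k : ℝ) + 1) ^ (-τ))
    (b := fun k : ℕ => ((k : ℝ) + 1) ^ τ * a k) (n := n) (D := 2 * R)
    (fun k => Real.rpow_nonneg (by positivity) _)
    (fun k => Real.rpow_le_rpow_of_nonpos (by positivity) (by push_cast; linarith) (by linarith))
    (fun j => by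
      rcases le_total j n with h | h
      · rw [Finset.Ico_eq_empty_of_le h, Finset.sum_empty, abs_zero]
        linarith [(abs_nonneg _).trans (hR' 0)]
      · rw [Finset.sum_Ico_eq_sub _ h]
        refine (abs_sub _ _).trans ?_
        linarith [hR' j, hR' n]) hnm
  refine le_trans (le_of_eq ?_) this
  congr 1
  refine Finset.sum_congr rfl fun k _ => ?_
  rw [← mul_assoc, ← Real.rpow_add (by positivity), neg_add_cancel, Real.rpow_zero, one_mul]

end

section

/-! ### Lengths of trajectories under a Łojasiewicz inequality -/

/-- A nonnegative Lyapunov sequence `W` which dominates `a x²`, up to the perturbation `T`. -/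
structure Lyapunov (a x W T : ℕ → ℝ) (κ τ A : ℝ) : Prop where
  pos : 0 < A
  nonneg : ∀ k, 0 ≤ W k
  decrease : ∀ k, κ * (a k * x k ^ 2) ≤ W k - W (k + 1)
  abs_le : ∀ k : ℕ, |T k| ≤ A * ((k : ℝ) + 1) ^ (-τ)

lemma Lyapunov.succ_le {a x W T : ℕ → ℝ} {κ τ A : ℝ} (h : Lyapunov a x W T κ τ A) (hκ : 0 < κ)
    (ha : ∀ k, 0 < a k) (k : ℕ) : W (k + 1) ≤ W k := by
  have := h.decrease k
  have : 0 ≤ κ * (a k * x k ^ 2) := mul_nonneg hκ.le (mul_nonneg (ha k).le (sq_nonneg _))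
  linarith

/-- The length of a piece of trajectory on which a Łojasiewicz inequality holds. -/
lemma Lyapunov.length_le {a x W T : ℕ → ℝ} {κ τ A s c₁ c₂ β ζ : ℝ}
    (h : Lyapunov a x W T κ τ A) (hκ : 0 < κ) (ha : StepBounds a s c₁ c₂) (hs0 : 0 ≤ s)
    (hs1 : s ≤ 1) (hτ : 1 - s < τ) (hβ0 : 0 < β) (hβ1 : β < 1) (hζ : 0 < ζ)
    (hx : ∀ k, 0 ≤ x k) :
    ∃ C, 0 ≤ C ∧ ∀ n m : ℕ, (∀ k ∈ Finset.Ico n m, |W k - T k| ^ β ≤ ζ * x k) →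
      ∑ k ∈ Finset.Ico n m, a k * x k ≤
        C * ((W n + 2 * A * ((n : ℝ) + 1) ^ (-τ)) ^ (1 - β) +
          ((n : ℝ) + 1) ^ (-((τ - (1 - s)) / 2))) := by
  have hA := h.pos
  set t : ℕ → ℝ := fun k => A * ((k : ℝ) + 1) ^ (-τ) with ht
  have htpos : ∀ k, 0 < t k := fun k => mul_pos hA (Real.rpow_pos_of_pos (by positivity) _)
  have hta : ∀ k, t (k + 1) ≤ t k := fun k => by
    refine mul_le_mul_of_nonneg_left ?_ hA.le
    exact Real.rpow_le_rpow_of_nonpos (by positivity) (by push_cast; linarith) (by linarith)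
  have hWa := h.succ_le hκ ha.step_pos
  -- `y` keeps `x` only in the noise regime, where `W` is below twice the bound `t` on the
  -- perturbation.
  obtain ⟨y, hy⟩ : ∃ y : ℕ → ℝ, y = fun k => if W k < 2 * t k then x k else 0 := ⟨_, rfl⟩
  have hd : ∀ k, a k * x k ^ 2 ≤ κ⁻¹ * (W k - W (k + 1)) := fun k => by
    rw [inv_mul_eq_div, le_div_iff₀ hκ]
    linarith [h.decrease k]
  -- The truncated sequence `min W (2 t)` is nonincreasing and `O(φ ^ (-τ))` everywhere, and it
  -- decreases at least as fast as `W` in the noise regime.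
  obtain ⟨C, hC0, hC⟩ := sum_mul_le_of_decrease (a := a) (y := y)
    (W := fun k => min (W k) (2 * t k)) (φ := fun k : ℕ => (k : ℝ) + 1) (s := s) (w := τ)
    (K := κ⁻¹) (C₁ := c₂ * 2 ^ s) (C₂ := 2 * A) (N := 0) hs1 hτ isClock_add_one
    (by positivity) (mul_nonneg ha.upper_pos.le (by positivity)) (by positivity)
    (fun k _ => (ha.step_pos k).le) (fun k _ => ha.le_add_one hs0 k)
    (fun k _ => le_min (h.nonneg k) (by linarith [htpos k]))
    (fun k _ => min_le_min (hWa k) (by linarith [hta k]))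
    (fun k _ => (min_le_right _ _).trans (le_of_eq (by rw [ht]; ring)))
    (fun k _ => by
      rw [hy]; dsimp only
      split_ifs with hk
      · rw [min_eq_left hk.le]
        refine (hd k).trans (mul_le_mul_of_nonneg_left ?_ (by positivity))
        linarith [min_le_left (W (k + 1)) (2 * t (k + 1))]
      · have : min (W (k + 1)) (2 * t (k + 1)) ≤ min (W k) (2 * t k) :=
          min_le_min (hWa k) (by linarith [hta k])
        rw [zero_pow two_ne_zero, mul_zero]
        exact mul_nonneg (by positivity) (by linarith))
  -- In the drift regime `|W - T|` is at least `H / 4`, and the classical Łojasiewicz argument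
  -- bounds `a x` by the decrease of `H ^ (1 - β)`. Adding `2 t` keeps `H` positive.
  obtain ⟨H, hH⟩ : ∃ H : ℕ → ℝ, H = fun k => W k + 2 * t k := ⟨_, rfl⟩
  have hHpos : ∀ k, 0 < H k := fun k => by rw [hH]; have := h.nonneg k; have := htpos k; positivity
  have hHa : ∀ k, H (k + 1) ≤ H k := fun k => by rw [hH]; linarith [hWa k, hta k]
  set K := κ⁻¹ * (ζ * 4 ^ β) with hK
  have hK0 : 0 ≤ K := by positivity
  refine ⟨max C (K / (1 - β)), hC0.trans (le_max_left _ _), fun n m hl => ?_⟩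
  have key : ∀ k ∈ Finset.Ico n m,
      a k * x k ≤ a k * y k + K * ((H k - H (k + 1)) * H k ^ (-β)) := by
    intro k hk
    have hHH : 0 ≤ K * ((H k - H (k + 1)) * H k ^ (-β)) :=
      mul_nonneg hK0 (mul_nonneg (by linarith [hHa k]) (Real.rpow_nonneg (hHpos k).le _))
    by_cases hk2 : W k < 2 * t k
    · have : y k = x k := by rw [hy]; simp [hk2]
      rw [this]; linarith
    · have : y k = 0 := by rw [hy]; simp [hk2]
      rw [this, mul_zero, zero_add]
      have hk3 : 2 * t k ≤ W k := not_lt.1 hk2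
      have e1 : H k / 4 ≤ |W k - T k| := by
        have h1 := h.abs_le k
        have h2 := le_abs_self (W k - T k)
        have h3 := le_abs_self (T k)
        have h4 : H k = W k + 2 * t k := by rw [hH]
        change |T k| ≤ t k at h1
        linarith
      have e2 : (H k / 4) ^ β ≤ ζ * x k :=
        (Real.rpow_le_rpow (by linarith [hHpos k]) e1 hβ0.le).trans (hl k hk)
      have e3 : H k ^ β ≤ 4 ^ β * (ζ * x k) := by
        rw [Real.div_rpow (hHpos k).le (by norm_num), div_le_iff₀ (by positivity)] at e2
        linarith
      have hHβ : 0 < H k ^ β := Real.rpow_pos_of_pos (hHpos k) _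
      rw [Real.rpow_neg (hHpos k).le, ← div_eq_mul_inv, ← mul_div_assoc, le_div_iff₀ hHβ]
      have hax : 0 ≤ a k * x k := mul_nonneg (ha.step_pos k).le (hx k)
      calc a k * x k * H k ^ β ≤ a k * x k * (4 ^ β * (ζ * x k)) := by gcongr
        _ = (ζ * 4 ^ β) * (a k * x k ^ 2) := by ring
        _ ≤ (ζ * 4 ^ β) * (κ⁻¹ * (H k - H (k + 1))) := by
            refine mul_le_mul_of_nonneg_left ?_ (by positivity)
            refine (hd k).trans (mul_le_mul_of_nonneg_left ?_ (by positivity))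
            rw [hH]; dsimp only; linarith [hta k]
        _ = _ := by rw [hK]; ring
  have hpow : 0 ≤ ((n : ℝ) + 1) ^ (-((τ - (1 - s)) / 2)) := Real.rpow_nonneg (by positivity) _
  have hHn : H n = W n + 2 * A * ((n : ℝ) + 1) ^ (-τ) := by rw [hH, ht]; ring
  calc _ ≤ ∑ k ∈ Finset.Ico n m, (a k * y k + K * ((H k - H (k + 1)) * H k ^ (-β))) :=
        Finset.sum_le_sum key
    _ = ∑ k ∈ Finset.Ico n m, a k * y k +
        K * ∑ k ∈ Finset.Ico n m, ((H k - H (k + 1)) * H k ^ (-β)) := by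
        rw [Finset.sum_add_distrib, Finset.mul_sum]
    _ ≤ C * ((n : ℝ) + 1) ^ (-((τ - (1 - s)) / 2)) + K * (H n ^ (1 - β) / (1 - β)) := by
        gcongr
        · exact hC n (Nat.zero_le n) m
        · exact sum_Ico_sub_mul_rpow_neg_le (N := 0) (fun k _ => (hHpos k).le)
            (fun k _ => hHa k) hβ0 hβ1 (Nat.zero_le n) m
    _ = K / (1 - β) * H n ^ (1 - β) + C * ((n : ℝ) + 1) ^ (-((τ - (1 - s)) / 2)) := by ring
    _ ≤ _ := by
        rw [← hHn, mul_add]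
        have : 0 ≤ H n ^ (1 - β) := Real.rpow_nonneg (hHpos n).le _
        gcongr
        · exact le_max_right _ _
        · exact le_max_left _ _

/-- Tail sums of `a x`, with a general clock. -/
lemma Lyapunov.tail_le {a x W T φ : ℕ → ℝ} {κ τ A s c C₁ p Q w A' : ℝ} {N : ℕ}
    (h : Lyapunov a x W T κ τ A) (hκ : 0 < κ) (ha0 : ∀ k, 0 < a k) (hφ : IsClock φ N)
    (hs0 : 0 ≤ s) (hs1 : s ≤ 1) (hw : 1 - s < w) (hc : 0 < c) (hC₁ : 0 ≤ C₁)
    (hal : ∀ k ≥ N, c * φ (k + 1) ^ (-s) * (φ (k + 1) - φ k) ≤ a k)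
    (hau : ∀ k ≥ N, a k ≤ C₁ * φ (k + 1) ^ (-s) * (φ (k + 1) - φ k))
    (hp : 1 < p) (hpw : w * (p - 1) ≤ 1 - s) (hQ : 0 < Q)
    (hT : ∀ k ≥ N, |T k| ≤ A' * φ k ^ (-w))
    (hloj : ∀ k ≥ N, |W k - T k| ^ p ≤ Q * x k ^ 2) :
    ∃ C, 0 ≤ C ∧ ∀ n ≥ N, ∀ m,
      ∑ k ∈ Finset.Ico n m, a k * x k ≤ C * φ n ^ (-((w - (1 - s)) / 2)) := by
  obtain ⟨B, hB, hWB⟩ := decay_of_pow (W := W) hφ (div_pos hκ hQ) hc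
    (by linarith) hp hpw hal hs0 hT (fun k _ => h.succ_le hκ ha0 k) (fun k hk => by
      refine le_trans ?_ (h.decrease k)
      have := hloj k hk
      have := ha0 k
      calc κ / Q * a k * |W k - T k| ^ p ≤ κ / Q * a k * (Q * x k ^ 2) := by gcongr
        _ = _ := by field_simp)
  refine sum_mul_le_of_decrease (K := κ⁻¹) (W := W) hs1 hw hφ (by positivity) hC₁ hB
    (fun k _ => (ha0 k).le) hau (fun k _ => h.nonneg k) (fun k _ => h.succ_le hκ ha0 k) hWB
    (fun k _ => ?_)
  rw [inv_mul_eq_div, le_div_iff₀ hκ]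
  linarith [h.decrease k]

/-- Tail sums of `a x` are `O(φ^{-X})`. -/
def TailBound (a x φ : ℕ → ℝ) (X : ℝ) : Prop :=
  ∃ C N, 0 ≤ C ∧ ∀ n ≥ N, ∀ m, ∑ k ∈ Finset.Ico n m, a k * x k ≤ C * φ n ^ (-X)

lemma IsClock.shift {φ : ℕ → ℝ} {N M : ℕ} (h : IsClock φ N) (hNM : N ≤ M) : IsClock φ M :=
  ⟨fun k hk => h.one_le k (hNM.trans hk), fun k hk => h.mono k (hNM.trans hk),
    fun k hk => h.le_two_mul k (hNM.trans hk)⟩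

/-- The exponent `p` stands for `2 β`. The decay exponent of `W` is the smaller of the noise
exponent `τ` and the exponent `(1 - s) / (p - 1)` of the unperturbed inequality; `p < 2` keeps the
latter above `1 - s`. -/
lemma Lyapunov.tailBound_of_pow {a x W T : ℕ → ℝ} {κ τ A s c₁ c₂ p Q : ℝ}
    (h : Lyapunov a x W T κ τ A) (hκ : 0 < κ) (ha : StepBounds a s c₁ c₂) (hs0 : 0 ≤ s)
    (hs1 : s < 1) (hτ : 1 - s < τ) (hp : 1 < p) (hp2 : p < 2) (hQ : 0 < Q)
    (hloj : ∀ᶠ k in atTop, |W k - T k| ^ p ≤ Q * x k ^ 2) :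
    TailBound a x (fun k => (k : ℝ) + 1) ((min τ ((1 - s) / (p - 1)) - (1 - s)) / 2) := by
  obtain ⟨N, hN⟩ := eventually_atTop.1 hloj
  have hw : 1 - s < min τ ((1 - s) / (p - 1)) := by
    refine lt_min hτ ?_
    rw [lt_div_iff₀ (by linarith)]
    nlinarith
  obtain ⟨C, hC0, hC⟩ := h.tail_le (φ := fun k : ℕ => (k : ℝ) + 1) (N := N) (A' := A)
    (C₁ := c₂ * 2 ^ s) hκ
    ha.step_pos (isClock_add_one.shift (Nat.zero_le N)) hs0 hs1.le hw ha.pos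
    (mul_nonneg ha.upper_pos.le (by positivity)) (fun k _ => ha.add_one_le hs0 k)
    (fun k _ => ha.le_add_one hs0 k) hp
    (by
      calc _ ≤ (1 - s) / (p - 1) * (p - 1) :=
            mul_le_mul_of_nonneg_right (min_le_right _ _) (by linarith)
        _ = 1 - s := div_mul_cancel₀ _ (by linarith)
        _ ≤ _ := le_rfl) hQ
    (fun k _ => (h.abs_le k).trans (mul_le_mul_of_nonneg_left
      (Real.rpow_le_rpow_of_exponent_le (by simp) (by simp)) h.pos.le)) hN
  exact ⟨C, N, hC0, hC⟩

/-- On the logarithmic clock the perturbation, a negative power of `k`, is negligible, and only the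
rate of `W' = -W ^ p` remains. -/
lemma Lyapunov.tailBound_log {a x W T : ℕ → ℝ} {κ τ A c₁ c₂ p Q : ℝ}
    (h : Lyapunov a x W T κ τ A) (hκ : 0 < κ) (ha : StepBounds a 1 c₁ c₂) (hτ : 0 < τ)
    (hp : 1 < p) (hp2 : p < 2) (hQ : 0 < Q)
    (hloj : ∀ᶠ k in atTop, |W k - T k| ^ p ≤ Q * x k ^ 2) :
    TailBound a x (fun k => Real.log ((k : ℝ) + 2)) ((1 / (p - 1) - 1) / 2) := by
  obtain ⟨N, hN⟩ := eventually_atTop.1 hloj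
  have hp1 : 0 < p - 1 := by linarith
  have hw : 1 - (0 : ℝ) < 1 / (p - 1) := by
    rw [lt_div_iff₀ hp1]; linarith
  obtain ⟨D, hD, hDk⟩ := exists_rpow_neg_le_log hτ (w := 1 / (p - 1)) (by positivity)
  obtain ⟨C, hC0, hC⟩ := h.tail_le (φ := fun k : ℕ => Real.log ((k : ℝ) + 2)) (N := max N 1)
    (A' := A * D) (C₁ := 3 * c₂) hκ ha.step_pos (isClock_log.shift (le_max_right _ _)) le_rfl
    zero_le_one hw ha.pos (by have := ha.upper_pos; positivity) (fun k _ => ha.log_le k)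
    (fun k _ => ha.le_log k) hp
    (by rw [one_div, inv_mul_cancel₀ hp1.ne']; linarith) hQ
    (fun k _ => (h.abs_le k).trans (by
      rw [mul_assoc]; exact mul_le_mul_of_nonneg_left (hDk k) h.pos.le))
    (fun k hk => hN k ((le_max_left _ _).trans hk))
  rw [sub_zero] at hC
  exact ⟨C, max N 1, hC0, hC⟩

/-- The linear case. -/
lemma Lyapunov.tailBound_of_linear {a x W T : ℕ → ℝ} {κ τ A s c₁ c₂ Q g : ℝ}
    (h : Lyapunov a x W T κ τ A) (hκ : 0 < κ) (ha : StepBounds a s c₁ c₂) (hs0 : 0 ≤ s)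
    (hs1 : s ≤ 1) (hτ : 1 - s < τ) (hQ : 0 < Q)
    (hg : s = 1 → Tendsto (fun k : ℕ => ((k : ℝ) + 1) * a k) atTop (𝓝 g) ∧ τ < κ / Q * g)
    (hloj : ∀ᶠ k in atTop, |W k - T k| ≤ Q * x k ^ 2) :
    TailBound a x (fun k => (k : ℝ) + 1) ((τ - (1 - s)) / 2) := by
  have hτ0 : 0 < τ := by linarith
  have hWa := h.succ_le hκ ha.step_pos
  rcases hs1.lt_or_eq with hs1 | rfl
  · -- reduction to a superlinear inequality with exponent close to `1`
    set p := 1 + (1 - s) / τ with hp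
    have hp1 : 1 < p := by
      have : 0 < (1 - s) / τ := div_pos (by linarith) hτ0
      linarith
    have hp2 : p < 2 := by
      have : (1 - s) / τ < 1 := (div_lt_one hτ0).2 hτ
      linarith
    have hmin : min τ ((1 - s) / (p - 1)) = τ := by
      rw [hp, add_sub_cancel_left, div_div_cancel₀ (by linarith), min_self]
    rw [← hmin]
    set M := W 0 + A with hM
    have hM0 : 0 < M := by have := h.nonneg 0; have := h.pos; positivity
    refine h.tailBound_of_pow hκ ha hs0 hs1 hτ hp1 hp2 (Q := M ^ (p - 1) * Q) (by positivity) ?_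
    filter_upwards [hloj] with k hk
    have hW0 : W k ≤ W 0 := antitone_nat_of_succ_le hWa (Nat.zero_le k)
    have hTA : |T k| ≤ A := (h.abs_le k).trans (mul_le_of_le_one_right h.pos.le
      (Real.rpow_le_one_of_one_le_of_nonpos (by simp) (by linarith)))
    have hWT : |W k - T k| ≤ M := by
      have := abs_sub (W k) (T k)
      rw [abs_of_nonneg (h.nonneg k)] at this
      linarith
    have hnn := abs_nonneg (W k - T k)
    calc |W k - T k| ^ p = |W k - T k| ^ (p - 1) * |W k - T k| := by
          rcases hnn.eq_or_lt with h0 | h0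
          · rw [← h0, Real.zero_rpow (by linarith), mul_zero]
          · rw [Real.rpow_sub_one h0.ne', div_mul_cancel₀ _ h0.ne']
      _ ≤ M ^ (p - 1) * (Q * x k ^ 2) := by gcongr
      _ = _ := by ring
  · obtain ⟨hg1, hg2⟩ := hg rfl
    obtain ⟨B, hB, hWB⟩ := decay_of_linear (W := W) (T := T) hτ0 h.pos.le hg1 hg2
      (Eventually.of_forall h.abs_le) (Eventually.of_forall h.nonneg) (by
        filter_upwards [hloj] with k hk
        refine le_trans ?_ (h.decrease k)
        have h1 : W k - |T k| ≤ Q * x k ^ 2 := by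
          have := le_abs_self (W k - T k)
          have := le_abs_self (T k)
          linarith
        have := ha.step_pos k
        calc κ / Q * a k * (W k - |T k|) ≤ κ / Q * a k * (Q * x k ^ 2) := by gcongr
          _ = _ := by field_simp)
    obtain ⟨N, hN⟩ := eventually_atTop.1 hWB
    obtain ⟨C, hC0, hC⟩ := sum_mul_le_of_decrease (a := a) (y := x) (K := κ⁻¹) (W := W)
      (φ := fun k : ℕ => (k : ℝ) + 1) (N := N) (s := 1) (C₁ := c₂ * 2 ^ (1 : ℝ)) le_rfl hτ
      (isClock_add_one.shift (Nat.zero_le N)) (by positivity)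
      (mul_nonneg ha.upper_pos.le (by positivity)) hB
      (fun k _ => (ha.step_pos k).le) (fun k _ => ha.le_add_one hs0 k) (fun k _ => h.nonneg k)
      (fun k _ => hWa k) hN (fun k _ => by
        rw [inv_mul_eq_div, le_div_iff₀ hκ]
        linarith [h.decrease k])
    exact ⟨C, N, hC0, hC⟩

end

/-! ### Convergence and rates along a single trajectory -/

section

variable {m : ℕ}

lemma continuous_gradient {F : Vec m → ℝ} (hF : ContDiff ℝ 1 F) : Continuous (gradient F) :=
  (InnerProductSpace.toDual ℝ (Vec m)).symm.continuous.comp (hF.continuous_fderiv one_ne_zero)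

/-- `T` is the tail of the error series and `W` is `F - v` plus that tail. Being nonincreasing with
limit `0`, `W` is nonnegative, although `F - v` may change sign. -/
lemma exists_lyapunov {F : Vec m → ℝ} {θ : ℕ → Vec m} {a e : ℕ → ℝ} {κ τ v : ℝ} (hτ : 0 < τ)
    (hdesc : ∀ k, F (θ (k + 1)) ≤ F (θ k) - κ * (a k * ‖gradient F (θ k)‖ ^ 2) + e k)
    (he : HasTail e τ) (hv : Tendsto (fun n => F (θ n)) atTop (𝓝 v)) (hκ : 0 < κ)
    (ha : ∀ k, 0 < a k) :
    ∃ W T A, Lyapunov a (fun k => ‖gradient F (θ k)‖) W T κ τ A ∧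
      (∀ k, W k - T k = F (θ k) - v) ∧ Tendsto W atTop (𝓝 0) := by
  obtain ⟨l, C, hC⟩ := he
  obtain ⟨T, hT⟩ : ∃ T : ℕ → ℝ, T = fun k => l - ∑ i ∈ Finset.range k, e i := ⟨_, rfl⟩
  have hTb : ∀ k : ℕ, |T k| ≤ (|C| + 1) * ((k : ℝ) + 1) ^ (-τ) := fun k => by
    rw [hT]; dsimp only
    rw [abs_sub_comm]
    refine (hC k).trans (mul_le_mul_of_nonneg_right ?_ (Real.rpow_nonneg (by positivity) _))
    linarith [le_abs_self C]
  have hT0 : Tendsto T atTop (𝓝 0) := by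
    have h0 : Tendsto (fun n : ℕ => (|C| + 1) * ((n : ℝ) + 1) ^ (-τ)) atTop (𝓝 0) := by
      simpa using (tendsto_add_one_rpow_neg hτ).const_mul (|C| + 1)
    exact squeeze_zero_norm hTb h0
  have hdec : ∀ k, κ * (a k * ‖gradient F (θ k)‖ ^ 2) ≤
      (F (θ k) - v + T k) - (F (θ (k + 1)) - v + T (k + 1)) := fun k => by
    have h1 : T (k + 1) = T k - e k := by
      rw [hT]; dsimp only; rw [Finset.sum_range_succ]; ring
    rw [h1]
    linarith [hdesc k]
  have hlim : Tendsto (fun k => F (θ k) - v + T k) atTop (𝓝 0) := by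
    have := (hv.sub_const v).add hT0
    simpa using this
  refine ⟨fun k => F (θ k) - v + T k, T, |C| + 1, ⟨by positivity, ?_, hdec, hTb⟩,
    fun k => by ring, hlim⟩
  have hanti : Antitone fun k => F (θ k) - v + T k := antitone_nat_of_succ_le fun k => by
    have := hdec k
    have : 0 ≤ κ * (a k * ‖gradient F (θ k)‖ ^ 2) :=
      mul_nonneg hκ.le (mul_nonneg (ha k).le (sq_nonneg _))
    linarith
  exact fun k => hanti.le_of_tendsto hlim k

/-- Along a bounded trajectory, the values of `F` converge. -/
lemma exists_tendsto_value {F : Vec m → ℝ} (hF : Continuous F) {θ : ℕ → Vec m} {a e : ℕ → ℝ}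
    {κ τ : ℝ} (hτ : 0 < τ)
    (hdesc : ∀ k, F (θ (k + 1)) ≤ F (θ k) - κ * (a k * ‖gradient F (θ k)‖ ^ 2) + e k)
    (he : HasTail e τ) (hκ : 0 < κ) (ha : ∀ k, 0 < a k) (hbdd : ∃ R, ∀ k, ‖θ k‖ ≤ R) :
    ∃ v, Tendsto (fun n => F (θ n)) atTop (𝓝 v) := by
  obtain ⟨l, C, hC⟩ := he
  obtain ⟨R, hR⟩ := hbdd
  have hl : Tendsto (fun k => ∑ i ∈ Finset.range k, e i) atTop (𝓝 l) := by
    rw [tendsto_iff_norm_sub_tendsto_zero]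
    have h0 : Tendsto (fun n : ℕ => C * ((n : ℝ) + 1) ^ (-τ)) atTop (𝓝 0) := by
      simpa using (tendsto_add_one_rpow_neg hτ).const_mul C
    exact squeeze_zero (fun _ => norm_nonneg _) hC h0
  obtain ⟨B, hB⟩ := (Metric.isBounded_range_of_tendsto _ hl).exists_norm_le
  have hanti : Antitone fun k => F (θ k) - ∑ i ∈ Finset.range k, e i :=
    antitone_nat_of_succ_le fun k => by
      have := hdesc k
      have : 0 ≤ κ * (a k * ‖gradient F (θ k)‖ ^ 2) :=
        mul_nonneg hκ.le (mul_nonneg (ha k).le (sq_nonneg _))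
      rw [Finset.sum_range_succ]
      linarith
  obtain ⟨b, hb⟩ := ((isCompact_closedBall (0 : Vec m) R).image hF).bddBelow
  have hbd : BddBelow (range fun k => F (θ k) - ∑ i ∈ Finset.range k, e i) := by
    refine ⟨b - B, ?_⟩
    rintro _ ⟨k, rfl⟩
    have h1 : b ≤ F (θ k) := hb ⟨θ k, by simpa using hR k, rfl⟩
    have h2 := (le_abs_self _).trans (hB _ (mem_range_self k))
    dsimp only at h2 ⊢
    linarith
  have := (tendsto_atTop_ciInf hanti hbd).add hl
  exact ⟨_, by simpa using this⟩

/-- A bounded perturbed gradient trajectory of a Łojasiewicz function converges to a stationary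
point. -/
theorem exists_tendsto_critical {F : Vec m → ℝ} (hL : Lojasiewicz F) {θ : ℕ → Vec m}
    {a e : ℕ → ℝ} {κ τ s c₁ c₂ c D e₁ : ℝ} (ha : StepBounds a s c₁ c₂) (hs0 : 0 ≤ s)
    (hs1 : s ≤ 1) (hτ : 1 - s < τ) (hκ : 0 < κ) (hc : 0 ≤ c) (he₁ : 0 < e₁)
    (hsum : Tendsto (fun n => ∑ k ∈ Finset.range n, a k) atTop atTop)
    (hdesc : ∀ k, F (θ (k + 1)) ≤ F (θ k) - κ * (a k * ‖gradient F (θ k)‖ ^ 2) + e k)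
    (he : HasTail e τ) (hbdd : ∃ R, ∀ k, ‖θ k‖ ≤ R)
    (hmove : ∀ n m : ℕ, n ≤ m → ‖θ m - θ n‖ ≤
      c * ∑ k ∈ Finset.Ico n m, a k * ‖gradient F (θ k)‖ + D * ((n : ℝ) + 1) ^ (-e₁)) :
    ∃ θs, Tendsto θ atTop (𝓝 θs) ∧ gradient F θs = 0 := by
  have hτ0 : 0 < τ := by linarith
  obtain ⟨hC1, hLoj⟩ := hL
  have hFc : Continuous F := hC1.continuous
  have hgc := continuous_gradient hC1
  obtain ⟨v, hv⟩ := exists_tendsto_value hFc hτ0 hdesc he hκ ha.step_pos hbdd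
  obtain ⟨W, T, A, hW, hWT, hW0⟩ := exists_lyapunov hτ0 hdesc he hv hκ ha.step_pos
  -- the gradient is small infinitely often
  have hfreq : ∀ ε > 0, ∃ᶠ k in atTop, ‖gradient F (θ k)‖ < ε := by
    intro ε hε hcon
    obtain ⟨N, hN⟩ := eventually_atTop.1 hcon
    have h1 : ∀ n ≥ N, κ * ε ^ 2 * ∑ k ∈ Finset.Ico N n, a k ≤ W N - W n := by
      intro n hn
      induction n, hn using Nat.le_induction with
      | base => simp
      | succ n hn ih =>
        rw [Finset.sum_Ico_succ_top hn]
        have h2 := hW.decrease n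
        have h3 : ε ^ 2 ≤ ‖gradient F (θ n)‖ ^ 2 := by
          have := hN n hn
          gcongr
          exact not_lt.1 this
        have h4 := mul_le_mul_of_nonneg_left h3 (mul_nonneg hκ.le (ha.step_pos n).le)
        nlinarith
    obtain ⟨n, hn⟩ := ((hsum.eventually_gt_atTop
      (∑ k ∈ Finset.range N, a k + W N / (κ * ε ^ 2))).and (eventually_ge_atTop N)).exists
    have h2 := h1 n hn.2
    have h3 := hn.1
    rw [Finset.sum_Ico_eq_sub _ hn.2] at h2
    have h4 : W N / (κ * ε ^ 2) < ∑ k ∈ Finset.range n, a k - ∑ k ∈ Finset.range N, a k := by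
      linarith
    rw [div_lt_iff₀ (by positivity)] at h4
    have := hW.nonneg n
    linarith
  obtain ⟨φ, hφ, hφg⟩ := extraction_forall_of_frequently
    (P := fun (j k : ℕ) => ‖gradient F (θ k)‖ < 1 / ((j : ℝ) + 1)) fun j => hfreq _ (by positivity)
  obtain ⟨R, hR⟩ := hbdd
  obtain ⟨θs, -, ψ, hψ, hlim⟩ := tendsto_subseq_of_bounded
    (Metric.isBounded_closedBall (x := (0 : Vec m)) (r := R))
    (x := θ ∘ φ) (fun j => by simpa using hR (φ j))
  have hχ : Tendsto (φ ∘ ψ) atTop atTop := (hφ.comp hψ).tendsto_atTop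
  have hcrit : gradient F θs = 0 := by
    have h1 : Tendsto (fun j => ‖gradient F (θ (φ (ψ j)))‖) atTop (𝓝 ‖gradient F θs‖) :=
      ((hgc.tendsto θs).comp hlim).norm
    have h2 : Tendsto (fun j => ‖gradient F (θ (φ (ψ j)))‖) atTop (𝓝 0) := by
      refine squeeze_zero (fun _ => norm_nonneg _) (fun j => (hφg (ψ j)).le) ?_
      exact tendsto_one_div_add_atTop_nhds_zero_nat.comp hψ.tendsto_atTop
    exact norm_eq_zero.1 (tendsto_nhds_unique h1 h2)
  have hval : F θs = v :=
    tendsto_nhds_unique ((hFc.tendsto θs).comp hlim) (hv.comp hχ)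
  refine ⟨θs, ?_, hcrit⟩
  obtain ⟨V, hVo, hVs, β, hβ, ζ, hζ, hVL⟩ := hLoj θs hcrit
  obtain ⟨r, hr, hrV⟩ := Metric.isOpen_iff.1 hVo θs hVs
  obtain ⟨C, hC0, hC⟩ := hW.length_le hκ ha hs0 hs1 hτ hβ.1 hβ.2 hζ
    (fun k => norm_nonneg _)
  -- `G n` bounds every displacement after time `n`, as long as the path stays where the Łojasiewicz
  -- inequality holds.
  set G : ℕ → ℝ := fun n => c * (C * ((W n + 2 * A * ((n : ℝ) + 1) ^ (-τ)) ^ (1 - β) +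
    ((n : ℝ) + 1) ^ (-((τ - (1 - s)) / 2)))) + D * ((n : ℝ) + 1) ^ (-e₁) with hG
  have hG0 : Tendsto G atTop (𝓝 0) := by
    have h1 : Tendsto (fun n : ℕ => W n + 2 * A * ((n : ℝ) + 1) ^ (-τ)) atTop (𝓝 0) := by
      simpa using hW0.add ((tendsto_add_one_rpow_neg hτ0).const_mul (2 * A))
    have h2 : Tendsto (fun n : ℕ => (W n + 2 * A * ((n : ℝ) + 1) ^ (-τ)) ^ (1 - β)) atTop
        (𝓝 0) := by
      have := h1.rpow_const (p := 1 - β) (Or.inr (by linarith [hβ.2]))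
      rwa [Real.zero_rpow (by linarith [hβ.2])] at this
    have h3 := tendsto_add_one_rpow_neg (τ := (τ - (1 - s)) / 2) (by linarith)
    simpa using (((h2.add h3).const_mul C).const_mul c).add
      ((tendsto_add_one_rpow_neg he₁).const_mul D)
  rw [Metric.tendsto_atTop]
  intro ε hε
  set ε' := min ε r with hε'
  have hε'0 : 0 < ε' := lt_min hε hr
  have hGe : ∀ᶠ n in atTop, G n < ε' / 2 := hG0.eventually (gt_mem_nhds (by linarith))
  have hψe : ∀ᶠ j in atTop, dist (θ (φ (ψ j))) θs < ε' / 2 :=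
    (Metric.tendsto_nhds.1 hlim) _ (by linarith)
  obtain ⟨j, hj1, hj2⟩ := ((hχ.eventually hGe).and hψe).exists
  set n₀ := φ (ψ j) with hn₀
  have hj1' : G n₀ < ε' / 2 := hj1
  refine ⟨n₀, fun n hn => ?_⟩
  suffices h : dist (θ n) θs < ε' from h.trans_le (min_le_left _ _)
  -- Trapping: while the path stays in the ball of radius `ε' ≤ r`, its displacement since `n₀` is
  -- below `ε' / 2`, so the next point is in the ball as well.
  induction n using Nat.strong_induction_on with
  | _ n ih =>
    have hl := hC n₀ n (fun k hk => by
      have hk' := Finset.mem_Ico.1 hk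
      have h1 := ih k hk'.2 hk'.1
      rw [hWT, ← hval]
      exact hVL _ (hrV (Metric.mem_ball.2 (h1.trans_le (min_le_right _ _)))))
    have h2 := hmove n₀ n hn
    have h3 : ‖θ n - θ n₀‖ ≤ G n₀ := h2.trans
      (add_le_add (mul_le_mul_of_nonneg_left hl hc) le_rfl)
    calc dist (θ n) θs ≤ dist (θ n) (θ n₀) + dist (θ n₀) θs := dist_triangle _ _ _
      _ < ε' / 2 + ε' / 2 := by rw [dist_eq_norm (θ n)]; linarith
      _ = ε' := by ring

/-- Rates along a trajectory that converges to a stationary point. -/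
theorem tailBounds_of_lojasiewicz {F : Vec m → ℝ} (hC1 : ContDiff ℝ 1 F) {θ : ℕ → Vec m}
    {θs : Vec m} {a e : ℕ → ℝ} {κ τ s c₁ c₂ g β ζ : ℝ} (ha : StepBounds a s c₁ c₂)
    (hs0 : 0 ≤ s) (hs1 : s ≤ 1) (hτ : 1 - s < τ) (hκ : 0 < κ)
    (hdesc : ∀ k, F (θ (k + 1)) ≤ F (θ k) - κ * (a k * ‖gradient F (θ k)‖ ^ 2) + e k)
    (he : HasTail e τ) (hθ : Tendsto θ atTop (𝓝 θs)) (hcrit : gradient F θs = 0)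
    (hβ : β ∈ Ioo (0 : ℝ) 1) (hζ : 0 < ζ)
    (hloj : ∀ᶠ x in 𝓝 θs, |F x - F θs| ^ β ≤ ζ * ‖gradient F x‖) :
    (β ≤ 1 / 2 →
      (s = 1 → Tendsto (fun k : ℕ => ((k : ℝ) + 1) * a k) atTop (𝓝 g) ∧
        τ < κ / ζ ^ (1 / β) * g) →
      TailBound a (fun k => ‖gradient F (θ k)‖) (fun k => (k : ℝ) + 1) ((τ - (1 - s)) / 2)) ∧
    (1 / 2 < β → s < 1 → TailBound a (fun k => ‖gradient F (θ k)‖) (fun k => (k : ℝ) + 1)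
      ((min τ ((1 - s) / (2 * β - 1)) - (1 - s)) / 2)) ∧
    (1 / 2 < β → s = 1 → TailBound a (fun k => ‖gradient F (θ k)‖)
      (fun k => Real.log ((k : ℝ) + 2)) ((1 / (2 * β - 1) - 1) / 2)) := by
  have hτ0 : 0 < τ := by linarith
  have hFc : Continuous F := hC1.continuous
  have hv : Tendsto (fun n => F (θ n)) atTop (𝓝 (F θs)) := (hFc.tendsto θs).comp hθ
  obtain ⟨W, T, A, hW, hWT, -⟩ := exists_lyapunov hτ0 hdesc he hv hκ ha.step_pos
  have hl : ∀ᶠ k in atTop, |W k - T k| ^ β ≤ ζ * ‖gradient F (θ k)‖ := by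
    filter_upwards [hθ.eventually hloj] with k hk
    rwa [hWT]
  have hpow : ∀ᶠ k in atTop, |W k - T k| ^ (2 * β) ≤ ζ ^ 2 * ‖gradient F (θ k)‖ ^ 2 := by
    filter_upwards [hl] with k hk
    rw [mul_comm, Real.rpow_mul (abs_nonneg _), Real.rpow_two, ← mul_pow]
    have : 0 ≤ |W k - T k| ^ β := by positivity
    gcongr
  refine ⟨fun hβ2 hg => ?_, fun hβ2 hs => ?_, fun hβ2 hs => ?_⟩
  -- Near the limit `‖∇F‖ < 1`, hence `‖∇F‖ ^ (1 / β) ≤ ‖∇F‖ ^ 2` because `1 / β ≥ 2`. This gives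
  -- the linear regime with constant `ζ ^ (1 / β)`, the one in the condition on the steps.
  · refine hW.tailBound_of_linear hκ ha hs0 hs1 hτ (Real.rpow_pos_of_pos hζ (1 / β)) hg ?_
    have hsmall : ∀ᶠ k in atTop, ‖gradient F (θ k)‖ < 1 := by
      have h1 : Tendsto (fun k => ‖gradient F (θ k)‖) atTop (𝓝 ‖gradient F θs‖) :=
        (((continuous_gradient hC1).tendsto θs).comp hθ).norm
      rw [hcrit, norm_zero] at h1
      exact h1.eventually (gt_mem_nhds one_pos)
    filter_upwards [hl, hsmall] with k hk hk1
    have h0 := norm_nonneg (gradient F (θ k))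
    calc |W k - T k| = (|W k - T k| ^ β) ^ (1 / β) := by
          rw [← Real.rpow_mul (abs_nonneg _), mul_one_div_cancel hβ.1.ne', Real.rpow_one]
      _ ≤ (ζ * ‖gradient F (θ k)‖) ^ (1 / β) := by
          have := hβ.1
          gcongr
      _ = ζ ^ (1 / β) * ‖gradient F (θ k)‖ ^ (1 / β) := Real.mul_rpow hζ.le h0
      _ ≤ ζ ^ (1 / β) * ‖gradient F (θ k)‖ ^ 2 := by
          refine mul_le_mul_of_nonneg_left ?_ (Real.rpow_nonneg hζ.le _)
          rw [← Real.rpow_two]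
          rcases h0.eq_or_lt with h0 | h0
          · rw [← h0, Real.zero_rpow (by have := hβ.1; positivity), Real.zero_rpow two_ne_zero]
          · refine Real.rpow_le_rpow_of_exponent_ge h0 hk1.le ?_
            rw [le_div_iff₀ hβ.1]; linarith
  · exact hW.tailBound_of_pow hκ ha hs0 hs hτ (by linarith) (by linarith [hβ.2])
      (by positivity) hpow
  · subst hs
    exact hW.tailBound_log hκ ha hτ0 (by linarith) (by linarith [hβ.2]) (by positivity) hpow

/-- The distance to the limit is a limit of displacements, hence at most the remaining length plus
the noise tail, and the slower of the two decides the rate. -/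
lemma TailBound.norm_sub_le {a x φ : ℕ → ℝ} {X Y c D e₁ B : ℝ} {θ : ℕ → Vec m} {θs : Vec m}
    (h : TailBound a x φ X) (hθ : Tendsto θ atTop (𝓝 θs)) (hc : 0 ≤ c) (hD : 0 ≤ D)
    (hmove : ∀ n m : ℕ, n ≤ m → ‖θ m - θ n‖ ≤
      c * ∑ k ∈ Finset.Ico n m, a k * x k + D * ((n : ℝ) + 1) ^ (-e₁))
    (hφ : ∀ᶠ n in atTop, 1 ≤ φ n) (hYX : Y ≤ X)
    (he : ∀ᶠ n : ℕ in atTop, ((n : ℝ) + 1) ^ (-e₁) ≤ B * φ n ^ (-Y)) :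
    (fun n => θ n - θs) =O[atTop] fun n => φ n ^ (-Y) := by
  obtain ⟨C, N, hC0, hC⟩ := h
  refine IsBigO.of_bound (c * C + D * B) ?_
  filter_upwards [eventually_ge_atTop N, hφ, he] with n hn hφn hen
  have h0 : 0 ≤ φ n ^ (-Y) := Real.rpow_nonneg (by linarith) _
  rw [Real.norm_of_nonneg h0]
  have h1 : Tendsto (fun k => ‖θ k - θ n‖) atTop (𝓝 ‖θs - θ n‖) := (hθ.sub_const _).norm
  rw [norm_sub_rev]
  refine le_of_tendsto h1 (eventually_atTop.2 ⟨n, fun k hk => ?_⟩)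
  calc _ ≤ c * ∑ k ∈ Finset.Ico n k, a k * x k + D * ((n : ℝ) + 1) ^ (-e₁) := hmove n k hk
    _ ≤ c * (C * φ n ^ (-Y)) + D * (B * φ n ^ (-Y)) := by
        gcongr
        refine (hC n hn k).trans (mul_le_mul_of_nonneg_left ?_ hC0)
        exact Real.rpow_le_rpow_of_exponent_le hφn (by linarith)
    _ = _ := by ring

end

section

variable {m : ℕ}

/-! ### Hölder smooth functions -/

/-- Descent lemma: along the segment, the difference `ψ` of the two sides has nonpositive
derivative, by Cauchy-Schwarz and the Hölder bound on the gradient. -/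
lemma HolderSmooth.le_add {F : Vec m → ℝ} {L α : ℝ} (h : HolderSmooth F L α) (hα : 0 < α)
    (x y : Vec m) :
    F y ≤ F x + inner ℝ (gradient F x) (y - x) + L / (1 + α) * ‖y - x‖ ^ (1 + α) := by
  obtain ⟨-, hd, hH⟩ := h
  set v := y - x with hv
  obtain ⟨ψ, hψ⟩ : ∃ ψ : ℝ → ℝ, ψ = fun t => F (x + t • v) - t * inner ℝ (gradient F x) v -
      L / (1 + α) * (t ^ (1 + α) * ‖v‖ ^ (1 + α)) := ⟨_, rfl⟩
  have hder : ∀ t : ℝ, HasDerivAt ψ (inner ℝ (gradient F (x + t • v)) v -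
      inner ℝ (gradient F x) v - L / (1 + α) * (((1 + α) * t ^ α) * ‖v‖ ^ (1 + α))) t := by
    intro t
    have h1 : HasDerivAt (fun t : ℝ => x + t • v) v t := by
      simpa using ((hasDerivAt_id t).smul_const v).const_add x
    have h2 : HasDerivAt (fun t : ℝ => F (x + t • v)) (inner ℝ (gradient F (x + t • v)) v) t := by
      have := (hd (x + t • v)).hasGradientAt.hasFDerivAt.comp_hasDerivAt t h1
      simpa [Function.comp_def] using this
    have h3 : HasDerivAt (fun t : ℝ => t ^ (1 + α)) ((1 + α) * t ^ α) t := by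
      have := Real.hasDerivAt_rpow_const (x := t) (p := 1 + α) (Or.inr (by linarith))
      simpa using this
    have h4 := ((h3.mul_const (‖v‖ ^ (1 + α))).const_mul (L / (1 + α)))
    have h5 : HasDerivAt (fun t : ℝ => t * inner ℝ (gradient F x) v)
        (inner ℝ (gradient F x) v) t := by
      simpa using (hasDerivAt_id t).mul_const (inner ℝ (gradient F x) v)
    rw [hψ]
    exact (h2.sub h5).sub h4
  have hanti : AntitoneOn ψ (Icc 0 1) := by
    refine antitoneOn_of_deriv_nonpos (convex_Icc 0 1)
      (fun t _ => (hder t).continuousAt.continuousWithinAt)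
      (fun t _ => (hder t).differentiableAt.differentiableWithinAt) (fun t ht => ?_)
    rw [interior_Icc] at ht
    rw [(hder t).deriv, ← inner_sub_left]
    have h1 : inner ℝ (gradient F (x + t • v) - gradient F x) v ≤
        L * (t ^ α * ‖v‖ ^ α) * ‖v‖ := by
      refine (real_inner_le_norm _ _).trans (mul_le_mul_of_nonneg_right ?_ (norm_nonneg _))
      have := hH x (x + t • v)
      rwa [add_sub_cancel_left, norm_smul, Real.norm_of_nonneg ht.1.le,
        Real.mul_rpow ht.1.le (norm_nonneg _)] at this
    have h2 : ‖v‖ ^ (1 + α) = ‖v‖ * ‖v‖ ^ α := by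
      rw [Real.rpow_add_of_nonneg (norm_nonneg _) zero_le_one hα.le, Real.rpow_one]
    rw [h2]
    have h3 : L / (1 + α) * ((1 + α) * t ^ α * (‖v‖ * ‖v‖ ^ α)) =
        L * (t ^ α * ‖v‖ ^ α) * ‖v‖ := by
      have : (1 + α) ≠ 0 := by linarith
      field_simp
    linarith
  have := hanti (left_mem_Icc.2 zero_le_one) (right_mem_Icc.2 zero_le_one) zero_le_one
  rw [hψ] at this
  simp only [one_smul, one_mul, Real.one_rpow, zero_smul, add_zero, zero_mul, sub_zero] at this
  rw [Real.zero_rpow (by linarith), zero_mul, mul_zero, sub_zero, hv, add_sub_cancel] at this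
  rw [← hv] at this
  linarith

lemma HolderSmooth.sub_nonneg {F : Vec m → ℝ} {L α : ℝ} (h : HolderSmooth F L α) (x : Vec m) :
    0 ≤ F x - ⨅ y, F y := by
  linarith [ciInf_le h.1 x]

/-- A gradient step of the best length cannot lead below the infimum. -/
lemma HolderSmooth.gradient_rpow_le {F : Vec m → ℝ} {L α : ℝ} (h : HolderSmooth F L α)
    (hα : 0 < α) (hL : 0 < L) (x : Vec m) :
    ‖gradient F x‖ ^ ((1 + α) / α) ≤ (1 + α) * L ^ (1 / α) / α * (F x - ⨅ y, F y) := by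
  set G := ‖gradient F x‖ with hG
  rcases (norm_nonneg (gradient F x)).eq_or_lt with h0 | h0
  · rw [hG, ← h0, Real.zero_rpow (by positivity)]
    exact mul_nonneg (by positivity) (h.sub_nonneg x)
  change 0 < G at h0
  -- `r` minimizes `-r G + L r ^ (1 + α) / (1 + α)`, the change allowed by the descent lemma for a
  -- move of length `r` against the gradient.
  set r := (G / L) ^ (1 / α) with hr
  have hr0 : 0 < r := by positivity
  have hrα : r ^ α = G / L := by
    rw [hr, ← Real.rpow_mul (by positivity), one_div_mul_cancel hα.ne', Real.rpow_one]
  have h1 := h.le_add hα x (x - (r / G) • gradient F x)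
  rw [sub_sub_cancel_left, inner_neg_right, inner_smul_right, real_inner_self_eq_norm_sq, norm_neg,
    norm_smul, Real.norm_of_nonneg (by positivity), ← hG, div_mul_cancel₀ _ h0.ne',
    Real.rpow_add hr0, Real.rpow_one, hrα] at h1
  have h2 := ciInf_le h.1 (x - (r / G) • gradient F x)
  have h3 : r * G * (α / (1 + α)) ≤ F x - ⨅ y, F y := by
    have e : -(r / G * G ^ 2) + L / (1 + α) * (r * (G / L)) = -(r * G * (α / (1 + α))) := by
      field_simp; ring
    linarith
  have h4 : G ^ ((1 + α) / α) = L ^ (1 / α) * (r * G) := by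
    rw [hr, Real.div_rpow h0.le hL.le, show (1 + α) / α = 1 / α + 1 by field_simp; ,
      Real.rpow_add_one h0.ne']
    field_simp
  rw [h4]
  calc L ^ (1 / α) * (r * G) = (1 + α) * L ^ (1 / α) / α * (r * G * (α / (1 + α))) := by
        field_simp
    _ ≤ _ := by gcongr

/-- For gradients of norm at least `1`, compare the exponents `2 ≤ (1 + α) / α`. It serves to deduce
integrability of squared gradients from that of the gap. -/
lemma HolderSmooth.gradient_sq_le {F : Vec m → ℝ} {L α : ℝ} (h : HolderSmooth F L α)
    (hα : α ∈ Ioc (0 : ℝ) 1) (hL : 0 < L) (x : Vec m) :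
    ‖gradient F x‖ ^ 2 ≤ 1 + (1 + α) * L ^ (1 / α) / α * (F x - ⨅ y, F y) := by
  have hα0 := hα.1
  have h0 := norm_nonneg (gradient F x)
  have h2 : 0 ≤ (1 + α) * L ^ (1 / α) / α * (F x - ⨅ y, F y) :=
    mul_nonneg (by positivity) (h.sub_nonneg x)
  rcases le_total ‖gradient F x‖ 1 with h1 | h1
  · have : ‖gradient F x‖ ^ 2 ≤ 1 := pow_le_one₀ h0 h1
    linarith
  · have h3 := h.gradient_rpow_le hα0 hL x
    have h4 : ‖gradient F x‖ ^ 2 ≤ ‖gradient F x‖ ^ ((1 + α) / α) := by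
      rw [← Real.rpow_two]
      refine Real.rpow_le_rpow_of_exponent_le h1 ?_
      rw [le_div_iff₀ hα0]; linarith [hα.2]
    linarith

/-! ### Coercive functions -/

lemma Coercive.isBounded_sublevel {F : Vec m → ℝ} (h : Coercive F) (ℓ : ℝ) :
    Bornology.IsBounded (sublevel F ℓ) := by
  have h1 : ∀ᶠ x in Bornology.cobounded (Vec m), ℓ < F x := h.eventually_gt_atTop ℓ
  rw [Bornology.isBounded_def]
  filter_upwards [h1] with x hx
  simpa [sublevel] using hx

lemma Coercive.isCompact_sublevel {F : Vec m → ℝ} (h : Coercive F) (hF : Continuous F) (ℓ : ℝ) :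
    IsCompact (sublevel F ℓ) :=
  Metric.isCompact_of_isClosed_isBounded (isClosed_le hF continuous_const)
    (h.isBounded_sublevel ℓ)

lemma Coercive.exists_forall_le {F : Vec m → ℝ} (h : Coercive F) (hF : Continuous F) :
    ∃ x, (∀ y, F x ≤ F y) ∧ F x = ⨅ y, F y := by
  obtain ⟨x, hx⟩ := hF.exists_forall_le (by rwa [← Metric.cobounded_eq_cocompact])
  refine ⟨x, hx, le_antisymm (le_ciInf hx) (ciInf_le ⟨F x, ?_⟩ x)⟩
  rintro _ ⟨y, rfl⟩
  exact hx y

/-! ### Łojasiewicz inequalities with uniform parameters -/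

lemma UniformLojasiewiczOn.eventually {F : Vec m → ℝ} {K : Set (Vec m)} {β ζ : ℝ}
    (h : UniformLojasiewiczOn F K β ζ) {x : Vec m} (hx : x ∈ K) (hg : gradient F x = 0) :
    ∀ᶠ y in 𝓝 x, |F y - F x| ^ β ≤ ζ * ‖gradient F y‖ := by
  obtain ⟨V, hV, hxV, h⟩ := h x hx hg
  filter_upwards [hV.mem_nhds hxV] with y hy using h y hy

lemma uniformLojasiewiczOn_of_eventually {F : Vec m → ℝ} {K : Set (Vec m)} {β ζ : ℝ}
    (h : ∀ x ∈ K, gradient F x = 0 → ∀ᶠ y in 𝓝 x, |F y - F x| ^ β ≤ ζ * ‖gradient F y‖) :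
    UniformLojasiewiczOn F K β ζ := by
  intro x hx hg
  obtain ⟨V, hV, hVo, hxV⟩ := eventually_nhds_iff.1 (h x hx hg)
  exact ⟨V, hVo, hxV, hV⟩

/-- A local Łojasiewicz inequality holds with constant `1` for every larger exponent. -/
lemma eventually_lojasiewicz_one {F : Vec m → ℝ} (hF : Continuous F) {x : Vec m} {β β' ζ : ℝ}
    (hβ0 : 0 < β) (hβ : β < β')
    (h : ∀ᶠ y in 𝓝 x, |F y - F x| ^ β ≤ ζ * ‖gradient F y‖) :
    ∀ᶠ y in 𝓝 x, |F y - F x| ^ β' ≤ 1 * ‖gradient F y‖ := by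
  have h1 : Tendsto (fun y => |F y - F x| ^ (β' - β) * ζ) (𝓝 x) (𝓝 0) := by
    have h2 : Tendsto (fun y => |F y - F x|) (𝓝 x) (𝓝 0) := by
      simpa using ((hF.tendsto x).sub_const (F x)).abs
    have h3 := (h2.rpow_const (p := β' - β) (Or.inr (by linarith))).mul_const ζ
    rwa [Real.zero_rpow (by linarith), zero_mul] at h3
  filter_upwards [h, h1.eventually (gt_mem_nhds one_pos)] with y hy hy1
  calc |F y - F x| ^ β' = |F y - F x| ^ (β' - β) * |F y - F x| ^ β := by
        rw [← Real.rpow_add_of_nonneg (abs_nonneg _) (by linarith) hβ0.le, sub_add_cancel]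
    _ ≤ |F y - F x| ^ (β' - β) * (ζ * ‖gradient F y‖) := by gcongr
    _ = |F y - F x| ^ (β' - β) * ζ * ‖gradient F y‖ := by ring
    _ ≤ _ := by gcongr

/-- Induction on compact sets. The property is strengthened to all exponents above `β`: unions then
only require a maximum of exponents, and the local constants are absorbed into `1` by a slight
increase of the exponent. -/
theorem Lojasiewicz.exists_uniform {F : Vec m → ℝ} (h : Lojasiewicz F) {K : Set (Vec m)}
    (hK : IsCompact K) : ∃ β ∈ Ioo (0 : ℝ) 1, UniformLojasiewiczOn F K β 1 := by
  obtain ⟨hC1, hL⟩ := h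
  have hFc := hC1.continuous
  suffices hs : ∃ β ∈ Ioo (0 : ℝ) 1, ∀ β' > β, ∀ x ∈ K, gradient F x = 0 →
      ∀ᶠ y in 𝓝 x, |F y - F x| ^ β' ≤ 1 * ‖gradient F y‖ by
    obtain ⟨β, hβ, h⟩ := hs
    exact ⟨(β + 1) / 2, ⟨by linarith [hβ.1], by linarith [hβ.2]⟩,
      uniformLojasiewiczOn_of_eventually (h _ (by linarith [hβ.2]))⟩
  refine hK.induction_on (p := fun K => ∃ β ∈ Ioo (0 : ℝ) 1, ∀ β' > β, ∀ x ∈ K,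
    gradient F x = 0 → ∀ᶠ y in 𝓝 x, |F y - F x| ^ β' ≤ 1 * ‖gradient F y‖) ?_ ?_ ?_ ?_
  · exact ⟨1 / 2, by norm_num, fun _ _ _ hx => hx.elim⟩
  · intro S T hST hT
    obtain ⟨β, hβ, h⟩ := hT
    exact ⟨β, hβ, fun β' hβ' x hx => h β' hβ' x (hST hx)⟩
  · intro S T hS hT
    obtain ⟨β, hβ, h⟩ := hS
    obtain ⟨β₁, hβ₁, h₁⟩ := hT
    refine ⟨max β β₁, ⟨lt_max_of_lt_left hβ.1, max_lt hβ.2 hβ₁.2⟩, fun β' hβ' x hx => ?_⟩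
    rcases hx with hx | hx
    · exact h β' ((le_max_left _ _).trans_lt hβ') x hx
    · exact h₁ β' ((le_max_right _ _).trans_lt hβ') x hx
  · intro x hx
    by_cases hg : gradient F x = 0
    · obtain ⟨V, hVo, hxV, β, hβ, ζ, -, hV⟩ := hL x hg
      refine ⟨V, mem_nhdsWithin_of_mem_nhds (hVo.mem_nhds hxV), β, hβ, fun β' hβ' y hy hgy => ?_⟩
      -- The inequality around `x`, evaluated at another critical point `y`, forces equal values; it
      -- is therefore also an inequality around `y`.
      have hyx : F y = F x := by
        have h1 := hV y hy
        rw [hgy, norm_zero, mul_zero] at h1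
        by_contra hne
        have : 0 < |F y - F x| := abs_pos.2 (sub_ne_zero.2 hne)
        linarith [Real.rpow_pos_of_pos this β]
      refine eventually_lojasiewicz_one hFc hβ.1 hβ' (ζ := ζ) ?_
      filter_upwards [hVo.mem_nhds hy] with z hz
      rw [hyx]
      exact hV z hz
    · refine ⟨{y | gradient F y ≠ 0}, mem_nhdsWithin_of_mem_nhds
        ((isOpen_ne_fun (continuous_gradient hC1) continuous_const).mem_nhds hg), 1 / 2,
        by norm_num, fun β' _ y hy hgy => absurd hgy hy⟩

/-! ### Global Łojasiewicz inequalities -/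

/-- `1 ≤ m` makes the space unbounded, so coercivity produces large values, and the intermediate
value theorem applies. -/
lemma Coercive.exists_value_eq {F : Vec m → ℝ} (hm : 1 ≤ m) (h : Coercive F) (hF : Continuous F)
    {v : ℝ} (hv : ⨅ y, F y ≤ v) : ∃ x, F x = v := by
  obtain ⟨x, -, hx⟩ := h.exists_forall_le hF
  have : Nonempty (Fin m) := ⟨⟨0, hm⟩⟩
  have : (Bornology.cobounded (Vec m)).NeBot := inferInstance
  obtain ⟨y, hy⟩ := (h.eventually_ge_atTop v).exists
  exact mem_range_of_exists_le_of_exists_ge hF ⟨x, by rwa [hx]⟩ ⟨y, hy⟩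

/-- The inequality is the one attached to a minimizer. Smoothness bounds `‖∇F‖` by a multiple of `(F
- inf F) ^ (α / (1 + α))`; since every small positive gap is attained, an exponent `β` below `α / (1
+ α)` would be contradictory. -/
theorem GloballyLojasiewicz.exists_ineq {F : Vec m → ℝ} {L α : ℝ} (hm : 1 ≤ m)
    (h : GloballyLojasiewicz F) (hH : HolderSmooth F L α) (hα : α ∈ Ioc (0 : ℝ) 1) (hL : 0 < L)
    (hc : Coercive F) :
    ∃ β ∈ Ico (α / (1 + α)) 1, ∃ ζ > 0, GlobalLojasiewiczIneq F β ζ := by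
  obtain ⟨hC1, hG⟩ := h
  have hα0 := hα.1
  have hFc := hC1.continuous
  obtain ⟨x, hx, hxv⟩ := hc.exists_forall_le hFc
  have hgx : gradient F x = 0 := by
    have : IsLocalMin F x := Filter.Eventually.of_forall hx
    rw [gradient, this.fderiv_eq_zero, map_zero]
  obtain ⟨β, hβ, ζ, hζ, hβζ⟩ := hG x hgx
  have hineq : GlobalLojasiewiczIneq F β ζ := fun y => by
    have := hβζ y
    rwa [hxv, abs_of_nonneg (hH.sub_nonneg y)] at this
  refine ⟨β, ⟨?_, hβ.2⟩, ζ, hζ, hineq⟩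
  by_contra hlt
  rw [not_le] at hlt
  set K := (1 + α) * L ^ (1 / α) / α with hK
  have hK0 : 0 < K := by positivity
  set q := α / (1 + α) with hq
  have hq0 : 0 < q := by positivity
  set M := ζ * K ^ q with hM
  have hM0 : 0 < M := by positivity
  -- the values of `F - inf F` would be bounded away from zero
  have key : ∀ u > 0, u ^ β ≤ M * u ^ q := by
    intro u hu
    obtain ⟨y, hy⟩ := hc.exists_value_eq hm hFc (v := (⨅ y, F y) + u) (by linarith)
    have h1 := hineq y
    have h2 := hH.gradient_rpow_le hα0 hL y
    have h3 : ‖gradient F y‖ ≤ (K * u) ^ q := by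
      have e : F y - ⨅ y, F y = u := by rw [hy]; ring
      rw [e] at h2
      calc ‖gradient F y‖ = (‖gradient F y‖ ^ ((1 + α) / α)) ^ q := by
            rw [← Real.rpow_mul (norm_nonneg _), hq]
            have : (1 + α) / α * (α / (1 + α)) = 1 := by field_simp
            rw [this, Real.rpow_one]
        _ ≤ _ := by gcongr
    have e : F y - ⨅ y, F y = u := by rw [hy]; ring
    rw [e] at h1
    calc u ^ β ≤ ζ * ‖gradient F y‖ := h1
      _ ≤ ζ * (K * u) ^ q := by gcongr
      _ = _ := by rw [Real.mul_rpow hK0.le hu.le, hM]; ring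
  have h1 : Tendsto (fun u : ℝ => M * u ^ (q - β)) (𝓝[>] 0) (𝓝 0) := by
    have h2 : Tendsto (fun u : ℝ => u ^ (q - β)) (𝓝 0) (𝓝 0) := by
      have := (continuous_id.rpow_const (p := q - β) (fun _ => Or.inr (by linarith))).tendsto
        (0 : ℝ)
      simpa [Real.zero_rpow (show q - β ≠ 0 by linarith)] using this
    simpa using (h2.mono_left nhdsWithin_le_nhds).const_mul M
  obtain ⟨u, hu1, hu2⟩ := ((h1.eventually (gt_mem_nhds one_pos)).and self_mem_nhdsWithin).exists
  have hu : 0 < u := hu2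
  have h3 := key u hu
  rw [Real.rpow_sub hu, ← mul_div_assoc, div_lt_one (Real.rpow_pos_of_pos hu _)] at hu1
  linarith

/-- For exponents at most `1/2`, a global Łojasiewicz inequality implies a Polyak-Łojasiewicz
inequality. -/
lemma GlobalLojasiewiczIneq.le_mul_sq {F : Vec m → ℝ} {L α β ζ : ℝ}
    (h : GlobalLojasiewiczIneq F β ζ) (hH : HolderSmooth F L α) (hα : α ∈ Ioc (0 : ℝ) 1)
    (hL : 0 < L) (hζ : 0 < ζ) (hβ : β ∈ Ioo (α / (1 + α)) 1 ∪ {1 / 2}) (hβ2 : β ≤ 1 / 2)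
    (x : Vec m) :
    F x - ⨅ y, F y ≤ ζ ^ (2 + lam α β * ((1 + α) / α)) *
      ((1 + α) * L ^ (1 / α) / α) ^ lam α β * ‖gradient F x‖ ^ 2 := by
  have hα0 := hα.1
  set K := (1 + α) * L ^ (1 / α) / α with hK
  have hK0 : 0 < K := by positivity
  set V := F x - ⨅ y, F y with hV
  set G := ‖gradient F x‖ with hG
  have hG0 : 0 ≤ G := norm_nonneg _
  have h1 : V ^ β ≤ ζ * G := h x
  rcases (hH.sub_nonneg x).eq_or_lt with h0 | h0
  · rw [hV, ← h0]; positivity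
  change 0 < V at h0
  have h2 : V ^ (2 * β) ≤ ζ ^ 2 * G ^ 2 := by
    rw [mul_comm, Real.rpow_mul h0.le, Real.rpow_two, ← mul_pow]
    gcongr
  rcases hβ2.eq_or_lt with hβ2 | hβ2
  · have : lam α β = 0 := by rw [lam, if_neg (by linarith)]
    rw [this, zero_mul, add_zero, Real.rpow_zero, mul_one, Real.rpow_two]
    rwa [hβ2, mul_one_div_cancel two_ne_zero, Real.rpow_one] at h2
  · have hβ1 : α / (1 + α) < β := by
      rcases hβ with h | h
      · exact h.1
      · exact absurd h hβ2.ne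
    set l := lam α β with hl
    have hd : 0 < (1 + α) / α * β - 1 := by
      rw [div_lt_iff₀ (by linarith)] at hβ1
      rw [div_mul_eq_mul_div, sub_pos, lt_div_iff₀ hα0]
      linarith
    have hlam : l * ((1 + α) / α * β - 1) = 1 - 2 * β := by
      rw [hl, lam, if_pos hβ2, div_mul_cancel₀ _ hd.ne']
    have hl0 : 0 < l := by
      rw [hl, lam, if_pos hβ2]
      exact div_pos (by linarith) hd
    -- Combined with `G ^ ((1 + α) / α) ≤ K * V`, the inequality bounds `V` itself. The power `l` of
    -- this bound controls `V ^ (1 - 2 β)`, the factor missing from `h2`.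
    have h3 : V ^ ((1 + α) / α * β - 1) ≤ ζ ^ ((1 + α) / α) * K := by
      have h4 : V ^ ((1 + α) / α * β) ≤ ζ ^ ((1 + α) / α) * (K * V) := by
        calc V ^ ((1 + α) / α * β) = (V ^ β) ^ ((1 + α) / α) := by
              rw [mul_comm, Real.rpow_mul h0.le]
          _ ≤ (ζ * G) ^ ((1 + α) / α) := by gcongr
          _ = ζ ^ ((1 + α) / α) * G ^ ((1 + α) / α) := Real.mul_rpow hζ.le hG0
          _ ≤ _ := by gcongr; exact hH.gradient_rpow_le hα0 hL x
      rw [Real.rpow_sub_one h0.ne', div_le_iff₀ h0]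
      linarith
    have h5 : V ^ (1 - 2 * β) ≤ ζ ^ (l * ((1 + α) / α)) * K ^ l := by
      calc V ^ (1 - 2 * β) = (V ^ ((1 + α) / α * β - 1)) ^ l := by
            rw [← Real.rpow_mul h0.le, mul_comm _ l, hlam]
        _ ≤ (ζ ^ ((1 + α) / α) * K) ^ l := by gcongr
        _ = _ := by
            rw [Real.mul_rpow (by positivity) hK0.le, ← Real.rpow_mul hζ.le, mul_comm l]
    calc V = V ^ (1 - 2 * β) * V ^ (2 * β) := by
          rw [← Real.rpow_add h0, sub_add_cancel, Real.rpow_one]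
      _ ≤ (ζ ^ (l * ((1 + α) / α)) * K ^ l) * (ζ ^ 2 * G ^ 2) := by gcongr
      _ = _ := by
          rw [Real.rpow_add hζ, Real.rpow_two]; ring

end

section

/-! ### Step sequences -/

lemma exists_pos_le_of_eventually {r : ℕ → ℝ} {c : ℝ} (hr : ∀ k, 0 < r k) (hc : 0 < c)
    (h : ∀ᶠ k in atTop, c ≤ r k) : ∃ c' > 0, ∀ k, c' ≤ r k := by
  obtain ⟨N, hN⟩ := eventually_atTop.1 h
  have : ∀ n, ∃ c' > 0, ∀ k < n, c' ≤ r k := by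
    intro n
    induction n with
    | zero => exact ⟨1, one_pos, fun k hk => absurd hk (Nat.not_lt_zero k)⟩
    | succ n ih =>
      obtain ⟨c', hc', h'⟩ := ih
      refine ⟨min c' (r n), lt_min hc' (hr n), fun k hk => ?_⟩
      rcases Nat.lt_succ_iff_lt_or_eq.1 hk with hk | rfl
      · exact (min_le_left _ _).trans (h' k hk)
      · exact min_le_right _ _
  obtain ⟨c', hc', h'⟩ := this N
  refine ⟨min c c', lt_min hc hc', fun k => ?_⟩
  rcases lt_or_ge k N with hk | hk
  · exact (min_le_right _ _).trans (h' k hk)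
  · exact (min_le_left _ _).trans (hN k hk)

/-- All ratios of steps to powers are positive, so the finitely many indices outside the asymptotic
range only change the constants. -/
lemma exists_stepBounds {γ : ℕ → ℝ} {s : ℝ} (hpos : ∀ n ≥ 1, 0 < γ n)
    (h : IsTheta atTop γ (fun n : ℕ => (n : ℝ) ^ (-s))) :
    ∃ c₁ c₂, StepBounds (fun k => γ (k + 1)) s c₁ c₂ := by
  have hp : ∀ k : ℕ, 0 < ((k : ℝ) + 1) ^ (-s) := fun k => Real.rpow_pos_of_pos (by positivity) _
  have hg : ∀ k, 0 < γ (k + 1) := fun k => hpos _ (by omega)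
  obtain ⟨C, hC, hu⟩ := h.1.exists_pos
  obtain ⟨D, hD, hl⟩ := h.2.exists_pos
  have hu' : ∀ᶠ k : ℕ in atTop, C⁻¹ ≤ ((k : ℝ) + 1) ^ (-s) / γ (k + 1) := by
    filter_upwards [(tendsto_add_atTop_nat 1).eventually hu.bound] with k hk
    rw [Real.norm_of_nonneg (hg k).le] at hk
    push_cast at hk
    rw [Real.norm_of_nonneg (hp k).le] at hk
    rw [le_div_iff₀ (hg k), inv_mul_le_iff₀ hC]
    exact hk
  have hl' : ∀ᶠ k : ℕ in atTop, D⁻¹ ≤ γ (k + 1) / ((k : ℝ) + 1) ^ (-s) := by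
    filter_upwards [(tendsto_add_atTop_nat 1).eventually hl.bound] with k hk
    rw [Real.norm_of_nonneg (hg k).le] at hk
    push_cast at hk
    rw [Real.norm_of_nonneg (hp k).le] at hk
    rw [le_div_iff₀ (hp k), inv_mul_le_iff₀ hD]
    exact hk
  obtain ⟨c, hc, hck⟩ := exists_pos_le_of_eventually (fun k => div_pos (hp k) (hg k))
    (inv_pos.2 hC) hu'
  obtain ⟨c', hc', hck'⟩ := exists_pos_le_of_eventually (fun k => div_pos (hg k) (hp k))
    (inv_pos.2 hD) hl'
  refine ⟨c', c⁻¹, hc', fun k => ?_, fun k => ?_⟩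
  · have := hck' k
    rwa [le_div_iff₀ (hp k)] at this
  · have := hck k
    rw [le_div_iff₀ (hg k)] at this
    rwa [inv_mul_eq_div, le_div_iff₀ hc, mul_comm]

/-- If `γ` is of order `1/n`, the regularity of the steps determines the limit of `n γₙ`. -/
lemma tendsto_mul_step {γ : ℕ → ℝ} {γs c₁ c₂ : ℝ} (hγs : 0 < γs)
    (h : IsLittleO atTop (fun n : ℕ => Real.log (γ n / γ (n + 1))) (fun n => γ (n + 1)) ∨
      IsEquivalent atTop (fun n : ℕ => Real.log (γ n / γ (n + 1))) (fun n => γ (n + 1) / γs))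
    (hb : StepBounds (fun k => γ (k + 1)) 1 c₁ c₂) :
    Tendsto (fun k : ℕ => ((k : ℝ) + 1) * γ (k + 1)) atTop (𝓝 γs) := by
  have hg : ∀ k, 0 < γ (k + 1) := hb.step_pos
  have hγ0 : Tendsto (fun k => γ (k + 1)) atTop (𝓝 0) := by
    have h1 : Tendsto (fun n : ℕ => c₂ * ((n : ℝ) + 1) ^ (-(1 : ℝ))) atTop (𝓝 0) := by
      simpa using (tendsto_add_one_rpow_neg one_pos).const_mul c₂
    exact squeeze_zero (fun k => (hg k).le) hb.upper h1
  -- The indices are shifted by one so that `γ 0`, whose sign is unknown, never enters.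
  obtain ⟨q, hq⟩ : ∃ q : ℕ → ℝ, q = fun n => Real.log (γ (n + 1) / γ (n + 1 + 1)) := ⟨_, rfl⟩
  -- the ratio of the logarithm and the step has a limit
  obtain ⟨l, hl, hlim⟩ : ∃ l, (l = 0 ∨ l = 1 / γs) ∧
      Tendsto (fun n => q n / γ (n + 1 + 1)) atTop (𝓝 l) := by
    rcases h with h | h
    · refine ⟨0, Or.inl rfl, ?_⟩
      have := h.tendsto_div_nhds_zero.comp (tendsto_add_atTop_nat 1)
      rw [hq]
      exact this
    · refine ⟨1 / γs, Or.inr rfl, ?_⟩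
      have h1 := (isEquivalent_iff_tendsto_one (Eventually.of_forall fun n =>
        (div_pos (hg n) hγs).ne')).1 h
      have h2 := (h1.comp (tendsto_add_atTop_nat 1)).mul_const (1 / γs)
      rw [one_mul] at h2
      refine h2.congr fun n => ?_
      have := (hg (n + 1)).ne'
      rw [hq]
      simp only [Function.comp_apply, Pi.div_apply]
      field_simp
  have hq0 : Tendsto q atTop (𝓝 0) := by
    have h1 := hlim.mul (hγ0.comp (tendsto_add_atTop_nat 1))
    rw [mul_zero] at h1
    refine h1.congr fun n => ?_
    simp only [Function.comp_apply]
    exact div_mul_cancel₀ _ (hg (n + 1)).ne'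
  -- The difference equals `(1 - exp (-q n)) / γ (n + 2)`, which is `q n / γ (n + 2)` up to a second
  -- order term.
  have hdiff : Tendsto (fun n => 1 / γ (n + 1 + 1) - 1 / γ (n + 1)) atTop (𝓝 l) := by
    have h1 : Tendsto (fun n => (1 / γ (n + 1 + 1) - 1 / γ (n + 1)) - q n / γ (n + 1 + 1)) atTop
        (𝓝 0) := by
      have h2 : Tendsto (fun n => |q n / γ (n + 1 + 1)| * |q n|) atTop (𝓝 0) := by
        have := hlim.abs.mul hq0.abs
        rwa [abs_zero, mul_zero] at this
      refine squeeze_zero_norm' ?_ h2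
      have hq1 : ∀ᶠ n in atTop, |q n| ≤ 1 := by
        have := hq0.abs
        rw [abs_zero] at this
        exact (this.eventually (gt_mem_nhds one_pos)).mono fun _ h => h.le
      filter_upwards [hq1] with n hn
      have hr : Real.exp (-q n) = γ (n + 1 + 1) / γ (n + 1) := by
        rw [hq]; dsimp only
        rw [← Real.log_inv, Real.exp_log (by have := hg n; have := hg (n + 1); positivity),
          inv_div]
      have h3 := Real.abs_exp_sub_one_sub_id_le (x := -q n) (by rwa [abs_neg])
      have h4 : (1 / γ (n + 1 + 1) - 1 / γ (n + 1)) - q n / γ (n + 1 + 1) =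
          -(Real.exp (-q n) - 1 - -q n) / γ (n + 1 + 1) := by
        have := (hg n).ne'
        have := (hg (n + 1)).ne'
        rw [hr]; field_simp; ring
      rw [h4, Real.norm_eq_abs, abs_div, abs_neg, abs_div, abs_of_pos (hg (n + 1)),
        div_mul_eq_mul_div]
      have : |q n| * |q n| = (-q n) ^ 2 := by rw [abs_mul_abs_self]; ring
      rw [this]
      exact div_le_div_of_nonneg_right h3 (hg (n + 1)).le
    simpa using h1.add hlim
  -- The Cesàro means telescope, so `1 / (n γ (n + 1))` has limit `l`.
  have hces := hdiff.cesaro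
  have hces' : Tendsto (fun n : ℕ => (n : ℝ)⁻¹ * (1 / γ (n + 1))) atTop (𝓝 l) := by
    have h1 : Tendsto (fun n : ℕ => (n : ℝ)⁻¹ * (1 / γ (0 + 1))) atTop (𝓝 0) := by
      simpa using (tendsto_inv_atTop_nhds_zero_nat (𝕜 := ℝ)).mul_const (1 / γ (0 + 1))
    have h2 := hces.add h1
    rw [add_zero] at h2
    refine h2.congr fun n => ?_
    rw [Finset.sum_range_sub (fun i => 1 / γ (i + 1))]
    ring
  -- A step of order at most `1 / n` excludes `l = 0`: when `s = 1`, only the alternative with `γs`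
  -- is possible.
  have hl0 : l ≠ 0 := by
    rintro rfl
    have hC := hb.upper_pos
    have h1 : ∀ᶠ n : ℕ in atTop, 1 / c₂ ≤ (n : ℝ)⁻¹ * (1 / γ (n + 1)) := by
      filter_upwards [eventually_ge_atTop 1] with n hn
      have hn' : (0 : ℝ) < n := by exact_mod_cast hn
      have h2 := hb.upper n
      rw [Real.rpow_neg_one] at h2
      have h3 : γ (n + 1) * n ≤ c₂ := by
        calc γ (n + 1) * n ≤ c₂ * ((n : ℝ) + 1)⁻¹ * n := by gcongr
          _ = c₂ * (n / ((n : ℝ) + 1)) := by ring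
          _ ≤ c₂ * 1 := by
            gcongr
            rw [div_le_one (by positivity)]; linarith
          _ = c₂ := mul_one _
      have := hg n
      rw [← one_div, one_div_mul_one_div, div_le_div_iff₀ hC (by positivity)]
      linarith
    have := ge_of_tendsto hces' h1
    have : 0 < 1 / c₂ := by positivity
    linarith
  have hl' : l = 1 / γs := hl.resolve_left hl0
  have h5 := hces'.inv₀ hl0
  rw [hl', one_div, inv_inv] at h5
  have h6 := h5.add hγ0
  rw [add_zero] at h6
  refine h6.congr' ?_
  filter_upwards [eventually_ge_atTop 1] with n hn
  have hn' : (0 : ℝ) < n := by exact_mod_cast hn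
  have := (hg n).ne'
  field_simp

/-! ### Exponents -/

variable {Ω : Type*} [MeasurableSpace Ω]

/-- One bound with the largest exponent, at `σ = σmin`, gives the whole family: a larger `σ` lowers
the exponent and raises `K / (1 - σ)`. -/
lemma rateFamily_of_forall {P : Measure Ω} [IsProbabilityMeasure P] {err : ℕ → Ω → ℝ}
    {δ K σmin e : ℝ} {n₀ : ℕ} {scale q : ℕ → ℝ} (hK : 0 ≤ K) (he : 0 ≤ e) (hσ0 : 0 ≤ σmin)
    (hσ : σmin < 1)
    (hq0 : ∀ n ≥ n₀, 0 ≤ q n)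
    (hq : ∀ x, 0 ≤ x → x ≤ e * (1 - σmin) → ∀ n ≥ n₀, q n ≤ scale n ^ (-x))
    (h : ∀ n ≥ n₀, 1 - δ ≤ P.real {ω | err n ω ≤ K * q n}) :
    RateFamily P err δ K σmin e n₀ scale := by
  refine ⟨⟨⟨σmin, ⟨le_rfl, hσ⟩, rfl⟩, ?_⟩, fun σ hσ' n hn => (h n hn).trans ?_⟩
  · rintro _ ⟨σ, hσ', rfl⟩
    exact mul_le_mul_of_nonneg_left (by linarith [hσ'.1]) he
  · refine measureReal_mono (fun ω hω => ?_) (measure_ne_top _ _)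
    refine le_trans (show err n ω ≤ K * q n from hω) ?_
    have h1 : 0 < 1 - σ := by linarith [hσ'.2]
    have h2 := hq (e * (1 - σ)) (mul_nonneg he h1.le)
      (mul_le_mul_of_nonneg_left (by linarith [hσ'.1]) he) n hn
    refine mul_le_mul ?_ h2 (hq0 n hn) (by positivity)
    rw [le_div_iff₀ h1]
    have : 0 ≤ σ := hσ0.trans hσ'.1
    nlinarith

lemma add_one_rpow_neg_le {X x : ℝ} (h0 : 0 ≤ x) (h : x ≤ X) {n : ℕ} (hn : 1 ≤ n) :
    ((n : ℝ) + 1) ^ (-X) ≤ (n : ℝ) ^ (-x) := by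
  have hn' : (1 : ℝ) ≤ n := by exact_mod_cast hn
  calc ((n : ℝ) + 1) ^ (-X) ≤ ((n : ℝ) + 1) ^ (-x) :=
        Real.rpow_le_rpow_of_exponent_le (by linarith) (by linarith)
    _ ≤ _ := Real.rpow_le_rpow_of_nonpos (by linarith) (by linarith) (by linarith)

lemma log_add_two_rpow_neg_le {X x : ℝ} (h0 : 0 ≤ x) (h : x ≤ X) {n : ℕ} (hn : 2 ≤ n) :
    Real.log ((n : ℝ) + 2) ^ (-X) ≤ Real.log (n : ℝ) ^ (-x) := by
  have hn' : (2 : ℝ) ≤ n := by exact_mod_cast hn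
  have hl : 0 < Real.log n := Real.log_pos (by linarith)
  have h1 : 1 ≤ Real.log ((n : ℝ) + 2) := isClock_log.one_le n (by omega)
  -- At `n = 2` the logarithm is below `1` and its negative powers are at least `1`, so the
  -- comparison passes through `1`.
  rcases le_total (Real.log n) 1 with h2 | h2
  · exact (Real.rpow_le_one_of_one_le_of_nonpos h1 (by linarith)).trans
      (Real.one_le_rpow_of_pos_of_le_one_of_nonpos hl h2 (by linarith))
  · calc _ ≤ Real.log ((n : ℝ) + 2) ^ (-x) :=
          Real.rpow_le_rpow_of_exponent_le h1 (by linarith)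
      _ ≤ _ := Real.rpow_le_rpow_of_nonpos hl
          (Real.log_le_log (by linarith) (by linarith)) (by linarith)

/-- The constraints on the exponents. -/
structure Exponents (α ρ s : ℝ) : Prop where
  hα : α ∈ Ioc (0 : ℝ) 1
  three_lt : 3 < ρ
  two_lt : 2 < α * ρ
  le_one : s ≤ 1
  three_fourths_lt : 3 / 4 < s
  two_lt_mul : 2 < (2 + α) * s
  mul_le : ρ * (1 - s) ≤ s

/-- Inserting `s ≥ ρ / (1 + ρ)`: `ρ > 3` gives `s > 3 / 4`, so the noise exponent `s - 3 / 4` is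
positive, and `α ρ > 2` gives `(2 + α) s > 2`, that is `1 - s < (1 + α) s - 1`. -/
lemma exponents {α ρ s : ℝ} (hα : α ∈ Ioc (0 : ℝ) 1) (hρ : max 3 (2 / α) < ρ)
    (hs : s ∈ Icc (ρ / (1 + ρ)) 1) : Exponents α ρ s := by
  have h3 : 3 < ρ := (le_max_left _ _).trans_lt hρ
  have h2 : 2 < α * ρ := by
    have := (le_max_right _ _).trans_lt hρ
    rwa [div_lt_iff₀ hα.1, mul_comm] at this
  have h1 := hs.1
  rw [div_le_iff₀ (by linarith)] at h1
  refine ⟨hα, h3, h2, hs.2, by nlinarith, ?_, by linarith⟩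
  have hα0 := hα.1
  have hs0 : 0 < s := lt_of_lt_of_le (by positivity) hs.1
  nlinarith

namespace Exponents

variable {α ρ s : ℝ}

lemma pos (h : Exponents α ρ s) : 0 < s := by linarith [h.three_fourths_lt]

lemma one_lt (h : Exponents α ρ s) : 1 < (1 + α) * s := by nlinarith [h.two_lt_mul, h.le_one]

lemma expBase_nonneg (h : Exponents α ρ s) : 0 ≤ expBase α s :=
  le_min (by linarith [h.three_fourths_lt]) (by linarith [h.one_lt])

lemma half_le_sigmaBase (h : Exponents α ρ s) : 1 / 2 ≤ sigmaBase α s := by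
  refine le_trans ?_ (le_max_left _ _)
  have := h.three_fourths_lt
  rw [div_le_div_iff₀ (by norm_num) (by linarith)]
  linarith [h.le_one]

lemma sigmaBase_lt_one (h : Exponents α ρ s) : sigmaBase α s < 1 := by
  refine max_lt ?_ ?_
  · rw [div_lt_one] <;> linarith [h.three_fourths_lt]
  · rw [div_lt_one] <;> nlinarith [h.two_lt_mul, h.one_lt]

/-- Each entry of `sigmaBase` is the value of `σ` at which the matching entry of `expBase`, times `1
- σ`, equals an available exponent: that of the noise, and that of the length for `τ = (1 + α) s -
1`. -/
lemma expBase_mul_le (h : Exponents α ρ s) {σ e : ℝ} (hσ : sigmaBase α s ≤ σ) (hσ1 : σ < 1) (he : e ≤ expBase α s) :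
    e * (1 - σ) ≤ s - 3 / 4 ∧ e * (1 - σ) ≤ ((1 + α) * s - 1 - (1 - s)) / 2 := by
  have h1 : e * (1 - σ) ≤ expBase α s * (1 - σ) :=
    mul_le_mul_of_nonneg_right he (by linarith)
  have hs := h.three_fourths_lt
  have ho := h.one_lt
  constructor
  · have e1 : 1 / (2 * (2 * s - 1)) ≤ σ := (le_max_left _ _).trans hσ
    rw [div_le_iff₀ (by linarith)] at e1
    have e2 : expBase α s * (1 - σ) ≤ (2 * s - 1) / 2 * (1 - σ) :=
      mul_le_mul_of_nonneg_right (min_le_left _ _) (by linarith)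
    nlinarith
  · have e1 : α * s / (2 * ((1 + α) * s - 1)) ≤ σ := (le_max_right _ _).trans hσ
    rw [div_le_iff₀ (by linarith)] at e1
    have e2 : expBase α s * (1 - σ) ≤ ((1 + α) * s - 1) * (1 - σ) :=
      mul_le_mul_of_nonneg_right (min_le_right _ _) (by linarith)
    nlinarith

lemma max_one_sub (α : ℝ) : max (1 - α) (1 / 2) = 1 - min α (1 / 2) := by
  rcases le_total α (1 / 2) with h | h
  · rw [min_eq_left h, max_eq_left (by linarith)]
  · rw [min_eq_right h, max_eq_right (by linarith)]; norm_num

lemma one_lt_min (h : Exponents α ρ s) : 1 < (1 + min α (1 / 2)) * s := by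
  rcases le_total α (1 / 2) with h' | h'
  · rw [min_eq_left h']; exact h.one_lt
  · rw [min_eq_right h']; linarith [h.three_fourths_lt]

/-- The exponents of the local case with `β ≤ 1/2`. -/
lemma local_linear (h : Exponents α ρ s) {σ : ℝ}
    (hσ : σ = max (sigmaBase α s)
        ((1 - max (1 - α) (1 / 2) * s) / (2 * min α (1 / 2) * s))) :
    0 ≤ σ ∧ σ < 1 ∧ 0 ≤ min (min α (1 / 2) * s) (expBase α s) ∧
    min (min α (1 / 2) * s) (expBase α s) * (1 - σ) ≤ s - 3 / 4 ∧
    min (min α (1 / 2) * s) (expBase α s) * (1 - σ) ≤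
      (min (s / 2) ((1 + α) * s - 1) - (1 - s)) / 2 := by
  have hs := h.pos
  set a := min α (1 / 2) with ha
  have ha0 : 0 < a := lt_min h.hα.1 (by norm_num)
  have ha2 : a ≤ 1 / 2 := min_le_right _ _
  have h1 : 1 < (1 + a) * s := h.one_lt_min
  rw [max_one_sub] at hσ
  have hb : sigmaBase α s ≤ σ := hσ ▸ le_max_left _ _
  have hr : (1 - (1 - a) * s) / (2 * a * s) ≤ σ := hσ ▸ le_max_right _ _
  have hσ1 : σ < 1 := by
    rw [hσ]
    refine max_lt h.sigmaBase_lt_one ?_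
    rw [div_lt_one (by positivity)]
    linarith
  obtain ⟨e1, e2⟩ := h.expBase_mul_le hb hσ1 (min_le_right (a * s) _)
  refine ⟨by linarith [h.half_le_sigmaBase], hσ1,
    le_min (by positivity) h.expBase_nonneg, e1, ?_⟩
  rw [div_le_iff₀ (by positivity)] at hr
  -- The lower bound on `σ` gives `a s (1 - σ) ≤ ((1 + a) s - 1) / 2`, and `a ≤ 1 / 2` compares this
  -- with the length exponent for `τ = s / 2`.
  have e3 : min (a * s) (expBase α s) * (1 - σ) ≤ a * s * (1 - σ) :=
    mul_le_mul_of_nonneg_right (min_le_left _ _) (by linarith)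
  rw [le_div_iff₀ two_pos, le_sub_iff_add_le]
  refine le_min ?_ (by linarith)
  nlinarith

/-- The exponents of the cases with `β > 1/2`, `s < 1`. -/
lemma pow_case (h : Exponents α ρ s) {σ r β τ : ℝ} (hr : 1 < r) (hσ : σ = max (sigmaBase α s) ((1 + r) / (2 * r)))
    (hrβ : r ≤ 1 / (2 * β - 1))
    (hτ : τ = (1 + α) * s - 1 ∨
      (τ = min (s / 2) ((1 + α) * s - 1) ∧ r ≤ (ρ - 1) / 2)) :
    0 ≤ σ ∧ σ < 1 ∧ 0 ≤ min (r * (1 - s)) (expBase α s) ∧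
    min (r * (1 - s)) (expBase α s) * (1 - σ) ≤ s - 3 / 4 ∧
    min (r * (1 - s)) (expBase α s) * (1 - σ) ≤
      (min τ ((1 - s) / (2 * β - 1)) - (1 - s)) / 2 := by
  have hb : sigmaBase α s ≤ σ := hσ ▸ le_max_left _ _
  have hr' : (1 + r) / (2 * r) ≤ σ := hσ ▸ le_max_right _ _
  have h1s : 0 ≤ 1 - s := by linarith [h.le_one]
  have hσ1 : σ < 1 := by
    rw [hσ]
    refine max_lt h.sigmaBase_lt_one ?_
    rw [div_lt_one (by positivity)]
    linarith
  obtain ⟨e1, e2⟩ := h.expBase_mul_le hb hσ1 (min_le_right (r * (1 - s)) _)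
  refine ⟨by linarith [h.half_le_sigmaBase], hσ1,
    le_min (by positivity) h.expBase_nonneg, e1, ?_⟩
  rw [div_le_iff₀ (by positivity)] at hr'
  have e3 : min (r * (1 - s)) (expBase α s) * (1 - σ) ≤ r * (1 - s) * (1 - σ) :=
    mul_le_mul_of_nonneg_right (min_le_left _ _) (by linarith)
  have e4 : r * (1 - s) * (1 - σ) ≤ (r - 1) * (1 - s) / 2 := by
    have : r * (1 - σ) ≤ (r - 1) / 2 := by linarith
    calc _ = (r * (1 - σ)) * (1 - s) := by ring
      _ ≤ (r - 1) / 2 * (1 - s) := by gcongr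
      _ = _ := by ring
  rw [le_div_iff₀ two_pos, le_sub_iff_add_le]
  refine le_min ?_ ?_
  · rcases hτ with rfl | ⟨rfl, hτ⟩
    · linarith
    -- From `r ≤ (ρ - 1) / 2` and `ρ (1 - s) ≤ s` follows `r (1 - s) ≤ s / 2`; this is the role of
    -- the term `(ρ - 1) / 2` in `rLocal`.
    · refine le_min ?_ (by linarith)
      have := mul_le_mul_of_nonneg_right hτ h1s
      nlinarith [h.mul_le]
  · have : r * (1 - s) ≤ (1 - s) / (2 * β - 1) := by
      rw [div_eq_mul_one_div, mul_comm]
      exact mul_le_mul_of_nonneg_left hrβ h1s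
    linarith

/-- The exponents of the cases with `β > 1/2`, `s = 1`. -/
lemma log_case {r β : ℝ} (hr : 1 < r) (hrβ : r ≤ 1 / (2 * β - 1)) :
    0 ≤ (1 + r) / (2 * r) ∧ (1 + r) / (2 * r) < 1 ∧
    r * (1 - (1 + r) / (2 * r)) = (r - 1) / 2 ∧ (r - 1) / 2 ≤ (1 / (2 * β - 1) - 1) / 2 := by
  refine ⟨by positivity, ?_, ?_, by linarith⟩
  · rw [div_lt_one (by positivity)]; linarith
  · field_simp; ring

lemma one_lt_rLocal (h : Exponents α ρ s) {β : ℝ} (hβ : 1 / 2 < β) (hβ1 : β < 1) : 1 < rLocal α ρ β := by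
  refine lt_min ?_ (lt_min (by linarith [h.two_lt]) (by linarith [h.three_lt]))
  rw [lt_div_iff₀ (by linarith)]; linarith

lemma one_lt_rGlobal (h : Exponents α ρ s) {β : ℝ} (hβ : 1 / 2 < β) (hβ1 : β < 1) : 1 < rGlobal α ρ β := by
  refine lt_min ?_ (by linarith [h.two_lt])
  rw [lt_div_iff₀ (by linarith)]; linarith

end Exponents

end

section

/-! ### Processes driven by independent innovations -/

section Innovation

variable {Ω E S : Type*} [mΩ : MeasurableSpace Ω] [mE : MeasurableSpace E] [mS : MeasurableSpace S]

/-- The process `θ` is adapted, and the innovations `ξ n` have law `μ` and are independent of the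
past. -/
structure Innovation (P : Measure Ω) (ℱ : Filtration ℕ mΩ) (ξ : ℕ → Ω → E) (θ : ℕ → Ω → S)
    (μ : Measure E) : Prop where
  measurable : ∀ n, Measurable (ξ n)
  law : ∀ n, P.map (ξ n) = μ
  indep : ∀ n, Indep (ℱ n) (mE.comap (ξ n)) P
  adapted : ∀ n, Measurable[ℱ n] (θ n)
  past : ∀ n, Measurable[ℱ (n + 1)] (ξ n)

variable {P : Measure Ω} {ℱ : Filtration ℕ mΩ} {ξ : ℕ → Ω → E}
  {θ : ℕ → Ω → S} {μ : Measure E}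

namespace Innovation

lemma measurable_state (h : Innovation P ℱ ξ θ μ) (n : ℕ) : Measurable (θ n) :=
  (h.adapted n).mono (ℱ.le n) le_rfl

variable [IsProbabilityMeasure P]

lemma isProbabilityMeasure (h : Innovation P ℱ ξ θ μ) : IsProbabilityMeasure μ := by
  rw [← h.law 0]
  exact Measure.isProbabilityMeasure_map (h.measurable 0).aemeasurable

/-- Independence of the innovation from the past in its usable form: every conditioning below
reduces to Fubini for this product law. -/
lemma map_prod {S' : Type*} [mS' : MeasurableSpace S'] (h : Innovation P ℱ ξ θ μ) {n : ℕ}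
    {Y : Ω → S'} (hY : Measurable[ℱ n] Y) :
    P.map (fun ω => (Y ω, ξ n ω)) = (P.map Y).prod μ := by
  rw [← h.law n]
  refine (indepFun_iff_map_prod_eq_prod_map_map (hY.mono (ℱ.le n) le_rfl).aemeasurable
    (h.measurable n).aemeasurable).1 ?_
  exact indep_of_indep_of_le_left (h.indep n) (measurable_iff_comap_le.1 hY)

lemma lintegral_comp (h : Innovation P ℱ ξ θ μ) (n : ℕ) {f : E → S → ENNReal}
    (hf : Measurable (Function.uncurry f)) :
    ∫⁻ ω, f (ξ n ω) (θ n ω) ∂P = ∫⁻ ω, ∫⁻ x, f x (θ n ω) ∂μ ∂P := by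
  have := h.isProbabilityMeasure
  have hf' : Measurable fun z : S × E => f z.2 z.1 := hf.comp measurable_swap
  calc ∫⁻ ω, f (ξ n ω) (θ n ω) ∂P = ∫⁻ z, f z.2 z.1 ∂(P.map fun ω => (θ n ω, ξ n ω)) :=
        (lintegral_map hf' ((h.measurable_state n).prodMk (h.measurable n))).symm
    _ = ∫⁻ y, ∫⁻ x, f x y ∂μ ∂(P.map (θ n)) := by
        rw [h.map_prod (h.adapted n), lintegral_prod _ hf'.aemeasurable]
    _ = _ := lintegral_map hf'.lintegral_prod_right' (h.measurable_state n)

/-- Tonelli: a bound on the integral with the state frozen, once integrable along the process,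
yields both integrability and a bound on the mean. -/
lemma integrable_of_le (h : Innovation P ℱ ξ θ μ) (n : ℕ) {f : E → S → ℝ}
    (hf : Measurable (Function.uncurry f)) (hf0 : ∀ x y, 0 ≤ f x y) {D : S → ℝ}
    (hD : ∀ y, Integrable (fun x => f x y) μ ∧ ∫ x, f x y ∂μ ≤ D y)
    (hDi : Integrable (fun ω => D (θ n ω)) P) :
    Integrable (fun ω => f (ξ n ω) (θ n ω)) P ∧
      ∫ ω, f (ξ n ω) (θ n ω) ∂P ≤ ∫ ω, D (θ n ω) ∂P := by
  have hD0 : ∀ y, 0 ≤ D y := fun y => (integral_nonneg fun x => hf0 x y).trans (hD y).2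
  have hm : Measurable fun ω => f (ξ n ω) (θ n ω) :=
    hf.comp ((h.measurable n).prodMk (h.measurable_state n))
  have key : ∫⁻ ω, ENNReal.ofReal (f (ξ n ω) (θ n ω)) ∂P ≤
      ∫⁻ ω, ENNReal.ofReal (D (θ n ω)) ∂P := by
    rw [h.lintegral_comp n (f := fun x y => ENNReal.ofReal (f x y)) hf.ennreal_ofReal]
    refine lintegral_mono fun ω => ?_
    rw [← ofReal_integral_eq_lintegral_ofReal (hD _).1 (Eventually.of_forall fun x => hf0 x _)]
    exact ENNReal.ofReal_le_ofReal (hD _).2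
  have hDl : ∫⁻ ω, ENNReal.ofReal (D (θ n ω)) ∂P = ENNReal.ofReal (∫ ω, D (θ n ω) ∂P) :=
    (ofReal_integral_eq_lintegral_ofReal hDi (Eventually.of_forall fun ω => hD0 _)).symm
  have hi : Integrable (fun ω => f (ξ n ω) (θ n ω)) P := by
    refine ⟨hm.aestronglyMeasurable, ?_⟩
    rw [hasFiniteIntegral_iff_ofReal (Eventually.of_forall fun ω => hf0 _ _)]
    exact (key.trans_eq hDl).trans_lt ENNReal.ofReal_lt_top
  refine ⟨hi, ?_⟩
  rw [← ENNReal.ofReal_le_ofReal_iff (integral_nonneg fun ω => hD0 _), ← hDl,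
    ofReal_integral_eq_lintegral_ofReal hi (Eventually.of_forall fun ω => hf0 _ _)]
  exact key

/-- Freezing: given the past, the state is a constant and the innovation is integrated out. The
defining identity of conditional expectation on an event of the past is Fubini for the event, the
state and the innovation. -/
lemma condExp_comp (h : Innovation P ℱ ξ θ μ) (n : ℕ) {f : E → S → ℝ}
    (hf : Measurable (Function.uncurry f))
    (hi : Integrable (fun ω => f (ξ n ω) (θ n ω)) P) :
    (fun ω => ∫ x, f x (θ n ω) ∂μ) =ᵐ[P] P[fun ω => f (ξ n ω) (θ n ω) | ℱ n] := by
  have := h.isProbabilityMeasure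
  have hf' : Measurable fun z : S × E => f z.2 z.1 := hf.comp measurable_swap
  have hpm := (h.measurable_state n).prodMk (h.measurable n)
  have hmean : StronglyMeasurable fun y => ∫ x, f x y ∂μ :=
    hf'.stronglyMeasurable.integral_prod_right'
  have hiprod : Integrable (fun z : S × E => f z.2 z.1) ((P.map (θ n)).prod μ) := by
    rw [← h.map_prod (h.adapted n)]
    exact (integrable_map_measure hf'.aestronglyMeasurable hpm.aemeasurable).2 hi
  have hmi : Integrable (fun ω => ∫ x, f x (θ n ω) ∂μ) P :=
    hiprod.integral_prod_left.comp_measurable (h.measurable_state n)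
  refine ae_eq_condExp_of_forall_setIntegral_eq (ℱ.le n) hi (fun s _ _ => hmi.integrableOn)
    (fun s hs _ => ?_) (hmean.measurable.comp (h.adapted n)).aestronglyMeasurable
  -- disintegration of the pair `(1_s, θ n)` and the innovation
  set Y : Ω → ℝ × S := fun ω => (s.indicator (fun _ => 1) ω, θ n ω) with hY
  have hYm : Measurable[ℱ n] Y :=
    Measurable.prodMk (measurable_const.indicator hs) (h.adapted n)
  have hYm' : Measurable Y := hYm.mono (ℱ.le n) le_rfl
  have hg' : Measurable fun z : (ℝ × S) × E => z.1.1 * f z.2 z.1.2 :=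
    (measurable_fst.comp measurable_fst).mul
      (hf'.comp ((measurable_snd.comp measurable_fst).prodMk measurable_snd))
  have hind : ∀ (u : Ω → ℝ), (fun ω => s.indicator (fun _ => (1 : ℝ)) ω * u ω) = s.indicator u := by
    intro u; ext ω; by_cases hω : ω ∈ s <;> simp [hω]
  have hs' : MeasurableSet s := ℱ.le n s hs
  have hgi : Integrable (fun z : (ℝ × S) × E => z.1.1 * f z.2 z.1.2) ((P.map Y).prod μ) := by
    rw [← h.map_prod hYm, integrable_map_measure hg'.aestronglyMeasurable
      (hYm'.prodMk (h.measurable n)).aemeasurable]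
    have : (fun z : (ℝ × S) × E => z.1.1 * f z.2 z.1.2) ∘ (fun ω => (Y ω, ξ n ω)) =
        s.indicator fun ω => f (ξ n ω) (θ n ω) := by
      rw [← hind]; rfl
    rw [this]
    exact hi.indicator hs'
  calc ∫ ω in s, ∫ x, f x (θ n ω) ∂μ ∂P
      = ∫ ω, (Y ω).1 * ∫ x, f x (Y ω).2 ∂μ ∂P := by
        rw [← integral_indicator hs', ← hind]
    _ = ∫ y, y.1 * ∫ x, f x y.2 ∂μ ∂(P.map Y) := by
        refine (integral_map (f := fun y : ℝ × S => y.1 * ∫ x, f x y.2 ∂μ)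
          hYm'.aemeasurable ?_).symm
        exact (measurable_fst.mul (hmean.measurable.comp measurable_snd)).aestronglyMeasurable
    _ = ∫ z, z.1.1 * f z.2 z.1.2 ∂((P.map Y).prod μ) := by
        rw [integral_prod _ hgi]
        refine integral_congr_ae (Eventually.of_forall fun y => ?_)
        change y.1 * ∫ x, f x y.2 ∂μ = ∫ x, y.1 * f x y.2 ∂μ
        rw [integral_const_mul]
    _ = ∫ ω, (Y ω).1 * f (ξ n ω) (Y ω).2 ∂P := by
        rw [← h.map_prod hYm]
        exact integral_map (hYm'.prodMk (h.measurable n)).aemeasurable hg'.aestronglyMeasurable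
    _ = _ := by
        rw [← integral_indicator hs', ← hind]

end Innovation

variable [IsProbabilityMeasure P]

/-- The centered increments `h_k(ξ_k, θ_k) - ∫ h_k(x, θ_k) dμ(x)`. -/
def centered (μ : Measure E) (ξ : ℕ → Ω → E) (θ : ℕ → Ω → S) (f : ℕ → E → S → ℝ) (k : ℕ)
    (ω : Ω) : ℝ :=
  f k (ξ k ω) (θ k ω) - ∫ x, f k x (θ k ω) ∂μ

namespace Innovation

variable {f : ℕ → E → S → ℝ}

lemma centered_ae_eq (h : Innovation P ℱ ξ θ μ) {k : ℕ} (hf : Measurable (Function.uncurry (f k)))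
    (hi : Integrable (fun ω => f k (ξ k ω) (θ k ω)) P) :
    centered μ ξ θ f k =ᵐ[P] (fun ω => f k (ξ k ω) (θ k ω)) -
      P[fun ω => f k (ξ k ω) (θ k ω) | ℱ k] := by
  filter_upwards [h.condExp_comp k hf hi] with ω hω
  simp only [centered, Pi.sub_apply, hω]

lemma stronglyMeasurable_centered (h : Innovation P ℱ ξ θ μ) {k n : ℕ} (hkn : k < n)
    (hf : Measurable (Function.uncurry (f k))) :
    StronglyMeasurable[ℱ n] (centered μ ξ θ f k) := by
  have := h.isProbabilityMeasure
  have hle : ℱ (k + 1) ≤ ℱ n := ℱ.mono hkn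
  have hle' : ℱ k ≤ ℱ n := ℱ.mono hkn.le
  have hf' : Measurable fun z : S × E => f k z.2 z.1 := hf.comp measurable_swap
  have hmean : Measurable fun y => ∫ x, f k x y ∂μ :=
    hf'.stronglyMeasurable.integral_prod_right'.measurable
  have hξ : Measurable[ℱ n] (ξ k) := (h.past k).mono hle le_rfl
  have hθ : Measurable[ℱ n] (θ k) := (h.adapted k).mono hle' le_rfl
  exact ((hf.comp (hξ.prodMk hθ)).sub (hmean.comp hθ)).stronglyMeasurable

lemma memLp_centered (h : Innovation P ℱ ξ θ μ) {k : ℕ} (hf : Measurable (Function.uncurry (f k)))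
    (hL : MemLp (fun ω => f k (ξ k ω) (θ k ω)) 2 P) : MemLp (centered μ ξ θ f k) 2 P := by
  refine MemLp.ae_eq (h.centered_ae_eq hf (hL.integrable one_le_two)).symm ?_
  exact hL.sub (hL.condExp one_le_two)

lemma condExp_centered (h : Innovation P ℱ ξ θ μ) {k : ℕ}
    (hf : Measurable (Function.uncurry (f k)))
    (hi : Integrable (fun ω => f k (ξ k ω) (θ k ω)) P) :
    P[centered μ ξ θ f k | ℱ k] =ᵐ[P] 0 := by
  have h1 := condExp_congr_ae (m := ℱ k) (h.centered_ae_eq hf hi)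
  have h2 := condExp_sub hi (integrable_condExp (m := ℱ k)
    (f := fun ω => f k (ξ k ω) (θ k ω)) (μ := P)) (ℱ k)
  have h3 := condExp_of_stronglyMeasurable (ℱ.le k) (stronglyMeasurable_condExp (m := ℱ k)
    (f := fun ω => f k (ξ k ω) (θ k ω)) (μ := P)) integrable_condExp
  filter_upwards [h1, h2] with ω e1 e2
  rw [e1, e2, Pi.sub_apply, h3, sub_self, Pi.zero_apply]

/-- Centering subtracts a conditional expectation, so the left side is the mean of a conditional
variance. -/
lemma integral_sq_centered_le (h : Innovation P ℱ ξ θ μ) {k : ℕ}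
    (hf : Measurable (Function.uncurry (f k)))
    (hL : MemLp (fun ω => f k (ξ k ω) (θ k ω)) 2 P) :
    ∫ ω, centered μ ξ θ f k ω ^ 2 ∂P ≤ ∫ ω, f k (ξ k ω) (θ k ω) ^ 2 ∂P := by
  have h1 := h.centered_ae_eq hf (hL.integrable one_le_two)
  have h2 := condVar_ae_le_condExp_sq (ℱ.le k) hL
  have h3 : ∫ ω, centered μ ξ θ f k ω ^ 2 ∂P =
      ∫ ω, ((fun ω => f k (ξ k ω) (θ k ω)) -
        P[fun ω => f k (ξ k ω) (θ k ω) | ℱ k]) ω ^ 2 ∂P := by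
    refine integral_congr_ae ?_
    filter_upwards [h1] with ω hω
    rw [hω]
  rw [h3]
  calc _ = ∫ ω, Var[fun ω => f k (ξ k ω) (θ k ω); P | ℱ k] ω ∂P :=
        (integral_condExp (ℱ.le k)).symm
    _ ≤ ∫ ω, P[(fun ω => f k (ξ k ω) (θ k ω)) ^ 2 | ℱ k] ω ∂P :=
        integral_mono_ae integrable_condExp integrable_condExp h2
    _ = _ := integral_condExp (ℱ.le k)

/-- Orthogonality of martingale increments: the cross terms vanish upon conditioning on the past. -/
lemma integral_sq_sum_centered_le (h : Innovation P ℱ ξ θ μ)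
    (hf : ∀ k, Measurable (Function.uncurry (f k)))
    (hL : ∀ k, MemLp (fun ω => f k (ξ k ω) (θ k ω)) 2 P) {n m : ℕ} (hnm : n ≤ m) :
    MemLp (fun ω => ∑ k ∈ Finset.Ico n m, centered μ ξ θ f k ω) 2 P ∧
    ∫ ω, (∑ k ∈ Finset.Ico n m, centered μ ξ θ f k ω) ^ 2 ∂P ≤
      ∑ k ∈ Finset.Ico n m, ∫ ω, f k (ξ k ω) (θ k ω) ^ 2 ∂P := by
  have hc := fun k => h.memLp_centered (hf k) (hL k)
  have hS : ∀ m, MemLp (fun ω => ∑ k ∈ Finset.Ico n m, centered μ ξ θ f k ω) 2 P := fun m =>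
    memLp_finsetSum _ fun k _ => hc k
  refine ⟨hS m, ?_⟩
  induction m, hnm using Nat.le_induction with
  | base => simp
  | succ m hm ih =>
    have hSm : StronglyMeasurable[ℱ m] fun ω => ∑ k ∈ Finset.Ico n m, centered μ ξ θ f k ω :=
      Finset.stronglyMeasurable_fun_sum _ fun k hk =>
        h.stronglyMeasurable_centered (Finset.mem_Ico.1 hk).2 (hf k)
    have hprod := (hS m).integrable_mul (hc m)
    have hzero : ∫ ω, (∑ k ∈ Finset.Ico n m, centered μ ξ θ f k ω) * centered μ ξ θ f m ω ∂P
        = 0 := by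
      have h1 := condExp_mul_of_stronglyMeasurable_left hSm hprod
        ((hc m).integrable one_le_two)
      have h2 := h.condExp_centered (hf m) ((hL m).integrable one_le_two)
      have h3 := integral_condExp (ℱ.le m) (μ := P)
        (f := (fun ω => ∑ k ∈ Finset.Ico n m, centered μ ξ θ f k ω) * centered μ ξ θ f m)
      refine h3.symm.trans ?_
      rw [← integral_zero Ω ℝ (μ := P)]
      refine integral_congr_ae ?_
      filter_upwards [h1, h2] with ω e1 e2
      rw [e1, Pi.mul_apply, e2, Pi.zero_apply, mul_zero]
    rw [Finset.sum_Ico_succ_top hm]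
    calc _ = ∫ ω, ((∑ k ∈ Finset.Ico n m, centered μ ξ θ f k ω) ^ 2 +
          2 * ((∑ k ∈ Finset.Ico n m, centered μ ξ θ f k ω) * centered μ ξ θ f m ω) +
          centered μ ξ θ f m ω ^ 2) ∂P := by
          refine integral_congr_ae (Eventually.of_forall fun ω => ?_)
          dsimp only
          rw [Finset.sum_Ico_succ_top hm]; ring
      _ = ∫ ω, (∑ k ∈ Finset.Ico n m, centered μ ξ θ f k ω) ^ 2 ∂P +
          ∫ ω, centered μ ξ θ f m ω ^ 2 ∂P := by
          have hi1 := (hS m).integrable_sq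
          have hi2 : Integrable (fun ω => 2 * ((∑ k ∈ Finset.Ico n m, centered μ ξ θ f k ω) *
            centered μ ξ θ f m ω)) P := hprod.const_mul 2
          have e1 := integral_add (hi1.add hi2) (hc m).integrable_sq
          have e2 := integral_add hi1 hi2
          rw [integral_const_mul, hzero, mul_zero, add_zero] at e2
          rw [← e2]
          exact e1
      _ ≤ _ := add_le_add ih (h.integral_sq_centered_le (hf m) (hL m))

/-- Series of centered increments with summable second moments converge almost surely. -/
theorem ae_exists_tendsto_sum_centered (h : Innovation P ℱ ξ θ μ)
    (hf : ∀ k, Measurable (Function.uncurry (f k)))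
    (hL : ∀ k, MemLp (fun ω => f k (ξ k ω) (θ k ω)) 2 P)
    (hs : Summable fun k => ∫ ω, f k (ξ k ω) (θ k ω) ^ 2 ∂P) :
    ∀ᵐ ω ∂P, ∃ l, Tendsto (fun n => ∑ k ∈ Finset.range n, centered μ ξ θ f k ω) atTop (𝓝 l) := by
  have hc := fun k => h.memLp_centered (hf k) (hL k)
  have hS := fun n => h.integral_sq_sum_centered_le hf hL (Nat.zero_le n)
  simp only [Nat.Ico_zero_eq_range] at hS
  have hmart : Martingale (fun n ω => ∑ k ∈ Finset.range n, centered μ ξ θ f k ω) ℱ P := by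
    refine martingale_of_condExp_sub_eq_zero_nat (fun n => ?_)
      (fun n => (hS n).1.integrable one_le_two) (fun n => ?_)
    · exact Finset.stronglyMeasurable_fun_sum _ fun k hk =>
        h.stronglyMeasurable_centered (Finset.mem_range.1 hk) (hf k)
    · have : (fun ω => ∑ k ∈ Finset.range (n + 1), centered μ ξ θ f k ω) -
          (fun ω => ∑ k ∈ Finset.range n, centered μ ξ θ f k ω) = centered μ ξ θ f n := by
        ext ω; simp [Finset.sum_range_succ]
      rw [this]
      exact h.condExp_centered (hf n) ((hL n).integrable one_le_two)
  set R := ∑' k, ∫ ω, f k (ξ k ω) (θ k ω) ^ 2 ∂P with hR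
  have hR0 : 0 ≤ R := tsum_nonneg fun k => integral_nonneg fun ω => sq_nonneg _
  -- The L¹ bound needed for martingale convergence comes from the L² bound through `|x| ≤ 1 + x²`.
  refine hmart.submartingale.exists_ae_tendsto_of_bdd (R := (1 + R).toNNReal) fun n => ?_
  have hi := (hS n).1.integrable one_le_two
  rw [eLpNorm_one_eq_lintegral_enorm, ← ofReal_integral_norm_eq_lintegral_enorm hi]
  refine ENNReal.ofReal_le_ofReal ?_
  calc ∫ ω, ‖∑ k ∈ Finset.range n, centered μ ξ θ f k ω‖ ∂P
      ≤ ∫ ω, (1 + (∑ k ∈ Finset.range n, centered μ ξ θ f k ω) ^ 2) ∂P := by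
        refine integral_mono hi.norm ((integrable_const _).add (hS n).1.integrable_sq) fun ω => ?_
        dsimp only
        rw [Real.norm_eq_abs, ← sq_abs]
        nlinarith [sq_nonneg (|∑ k ∈ Finset.range n, centered μ ξ θ f k ω| - 1 / 2)]
    _ = 1 + ∫ ω, (∑ k ∈ Finset.range n, centered μ ξ θ f k ω) ^ 2 ∂P := by
        rw [integral_add (integrable_const _) (hS n).1.integrable_sq]; simp
    _ ≤ 1 + R := by
        gcongr
        exact (hS n).2.trans (hs.sum_le_tsum _ fun k _ => integral_nonneg fun ω => sq_nonneg _)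

end Innovation

end Innovation

end

section

/-! ### Moments of the iterates -/

/-- The optimality gap `F - inf F`. -/
def gap {m : ℕ} (F : Vec m → ℝ) (y : Vec m) : ℝ := F y - ⨅ z, F z

/-- The assumptions on the stochastic gradient recursion, with its innovations `ξ` and the step
`a k` from time `k` to time `k + 1`. -/
structure Model {Ω : Type*} [mΩ : MeasurableSpace Ω] {d m : ℕ} (P : Measure Ω)
    (ℱ : Filtration ℕ mΩ) (ξ : ℕ → Ω → Vec d) (θ : ℕ → Ω → Vec m) (μ : Measure (Vec d))
    (g : Vec d → Vec m → Vec m) (F : Vec m → ℝ) (a : ℕ → ℝ)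
    (L α C₀ κ c s c₁ c₂ : ℝ) : Prop where
  innovation : Innovation P ℱ ξ θ μ
  hα : α ∈ Ioc (0 : ℝ) 1
  hL : 0 < L
  hC₀ : 0 < C₀
  hκ : 0 < κ
  hc : 0 ≤ c
  hs : 3 / 4 < s
  hs1 : s ≤ 1
  hαs : 2 < (2 + α) * s
  smooth : HolderSmooth F L α
  contDiff : ContDiff ℝ 1 F
  measurable_g : Measurable (Function.uncurry g)
  succ_eq : ∀ k ω, θ (k + 1) ω = θ k ω - a k • g (ξ k ω) (θ k ω)
  memLp_g : ∀ y, MemLp (fun x => g x y) 2 μ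
  sq_le : ∀ y, ∫ x, ‖g x y‖ ^ 2 ∂μ ≤ C₀ * (gap F y + 1)
  drift : ∀ y, κ * ‖gradient F y‖ ^ 2 ≤ inner ℝ (∫ x, g x y ∂μ) (gradient F y)
  mean_le : ∀ y, ‖∫ x, g x y ∂μ‖ ≤ c * ‖gradient F y‖
  memLp_init : MemLp (θ 0) 2 P
  steps : StepBounds a s c₁ c₂

lemma rpow_one_add_le {t α : ℝ} (ht : 0 ≤ t) (hα : α ∈ Ioc (0 : ℝ) 1) :
    t ^ (1 + α) ≤ 1 + t ^ 2 := by
  rcases le_total t 1 with h | h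
  · have : t ^ (1 + α) ≤ 1 := Real.rpow_le_one ht h (by linarith [hα.1])
    nlinarith
  · have : t ^ (1 + α) ≤ t ^ (2 : ℝ) := Real.rpow_le_rpow_of_exponent_le h (by linarith [hα.2])
    rw [Real.rpow_two] at this
    linarith

lemma StepBounds.rpow_le {a : ℕ → ℝ} {s c₁ c₂ p : ℝ} (h : StepBounds a s c₁ c₂) (hp : 0 ≤ p)
    (k : ℕ) : a k ^ p ≤ c₂ ^ p * ((k : ℝ) + 1) ^ (-(p * s)) := by
  calc a k ^ p ≤ (c₂ * ((k : ℝ) + 1) ^ (-s)) ^ p :=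
        Real.rpow_le_rpow (h.step_pos k).le (h.upper k) hp
    _ = _ := by
      rw [Real.mul_rpow h.upper_pos.le (Real.rpow_nonneg (by positivity) _),
        ← Real.rpow_mul (by positivity)]
      congr 2; ring

lemma summable_add_one_rpow_neg {p : ℝ} (hp : 1 < p) :
    Summable fun k : ℕ => ((k : ℝ) + 1) ^ (-p) := by
  have := (summable_nat_add_iff 1).2 (Real.summable_nat_rpow (p := -p).2 (by linarith))
  simpa using this

/-- Discrete Grönwall inequality with summable coefficients. -/
lemma bounded_of_le_one_add_mul {u p : ℕ → ℝ} (hu : ∀ n, 0 ≤ u n) (hp : ∀ n, 0 ≤ p n)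
    (hs : Summable p) (h : ∀ n, u (n + 1) ≤ (1 + p n) * u n) (n : ℕ) :
    u n ≤ u 0 * Real.exp (∑' k, p k) := by
  have h1 : u n ≤ u 0 * Real.exp (∑ k ∈ Finset.range n, p k) := by
    induction n with
    | zero => simp
    | succ n ih =>
      rw [Finset.sum_range_succ, Real.exp_add]
      have := Real.add_one_le_exp (p n)
      calc u (n + 1) ≤ (1 + p n) * u n := h n
        _ ≤ Real.exp (p n) * (u 0 * Real.exp (∑ k ∈ Finset.range n, p k)) := by
            gcongr
            · exact hu n
            · linarith
        _ = _ := by ring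
  refine h1.trans (mul_le_mul_of_nonneg_left ?_ (hu 0))
  exact Real.exp_le_exp.2 (hs.sum_le_tsum _ fun k _ => hp k)

namespace Model

variable {Ω : Type*} [mΩ : MeasurableSpace Ω] {d m : ℕ} {P : Measure Ω}
  {ℱ : Filtration ℕ mΩ} {ξ : ℕ → Ω → Vec d} {θ : ℕ → Ω → Vec m} {μ : Measure (Vec d)}
  {g : Vec d → Vec m → Vec m} {F : Vec m → ℝ} {a : ℕ → ℝ} {L α C₀ κ c s c₁ c₂ : ℝ}

local notation "MODEL" => Model P ℱ ξ θ μ g F a L α C₀ κ c s c₁ c₂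

lemma gap_nonneg (M : MODEL) (y : Vec m) : 0 ≤ gap F y := M.smooth.sub_nonneg y

lemma continuous (M : MODEL) : Continuous F := M.contDiff.continuous

lemma measurable_gap (M : MODEL) : Measurable (gap F) :=
  (M.continuous.sub continuous_const).measurable

lemma measurable_gradient (M : MODEL) : Measurable (gradient F) :=
  (continuous_gradient M.contDiff).measurable

lemma measurable_oracle (M : MODEL) (y : Vec m) : Measurable fun x => g x y :=
  M.measurable_g.comp (measurable_id.prodMk measurable_const)

lemma integrable_sq (M : MODEL) (y : Vec m) : Integrable (fun x => ‖g x y‖ ^ 2) μ :=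
  (memLp_two_iff_integrable_sq_norm (M.measurable_oracle y).aestronglyMeasurable).1 (M.memLp_g y)

lemma one_lt (M : MODEL) : 1 < (1 + α) * s := by nlinarith [M.hαs, M.hs1]

lemma summable_rpow (M : MODEL) : Summable fun k => a k ^ (1 + α) := by
  have hα := M.hα.1
  refine Summable.of_nonneg_of_le (fun k => Real.rpow_nonneg (M.steps.step_pos k).le _)
    (fun k => M.steps.rpow_le (p := 1 + α) (by linarith) k) ?_
  exact (summable_add_one_rpow_neg M.one_lt).mul_left _

lemma value_step_le (M : MODEL) {t : ℝ} (ht : 0 < t) (x : Vec d) (y : Vec m) :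
    F (y - t • g x y) ≤ F y - t * inner ℝ (g x y) (gradient F y) +
      L * (t ^ (1 + α) * ‖g x y‖ ^ (1 + α)) := by
  have hα := M.hα.1
  have h1 := M.smooth.le_add hα y (y - t • g x y)
  rw [sub_sub_cancel_left, inner_neg_right, inner_smul_right, norm_neg, norm_smul,
    Real.norm_of_nonneg ht.le, Real.mul_rpow ht.le (norm_nonneg _), real_inner_comm] at h1
  have h2 : L / (1 + α) ≤ L := div_le_self M.hL.le (by linarith)
  have h3 : 0 ≤ t ^ (1 + α) * ‖g x y‖ ^ (1 + α) := by positivity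
  nlinarith

lemma coeff_nonneg (M : MODEL) (n : ℕ) : 0 ≤ L * (1 + C₀) * a n ^ (1 + α) :=
  mul_nonneg (mul_nonneg M.hL.le (by linarith [M.hC₀]))
    (Real.rpow_nonneg (M.steps.step_pos n).le _)

lemma measurable_gap_step (M : MODEL) (t : ℝ) :
    Measurable (Function.uncurry fun (x : Vec d) (y : Vec m) => gap F (y - t • g x y)) :=
  M.measurable_gap.comp (measurable_snd.sub (M.measurable_g.const_smul t))

lemma integral_gap_nonneg (M : MODEL) (n : ℕ) : 0 ≤ ∫ ω, gap F (θ n ω) ∂P :=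
  integral_nonneg fun _ => M.gap_nonneg _

variable [IsProbabilityMeasure P]

lemma isProbabilityMeasure (M : MODEL) : IsProbabilityMeasure μ :=
  M.innovation.isProbabilityMeasure

lemma integrable_oracle (M : MODEL) (y : Vec m) : Integrable (fun x => g x y) μ := by
  have := M.isProbabilityMeasure
  exact (M.memLp_g y).integrable one_le_two

lemma integrable_rpow (M : MODEL) (y : Vec m) :
    Integrable (fun x => ‖g x y‖ ^ (1 + α)) μ ∧
      ∫ x, ‖g x y‖ ^ (1 + α) ∂μ ≤ (1 + C₀) * (gap F y + 1) := by
  have := M.isProbabilityMeasure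
  have hle : ∀ x, ‖g x y‖ ^ (1 + α) ≤ 1 + ‖g x y‖ ^ 2 := fun x =>
    rpow_one_add_le (norm_nonneg _) M.hα
  have hi2 : Integrable (fun x => 1 + ‖g x y‖ ^ 2) μ := (integrable_const _).add (M.integrable_sq y)
  have hi : Integrable (fun x => ‖g x y‖ ^ (1 + α)) μ := by
    refine hi2.mono' ((M.measurable_oracle y).norm.pow_const _).aestronglyMeasurable
      (Eventually.of_forall fun x => ?_)
    rw [Real.norm_of_nonneg (Real.rpow_nonneg (norm_nonneg _) _)]
    exact hle x
  refine ⟨hi, (integral_mono hi hi2 hle).trans ?_⟩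
  rw [integral_add (integrable_const _) (M.integrable_sq y)]
  have h1 := M.sq_le y
  have h2 := M.gap_nonneg y
  simp only [integral_const, probReal_univ, smul_eq_mul, mul_one]
  nlinarith

/-- One step of the recursion in the mean. -/
lemma integral_gap_step_le (M : MODEL) {t : ℝ} (ht : 0 < t) (y : Vec m) :
    Integrable (fun x => gap F (y - t • g x y)) μ ∧
      ∫ x, gap F (y - t • g x y) ∂μ ≤ gap F y - κ * (t * ‖gradient F y‖ ^ 2) +
        L * (1 + C₀) * t ^ (1 + α) * (gap F y + 1) := by
  have := M.isProbabilityMeasure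
  have hg := M.integrable_oracle y
  have hin : Integrable (fun x => inner ℝ (g x y) (gradient F y)) μ := hg.inner_const _
  obtain ⟨hr, hrle⟩ := M.integrable_rpow y
  have hle : ∀ x, gap F (y - t • g x y) ≤ gap F y - t * inner ℝ (g x y) (gradient F y) +
      L * (t ^ (1 + α) * ‖g x y‖ ^ (1 + α)) := fun x => by
    have := M.value_step_le ht x y
    simp only [gap]; linarith
  have hi2a : Integrable (fun x => gap F y - t * inner ℝ (g x y) (gradient F y)) μ :=
    (integrable_const _).sub (hin.const_mul t)
  have hi2b : Integrable (fun x => L * (t ^ (1 + α) * ‖g x y‖ ^ (1 + α))) μ :=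
    (hr.const_mul _).const_mul L
  have hi2 := hi2a.add hi2b
  have hmeas : Measurable fun x => gap F (y - t • g x y) :=
    M.measurable_gap.comp (measurable_const.sub ((M.measurable_oracle y).const_smul t))
  have hi : Integrable (fun x => gap F (y - t • g x y)) μ := by
    refine hi2.mono' hmeas.aestronglyMeasurable (Eventually.of_forall fun x => ?_)
    rw [Real.norm_of_nonneg (M.gap_nonneg _)]
    exact hle x
  refine ⟨hi, (integral_mono hi hi2 hle).trans ?_⟩
  have e1 : ∫ x, ((fun x => gap F y - t * inner ℝ (g x y) (gradient F y)) +
      fun x => L * (t ^ (1 + α) * ‖g x y‖ ^ (1 + α))) x ∂μ =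
      gap F y - t * inner ℝ (∫ x, g x y ∂μ) (gradient F y) +
        L * (t ^ (1 + α) * ∫ x, ‖g x y‖ ^ (1 + α) ∂μ) := by
    rw [integral_add' hi2a hi2b, integral_sub (integrable_const _) (hin.const_mul t),
      integral_const_mul, integral_const_mul, integral_const_mul]
    have : ∫ x, inner ℝ (g x y) (gradient F y) ∂μ = inner ℝ (∫ x, g x y ∂μ) (gradient F y) := by
      rw [real_inner_comm, ← integral_inner (𝕜 := ℝ) hg (gradient F y)]
      exact integral_congr_ae (Eventually.of_forall fun x => real_inner_comm _ _)
    rw [this]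
    simp
  rw [e1]
  have h1 := M.drift y
  have h2 : 0 < t ^ (1 + α) := Real.rpow_pos_of_pos ht _
  have h3 := mul_le_mul_of_nonneg_left hrle (mul_nonneg M.hL.le h2.le)
  have h4 := mul_le_mul_of_nonneg_left h1 ht.le
  nlinarith

lemma integrable_init (M : MODEL) : Integrable (fun ω => gap F (θ 0 ω)) P := by
  have hα := M.hα.1
  have hm := M.innovation.measurable_state 0
  have hsq : Integrable (fun ω => ‖θ 0 ω‖ ^ 2) P :=
    (memLp_two_iff_integrable_sq_norm hm.aestronglyMeasurable).1 M.memLp_init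
  have hi : Integrable (fun ω => gap F 0 + ‖gradient F 0‖ * (1 + ‖θ 0 ω‖ ^ 2) +
      L / (1 + α) * (1 + ‖θ 0 ω‖ ^ 2)) P :=
    ((integrable_const _).add (((integrable_const _).add hsq).const_mul _)).add
      (((integrable_const _).add hsq).const_mul _)
  refine hi.mono' (M.measurable_gap.comp hm).aestronglyMeasurable
    (Eventually.of_forall fun ω => ?_)
  rw [Real.norm_of_nonneg (M.gap_nonneg _)]
  have h1 := M.smooth.le_add hα 0 (θ 0 ω)
  rw [sub_zero] at h1
  have h2 := real_inner_le_norm (gradient F 0) (θ 0 ω)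
  have h3 : ‖θ 0 ω‖ ≤ 1 + ‖θ 0 ω‖ ^ 2 := by nlinarith [sq_nonneg (‖θ 0 ω‖ - 1 / 2)]
  have h4 := mul_le_mul_of_nonneg_left h3 (norm_nonneg (gradient F 0))
  have h5 := mul_le_mul_of_nonneg_left (rpow_one_add_le (norm_nonneg (θ 0 ω)) M.hα)
    (div_nonneg M.hL.le (by linarith : 0 ≤ 1 + α))
  simp only [gap]
  linarith

lemma integrable_sq_gradient_of (M : MODEL) {n : ℕ} (h : Integrable (fun ω => gap F (θ n ω)) P) :
    Integrable (fun ω => ‖gradient F (θ n ω)‖ ^ 2) P := by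
  have hi : Integrable (fun ω => 1 + (1 + α) * L ^ (1 / α) / α * gap F (θ n ω)) P :=
    (integrable_const _).add (h.const_mul _)
  refine hi.mono' ((M.measurable_gradient.comp
    (M.innovation.measurable_state n)).norm.pow_const 2).aestronglyMeasurable
    (Eventually.of_forall fun ω => ?_)
  rw [Real.norm_of_nonneg (sq_nonneg _)]
  exact M.smooth.gradient_sq_le M.hα M.hL _

lemma integrable_bound (M : MODEL) {n : ℕ} (h : Integrable (fun ω => gap F (θ n ω)) P) :
    Integrable (fun ω => gap F (θ n ω) - κ * (a n * ‖gradient F (θ n ω)‖ ^ 2) +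
        L * (1 + C₀) * a n ^ (1 + α) * (gap F (θ n ω) + 1)) P :=
  (h.sub (((M.integrable_sq_gradient_of h).const_mul _).const_mul _)).add
    ((h.add (integrable_const _)).const_mul _)

lemma integrable_gap (M : MODEL) (n : ℕ) : Integrable (fun ω => gap F (θ n ω)) P := by
  induction n with
  | zero => exact M.integrable_init
  | succ n ih =>
    have := (M.innovation.integrable_of_le n (f := fun x y => gap F (y - a n • g x y))
      (M.measurable_gap_step _) (fun x y => M.gap_nonneg _)
      (fun y => M.integral_gap_step_le (M.steps.step_pos n) y) (M.integrable_bound ih)).1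
    simpa only [M.succ_eq] using this

lemma integrable_sq_gradient (M : MODEL) (n : ℕ) :
    Integrable (fun ω => ‖gradient F (θ n ω)‖ ^ 2) P :=
  M.integrable_sq_gradient_of (M.integrable_gap n)

/-- The recursion for the mean optimality gap. -/
lemma integral_gap_succ_le (M : MODEL) (n : ℕ) :
    ∫ ω, gap F (θ (n + 1) ω) ∂P ≤ ∫ ω, gap F (θ n ω) ∂P -
      κ * (a n * ∫ ω, ‖gradient F (θ n ω)‖ ^ 2 ∂P) +
        L * (1 + C₀) * a n ^ (1 + α) * (∫ ω, gap F (θ n ω) ∂P + 1) := by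
  have h1 := (M.innovation.integrable_of_le n (f := fun x y => gap F (y - a n • g x y))
    (M.measurable_gap_step _) (fun x y => M.gap_nonneg _)
    (fun y => M.integral_gap_step_le (M.steps.step_pos n) y)
    (M.integrable_bound (M.integrable_gap n))).2
  simp only [← M.succ_eq] at h1
  refine h1.trans (le_of_eq ?_)
  have i1 := M.integrable_gap n
  have i2 := ((M.integrable_sq_gradient n).const_mul (a n)).const_mul κ
  have i3 := (i1.add (integrable_const (μ := P) (1 : ℝ))).const_mul
    (L * (1 + C₀) * a n ^ (1 + α))
  have e := integral_add (i1.sub i2) i3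
  refine Eq.trans e ?_
  have e2 := integral_sub i1 i2
  have e3 := integral_add i1 (integrable_const (μ := P) (1 : ℝ))
  rw [integral_const_mul]
  simp only [integral_const, probReal_univ, smul_eq_mul, mul_one] at e3
  simp only [Pi.add_apply, Pi.sub_apply] at *
  rw [e2, e3, integral_const_mul, integral_const_mul]

/-- Discrete Grönwall for the mean gap plus one, whose growth coefficients are of order `a n ^ (1 +
α)`. -/
lemma exists_integral_gap_le (M : MODEL) : ∃ B, 0 ≤ B ∧ ∀ n, ∫ ω, gap F (θ n ω) ∂P ≤ B := by
  have hp := M.coeff_nonneg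
  have hu := M.integral_gap_nonneg
  have h := bounded_of_le_one_add_mul (u := fun n => ∫ ω, gap F (θ n ω) ∂P + 1)
    (p := fun n => L * (1 + C₀) * a n ^ (1 + α)) (fun n => by linarith [hu n]) hp
    (M.summable_rpow.mul_left _) (fun n => by
      have h1 := M.integral_gap_succ_le n
      have h2 : 0 ≤ κ * (a n * ∫ ω, ‖gradient F (θ n ω)‖ ^ 2 ∂P) :=
        mul_nonneg M.hκ.le (mul_nonneg (M.steps.step_pos n).le
          (integral_nonneg fun _ => sq_nonneg _))
      linarith)
  exact ⟨_, (hu 0).trans (le_trans (by linarith) (h 0)), fun n => le_trans (by linarith) (h n)⟩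

/-- Summing the recursion telescopes the mean gaps and leaves the gradients, bounded by the initial
gap plus a convergent series. -/
lemma summable_integral_sq_gradient (M : MODEL) :
    Summable fun n => a n * ∫ ω, ‖gradient F (θ n ω)‖ ^ 2 ∂P := by
  obtain ⟨B, hB0, hB⟩ := M.exists_integral_gap_le
  have hu := M.integral_gap_nonneg
  have hp := M.coeff_nonneg
  have hsum : Summable fun n => L * (1 + C₀) * a n ^ (1 + α) * (B + 1) :=
    (M.summable_rpow.mul_left _).mul_right _
  refine summable_of_sum_range_le (c := κ⁻¹ * (∫ ω, gap F (θ 0 ω) ∂P +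
    ∑' n, L * (1 + C₀) * a n ^ (1 + α) * (B + 1))) (fun n => mul_nonneg (M.steps.step_pos n).le
      (integral_nonneg fun _ => sq_nonneg _)) fun n => ?_
  rw [inv_mul_eq_div, le_div_iff₀ M.hκ]
  have h1 : ∀ n, κ * ∑ k ∈ Finset.range n, (a k * ∫ ω, ‖gradient F (θ k ω)‖ ^ 2 ∂P) ≤
      ∫ ω, gap F (θ 0 ω) ∂P - ∫ ω, gap F (θ n ω) ∂P +
        ∑ k ∈ Finset.range n, L * (1 + C₀) * a k ^ (1 + α) * (B + 1) := by
    intro n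
    induction n with
    | zero => simp
    | succ n ih =>
      rw [Finset.sum_range_succ, Finset.sum_range_succ, mul_add]
      have h2 := M.integral_gap_succ_le n
      have h3 := mul_le_mul_of_nonneg_left (add_le_add_left (hB n) 1) (hp n)
      linarith
  have h4 : ∑ k ∈ Finset.range n, L * (1 + C₀) * a k ^ (1 + α) * (B + 1) ≤
      ∑' n, L * (1 + C₀) * a n ^ (1 + α) * (B + 1) :=
    hsum.sum_le_tsum _ fun k _ => mul_nonneg (hp k) (by linarith)
  linarith [h1 n, hu n]

/-- Almost surely, the optimality gaps are bounded. -/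
lemma ae_exists_gap_le (M : MODEL) : ∀ᵐ ω ∂P, ∃ B, ∀ n, gap F (θ n ω) ≤ B := by
  have hp := M.coeff_nonneg
  obtain ⟨p, hpdef⟩ : ∃ p : ℕ → ℝ, p = fun n => L * (1 + C₀) * a n ^ (1 + α) := ⟨_, rfl⟩
  have hp0 : ∀ n, 0 ≤ p n := by rw [hpdef]; exact hp
  have hps : Summable p := by rw [hpdef]; exact M.summable_rpow.mul_left _
  -- Dividing by the bounded products `Q n` absorbs the growth factors and makes gap plus one a
  -- nonnegative supermartingale.
  obtain ⟨Q, hQdef⟩ : ∃ Q : ℕ → ℝ, Q = fun n => ∏ k ∈ Finset.range n, (1 + p k) := ⟨_, rfl⟩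
  have hQ1 : ∀ n, 1 ≤ Q n := fun n => by
    rw [hQdef]
    exact Finset.one_le_prod fun k _ => by linarith [hp0 k]
  have hQ0 : ∀ n, 0 < Q n := fun n => one_pos.trans_le (hQ1 n)
  have hQs : ∀ n, Q (n + 1) = (1 + p n) * Q n := fun n => by
    rw [hQdef]; dsimp only; rw [Finset.prod_range_succ, mul_comm]
  have hQb : ∀ n, Q n ≤ Q 0 * Real.exp (∑' k, p k) :=
    bounded_of_le_one_add_mul (fun n => (hQ0 n).le) hp0 hps (fun n => (hQs n).le)
  have hZi : ∀ n, Integrable (fun ω => (gap F (θ n ω) + 1) / Q n) P := fun n =>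
    ((M.integrable_gap n).add (integrable_const _)).div_const _
  have hsup : Supermartingale (fun n ω => (gap F (θ n ω) + 1) / Q n) ℱ P := by
    refine supermartingale_nat (fun n => ?_) hZi (fun n => ?_)
    · exact (((M.measurable_gap.comp (M.innovation.adapted n)).add_const 1).div_const
        _).stronglyMeasurable
    · have hi := hZi (n + 1)
      simp only [M.succ_eq] at hi
      have h1 := M.innovation.condExp_comp n
        (f := fun x y => (gap F (y - a n • g x y) + 1) / Q (n + 1))
        (((M.measurable_gap_step (a n)).add_const 1).div_const _) hi
      simp only [M.succ_eq]
      filter_upwards [h1] with ω hω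
      rw [← hω]
      have := M.isProbabilityMeasure
      obtain ⟨j1, j2⟩ := M.integral_gap_step_le (M.steps.step_pos n) (θ n ω)
      rw [integral_div, integral_add j1 (integrable_const _), hQs,
        div_le_div_iff₀ (mul_pos (by linarith [hp0 n]) (hQ0 n)) (hQ0 n)]
      simp only [integral_const, probReal_univ, smul_eq_mul, mul_one]
      have h3 : 0 ≤ κ * (a n * ‖gradient F (θ n ω)‖ ^ 2) :=
        mul_nonneg M.hκ.le (mul_nonneg (M.steps.step_pos n).le (sq_nonneg _))
      have h4 : ∫ x, gap F (θ n ω - a n • g x (θ n ω)) ∂μ + 1 ≤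
          (1 + p n) * (gap F (θ n ω) + 1) := by
        rw [hpdef]; dsimp only; linarith
      calc _ ≤ (1 + p n) * (gap F (θ n ω) + 1) * Q n :=
            mul_le_mul_of_nonneg_right h4 (hQ0 n).le
        _ = _ := by ring
  obtain ⟨B, hB0, hB⟩ := M.exists_integral_gap_le
  have hconv := hsup.neg.exists_ae_tendsto_of_bdd (R := (B + 1).toNNReal) fun n => by
    rw [Pi.neg_apply, eLpNorm_neg, eLpNorm_one_eq_lintegral_enorm,
      ← ofReal_integral_norm_eq_lintegral_enorm (hZi n)]
    refine ENNReal.ofReal_le_ofReal ?_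
    calc ∫ ω, ‖(gap F (θ n ω) + 1) / Q n‖ ∂P ≤ ∫ ω, (gap F (θ n ω) + 1) ∂P := by
          refine integral_mono (hZi n).norm ((M.integrable_gap n).add (integrable_const _))
            fun ω => ?_
          have := M.gap_nonneg (θ n ω)
          dsimp only
          rw [Real.norm_of_nonneg (div_nonneg (by linarith) (hQ0 n).le)]
          exact div_le_self (by linarith) (hQ1 n)
      _ = ∫ ω, gap F (θ n ω) ∂P + 1 := by
          rw [integral_add (M.integrable_gap n) (integrable_const _)]; simp
      _ ≤ _ := by linarith [hB n]
  filter_upwards [hconv] with ω ⟨l, hl⟩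
  obtain ⟨R, hR⟩ := (Metric.isBounded_range_of_tendsto _ hl).exists_norm_le
  refine ⟨R * (Q 0 * Real.exp (∑' k, p k)), fun n => ?_⟩
  have h1 : (gap F (θ n ω) + 1) / Q n ≤ R := by
    have := hR _ (mem_range_self n)
    simp only [Pi.neg_apply, norm_neg] at this
    exact (le_abs_self _).trans this
  have hR0 : 0 ≤ R := (norm_nonneg _).trans (hR _ (mem_range_self 0))
  rw [div_le_iff₀ (hQ0 n)] at h1
  have := mul_le_mul_of_nonneg_left (hQb n) hR0
  linarith

/-- Almost sure convergence of series of centered increments whose conditional second moments are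
controlled by the optimality gap. -/
lemma ae_exists_tendsto_centered (M : MODEL) {f : ℕ → Vec d → Vec m → ℝ} {G : ℕ → Vec m → ℝ}
    (hf : ∀ k, Measurable (Function.uncurry (f k)))
    (hG0 : ∀ k y, 0 ≤ G k y)
    (hfG : ∀ k y, Integrable (fun x => f k x y ^ 2) μ ∧
      ∫ x, f k x y ^ 2 ∂μ ≤ G k y * (gap F y + 1))
    (hGi : ∀ k, Integrable (fun ω => G k (θ k ω)) P)
    (hGs : Summable fun k => ∫ ω, G k (θ k ω) ∂P) :
    ∀ᵐ ω ∂P, ∃ l, Tendsto (fun n => ∑ k ∈ Finset.range n, centered μ ξ θ f k ω) atTop (𝓝 l) := by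
  -- localization to the event that the gaps are at most `B`
  have hloc : ∀ B : ℕ, ∀ᵐ ω ∂P, ∃ l, Tendsto (fun n => ∑ k ∈ Finset.range n,
      centered μ ξ θ (fun k x y => {y | gap F y ≤ B}.indicator (fun _ => (1 : ℝ)) y * f k x y) k ω)
      atTop (𝓝 l) := by
    intro B
    have hms : MeasurableSet {y | gap F y ≤ B} := measurableSet_le M.measurable_gap measurable_const
    have hmf : ∀ k, Measurable (Function.uncurry fun (x : Vec d) (y : Vec m) =>
        {y | gap F y ≤ B}.indicator (fun _ => (1 : ℝ)) y * f k x y) := fun k =>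
      ((measurable_const.indicator hms).comp measurable_snd).mul (hf k)
    have hint := fun k => M.innovation.integrable_of_le k
      (f := fun x y => ({y | gap F y ≤ B}.indicator (fun _ => (1 : ℝ)) y * f k x y) ^ 2)
      ((hmf k).pow_const 2) (fun x y => sq_nonneg _) (D := fun y => (B + 1) * G k y)
      (fun y => by
        by_cases hy : gap F y ≤ B
        · have : y ∈ {y | gap F y ≤ B} := hy
          simp only [indicator_of_mem this, one_mul]
          refine ⟨(hfG k y).1, (hfG k y).2.trans ?_⟩
          rw [mul_comm]
          exact mul_le_mul_of_nonneg_right (by linarith) (hG0 k y)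
        · have : y ∉ {y | gap F y ≤ B} := hy
          simp only [indicator_of_notMem this, zero_mul]
          have := hG0 k y
          refine ⟨by simp, ?_⟩
          simp only [ne_eq, OfNat.ofNat_ne_zero, not_false_eq_true, zero_pow, integral_zero]
          positivity) ((hGi k).const_mul _)
    refine M.innovation.ae_exists_tendsto_sum_centered hmf (fun k => ?_) ?_
    · refine (memLp_two_iff_integrable_sq ?_).2 (hint k).1
      exact ((hmf k).comp ((M.innovation.measurable k).prodMk
        (M.innovation.measurable_state k))).aestronglyMeasurable
    · refine Summable.of_nonneg_of_le (fun k => integral_nonneg fun ω => sq_nonneg _)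
        (fun k => (hint k).2) ?_
      simp only [integral_const_mul]
      exact hGs.mul_left _
  filter_upwards [ae_all_iff.2 hloc, M.ae_exists_gap_le] with ω hω ⟨B, hB⟩
  -- On this path all gaps are at most `N`, so every indicator equals `1` and the localized series
  -- is the original one.
  obtain ⟨N, hN⟩ := exists_nat_ge B
  obtain ⟨l, hl⟩ := hω N
  refine ⟨l, hl.congr fun n => Finset.sum_congr rfl fun k _ => ?_⟩
  have : θ k ω ∈ {y | gap F y ≤ N} := (hB k).trans hN
  simp only [centered, indicator_of_mem this, one_mul]

/-- Almost sure summability of nonnegative increments. -/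
lemma ae_summable (M : MODEL) {f : ℕ → Vec d → Vec m → ℝ} {r : ℕ → ℝ}
    (hf : ∀ k, Measurable (Function.uncurry (f k))) (hf0 : ∀ k x y, 0 ≤ f k x y)
    (hfr : ∀ k y, Integrable (fun x => f k x y) μ ∧ ∫ x, f k x y ∂μ ≤ r k * (gap F y + 1))
    (hr0 : ∀ k, 0 ≤ r k) (hr : Summable r) :
    ∀ᵐ ω ∂P, Summable fun k => f k (ξ k ω) (θ k ω) := by
  obtain ⟨B, hB0, hB⟩ := M.exists_integral_gap_le
  have hint := fun k => M.innovation.integrable_of_le k (hf k) (hf0 k)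
    (D := fun y => r k * (gap F y + 1)) (hfr k)
    (((M.integrable_gap k).add (integrable_const _)).const_mul _)
  have hs : Summable fun k => ∫ ω, f k (ξ k ω) (θ k ω) ∂P := by
    refine Summable.of_nonneg_of_le (fun k => integral_nonneg fun ω => hf0 k _ _)
      (fun k => (hint k).2) ?_
    refine Summable.of_nonneg_of_le (fun k => integral_nonneg fun ω => mul_nonneg (hr0 k)
      (by linarith [M.gap_nonneg (θ k ω)])) (fun k => ?_) (hr.mul_right (B + 1))
    rw [integral_const_mul, integral_add (M.integrable_gap k) (integrable_const _)]
    simp only [integral_const, probReal_univ, smul_eq_mul, mul_one]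
    exact mul_le_mul_of_nonneg_left (by linarith [hB k]) (hr0 k)
  have hfin : ∫⁻ ω, ∑' k, ENNReal.ofReal (f k (ξ k ω) (θ k ω)) ∂P ≠ ⊤ := by
    rw [lintegral_tsum fun k => (hint k).1.aestronglyMeasurable.aemeasurable.ennreal_ofReal]
    have : ∀ k, ∫⁻ ω, ENNReal.ofReal (f k (ξ k ω) (θ k ω)) ∂P =
        ENNReal.ofReal (∫ ω, f k (ξ k ω) (θ k ω) ∂P) := fun k =>
      (ofReal_integral_eq_lintegral_ofReal (hint k).1
        (Eventually.of_forall fun ω => hf0 k _ _)).symm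
    simp only [this]
    exact hs.tsum_ofReal_ne_top
  filter_upwards [ae_lt_top' (AEMeasurable.tsum fun k =>
    (hint k).1.aestronglyMeasurable.aemeasurable.ennreal_ofReal) hfin] with ω hω
  have := ENNReal.summable_toReal hω.ne
  simpa only [ENNReal.toReal_ofReal (hf0 _ _ _)] using this

end Model

end

section

/-! ### Almost sure behaviour of the trajectories -/

lemma HasTail.mono {a : ℕ → ℝ} {τ τ' : ℝ} (h : HasTail a τ) (hle : τ' ≤ τ) : HasTail a τ' := by
  obtain ⟨l, C, hC⟩ := h
  refine ⟨l, |C|, fun n => (hC n).trans ?_⟩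
  have h1 : (1 : ℝ) ≤ (n : ℝ) + 1 := by simp
  exact (mul_le_mul_of_nonneg_right (le_abs_self C) (by positivity)).trans
    (mul_le_mul_of_nonneg_left (Real.rpow_le_rpow_of_exponent_le h1 (by linarith)) (abs_nonneg C))

lemma norm_le_sum_abs {m : ℕ} (v : Vec m) : ‖v‖ ≤ ∑ i, |v i| := by
  rw [EuclideanSpace.norm_eq]
  refine Real.sqrt_le_iff.2 ⟨Finset.sum_nonneg fun i _ => abs_nonneg _, ?_⟩
  simp only [Real.norm_eq_abs]
  exact Finset.sum_sq_le_sq_sum_of_nonneg fun i _ => abs_nonneg _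

namespace Model

variable {Ω : Type*} [mΩ : MeasurableSpace Ω] {d m : ℕ} {P : Measure Ω}
  {ℱ : Filtration ℕ mΩ} {ξ : ℕ → Ω → Vec d} {θ : ℕ → Ω → Vec m} {μ : Measure (Vec d)}
  {g : Vec d → Vec m → Vec m} {F : Vec m → ℝ} {a : ℕ → ℝ} {L α C₀ κ c s c₁ c₂ : ℝ}

local notation "MODEL" => Model P ℱ ξ θ μ g F a L α C₀ κ c s c₁ c₂

lemma sub_lt (M : MODEL) : 1 - s < min (s / 2) ((1 + α) * s - 1) :=
  lt_min (by linarith [M.hs]) (by linarith [M.hαs])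

/-- The reason for the exponent `s / 2` of the gradient noise: with these weights the variances stay
of order `a k ‖∇F‖²`, whose means are summable. -/
lemma step_sq_le (M : MODEL) (k : ℕ) : (((k : ℝ) + 1) ^ (s / 2) * a k) ^ 2 ≤ c₂ * a k := by
  have h := M.steps.upper k
  have h0 := (M.steps.step_pos k).le
  have e : (((k : ℝ) + 1) ^ (s / 2)) ^ 2 = ((k : ℝ) + 1) ^ s := by
    rw [← Real.rpow_natCast, ← Real.rpow_mul (by positivity)]; congr 1; push_cast; ring
  have e2 : ((k : ℝ) + 1) ^ s * a k ≤ c₂ := by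
    calc _ ≤ ((k : ℝ) + 1) ^ s * (c₂ * ((k : ℝ) + 1) ^ (-s)) := by gcongr
      _ = c₂ * (((k : ℝ) + 1) ^ s * ((k : ℝ) + 1) ^ (-s)) := by ring
      _ = c₂ := by rw [← Real.rpow_add (by positivity), add_neg_cancel, Real.rpow_zero, mul_one]
  rw [mul_pow, e]
  nlinarith

variable [IsProbabilityMeasure P]

/-- Martingale convergence for the series with weights `(k + 1) ^ τ`, then `hasTail_of_tendsto`. -/
lemma ae_hasTail_centered (M : MODEL) {f : ℕ → Vec d → Vec m → ℝ} {G : ℕ → Vec m → ℝ} {τ : ℝ}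
    (hτ : 0 < τ) (hf : ∀ k, Measurable (Function.uncurry (f k))) (hG0 : ∀ k y, 0 ≤ G k y)
    (hfG : ∀ (k : ℕ) x y, (((k : ℝ) + 1) ^ τ * f k x y) ^ 2 ≤ G k y * ‖g x y‖ ^ 2)
    (hGi : ∀ k, Integrable (fun ω => G k (θ k ω)) P)
    (hGs : Summable fun k => ∫ ω, G k (θ k ω) ∂P) :
    ∀ᵐ ω ∂P, HasTail (fun k => centered μ ξ θ f k ω) τ := by
  have hmf : ∀ k : ℕ, Measurable (Function.uncurry fun (x : Vec d) (y : Vec m) =>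
      ((k : ℝ) + 1) ^ τ * f k x y) := fun k => measurable_const.mul (hf k)
  have hi : ∀ (k : ℕ) y, Integrable (fun x => (((k : ℝ) + 1) ^ τ * f k x y) ^ 2) μ := fun k y => by
    refine ((M.integrable_sq y).const_mul (G k y)).mono'
      (((hmf k).comp (measurable_id.prodMk measurable_const)).pow_const 2).aestronglyMeasurable
      (Eventually.of_forall fun x => ?_)
    rw [Real.norm_of_nonneg (sq_nonneg _)]
    exact hfG k x y
  have := M.ae_exists_tendsto_centered (f := fun k x y => ((k : ℝ) + 1) ^ τ * f k x y)
    (G := fun k y => C₀ * G k y) hmf (fun k y => mul_nonneg M.hC₀.le (hG0 k y))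
    (fun k y => ⟨hi k y, by
      calc _ ≤ ∫ x, G k y * ‖g x y‖ ^ 2 ∂μ :=
            integral_mono (hi k y) ((M.integrable_sq y).const_mul _) fun x => hfG k x y
        _ ≤ G k y * (C₀ * (gap F y + 1)) := by
            rw [integral_const_mul]
            exact mul_le_mul_of_nonneg_left (M.sq_le y) (hG0 k y)
        _ = _ := by ring⟩)
    (fun k => (hGi k).const_mul _) (by simpa only [integral_const_mul] using hGs.mul_left C₀)
  filter_upwards [this] with ω ⟨l, hl⟩
  refine hasTail_of_tendsto hτ (hl.congr fun n => Finset.sum_congr rfl fun k _ => ?_)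
  simp only [centered, integral_const_mul]
  ring

lemma ae_hasTail_gradient_noise (M : MODEL) :
    ∀ᵐ ω ∂P, HasTail (fun k => a k * inner ℝ (g (ξ k ω) (θ k ω) - ∫ x, g x (θ k ω) ∂μ)
      (gradient F (θ k ω))) (s / 2) := by
  have hs := M.hs
  have := M.ae_hasTail_centered (f := fun k x y => a k * inner ℝ (g x y) (gradient F y))
    (G := fun k y => c₂ * (a k * ‖gradient F y‖ ^ 2)) (τ := s / 2) (by linarith)
    (fun k => measurable_const.mul
      (M.measurable_g.inner (M.measurable_gradient.comp measurable_snd)))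
    (fun k y => mul_nonneg M.steps.upper_pos.le
      (mul_nonneg (M.steps.step_pos k).le (sq_nonneg _)))
    (fun k x y => by
      have h1 := M.step_sq_le k
      have h2 : inner ℝ (g x y) (gradient F y) ^ 2 ≤ ‖g x y‖ ^ 2 * ‖gradient F y‖ ^ 2 := by
        rw [← mul_pow, ← sq_abs]
        exact pow_le_pow_left₀ (abs_nonneg _) (abs_real_inner_le_norm _ _) 2
      calc _ = (((k : ℝ) + 1) ^ (s / 2) * a k) ^ 2 * inner ℝ (g x y) (gradient F y) ^ 2 := by ring
        _ ≤ (c₂ * a k) * (‖g x y‖ ^ 2 * ‖gradient F y‖ ^ 2) :=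
            mul_le_mul h1 h2 (sq_nonneg _) ((sq_nonneg _).trans h1)
        _ = _ := by ring)
    (fun k => ((M.integrable_sq_gradient k).const_mul _).const_mul _)
    (by simpa only [integral_const_mul] using M.summable_integral_sq_gradient.mul_left c₂)
  filter_upwards [this] with ω hω
  convert hω using 2 with k
  have hg := M.integrable_oracle (θ k ω)
  simp only [centered, integral_const_mul]
  rw [← mul_sub, inner_sub_left, real_inner_comm _ (∫ x, g x (θ k ω) ∂μ),
    ← integral_inner (𝕜 := ℝ) hg (gradient F (θ k ω))]
  congr 2
  exact integral_congr_ae (Eventually.of_forall fun x => real_inner_comm _ _)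

/-- The weights `(k + 1) ^ (s - 3 / 4)` leave variances of order `(k + 1) ^ (-3 / 2)`, up to the
gap. -/
lemma ae_hasTail_noise (M : MODEL) (i : Fin m) :
    ∀ᵐ ω ∂P, HasTail (fun k => centered μ ξ θ (fun k x y => a k * g x y i) k ω)
      (s - 3 / 4) := by
  have hs := M.hs
  have hc₂ := M.steps.upper_pos
  have := M.ae_hasTail_centered (f := fun k x y => a k * g x y i)
    (G := fun k _ => c₂ ^ 2 * ((k : ℝ) + 1) ^ (-(3 / 2 : ℝ))) (τ := s - 3 / 4) (by linarith)
    (fun k => measurable_const.mul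
      ((EuclideanSpace.proj i : Vec m →L[ℝ] ℝ).continuous.measurable.comp M.measurable_g))
    (fun k y => by positivity)
    (fun k x y => by
      have h1 : ((k : ℝ) + 1) ^ (s - 3 / 4) * a k ≤ c₂ * ((k : ℝ) + 1) ^ (-(3 / 4 : ℝ)) := by
        calc _ ≤ ((k : ℝ) + 1) ^ (s - 3 / 4) * (c₂ * ((k : ℝ) + 1) ^ (-s)) := by
              gcongr; exact M.steps.upper k
          _ = c₂ * (((k : ℝ) + 1) ^ (s - 3 / 4) * ((k : ℝ) + 1) ^ (-s)) := by ring
          _ = _ := by rw [← Real.rpow_add (by positivity)]; congr 2; ring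
      have h2 : (g x y i) ^ 2 ≤ ‖g x y‖ ^ 2 := by
        rw [← sq_abs]
        exact pow_le_pow_left₀ (abs_nonneg _) (PiLp.norm_apply_le (g x y) i) 2
      have h3 := (M.steps.step_pos k).le
      calc _ = (((k : ℝ) + 1) ^ (s - 3 / 4) * a k) ^ 2 * (g x y i) ^ 2 := by ring
        _ ≤ (c₂ * ((k : ℝ) + 1) ^ (-(3 / 4 : ℝ))) ^ 2 * ‖g x y‖ ^ 2 := by gcongr
        _ = _ := by
          rw [mul_pow, ← Real.rpow_natCast (((k : ℝ) + 1) ^ (-(3 / 4 : ℝ))),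
            ← Real.rpow_mul (by positivity)]
          norm_num)
    (fun k => integrable_const _)
    (by simpa using (summable_add_one_rpow_neg (p := 3 / 2) (by norm_num)).mul_left (c₂ ^ 2))
  exact this

/-- Tail of the remainder of the descent inequality. -/
lemma ae_hasTail_remainder (M : MODEL) {τ : ℝ} (hτ0 : 0 < τ) (hτs : τ ≤ s / 2)
    (hτ : τ ≤ (1 + α) * s - 1) :
    ∀ᵐ ω ∂P, HasTail (fun k => a k ^ (1 + α) * ‖g (ξ k ω) (θ k ω)‖ ^ (1 + α)) τ := by
  have hα := M.hα.1
  have hs := M.hs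
  have hc₂ := M.steps.upper_pos
  have hsp := M.steps.step_pos
  have hstep : ∀ k, a k ^ (1 + α) ≤ c₂ ^ (1 + α) * ((k : ℝ) + 1) ^ (-((1 + α) * s)) :=
    fun k => M.steps.rpow_le (by linarith) k
  have hk0 : ∀ (k : ℕ) (p : ℝ), 0 ≤ ((k : ℝ) + 1) ^ p := fun k p => by positivity
  have ha0 : ∀ k, 0 ≤ a k ^ (1 + α) := fun k => Real.rpow_nonneg (hsp k).le _
  -- weighted series
  have hser : ∀ {f : ℕ → Vec d → Vec m → ℝ} {r : ℕ → ℝ},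
      (∀ k, Measurable (Function.uncurry (f k))) → (∀ k x y, 0 ≤ f k x y) →
      (∀ k y, Integrable (fun x => f k x y) μ ∧
        ∫ x, ((k : ℝ) + 1) ^ τ * f k x y ∂μ ≤ r k * (gap F y + 1)) →
      (∀ k, 0 ≤ r k) → Summable r →
      ∀ᵐ ω ∂P, HasTail (fun k => f k (ξ k ω) (θ k ω)) τ := by
    intro f r hf hf0 hfr hr0 hr
    have := M.ae_summable (f := fun k x y => ((k : ℝ) + 1) ^ τ * f k x y)
      (fun k => (hf k).const_mul _) (fun k x y => mul_nonneg (hk0 _ _) (hf0 k x y))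
      (fun k y => ⟨(hfr k y).1.const_mul _, (hfr k y).2⟩) hr0 hr
    filter_upwards [this] with ω hω
    exact hasTail_of_tendsto hτ0 hω.hasSum.tendsto_sum_nat
  have hmg : ∀ k, Measurable (Function.uncurry fun (x : Vec d) (y : Vec m) =>
      a k ^ (1 + α) * ‖g x y‖ ^ (1 + α)) := fun k =>
    measurable_const.mul (M.measurable_g.norm.pow_const _)
  rcases hτ.lt_or_eq with hlt | heq
  · refine hser (f := fun k x y => a k ^ (1 + α) * ‖g x y‖ ^ (1 + α))
      (r := fun k => c₂ ^ (1 + α) * (1 + C₀) * ((k : ℝ) + 1) ^ (-((1 + α) * s - τ))) hmg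
      (fun k x y => mul_nonneg (ha0 k) (by positivity)) (fun k y => ?_)
      (fun k => by have := M.hC₀; positivity)
      ((summable_add_one_rpow_neg (by linarith)).mul_left _)
    obtain ⟨h1, h2⟩ := M.integrable_rpow y
    refine ⟨h1.const_mul _, ?_⟩
    rw [integral_const_mul, integral_const_mul]
    have hC₀ := M.hC₀
    have hgap := M.gap_nonneg y
    calc _ ≤ ((k : ℝ) + 1) ^ τ * (c₂ ^ (1 + α) * ((k : ℝ) + 1) ^ (-((1 + α) * s)) *
          ((1 + C₀) * (gap F y + 1))) := by
          gcongr
          exact hstep k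
      _ = c₂ ^ (1 + α) * (1 + C₀) * (((k : ℝ) + 1) ^ τ * ((k : ℝ) + 1) ^ (-((1 + α) * s))) *
          (gap F y + 1) := by ring
      _ = _ := by rw [← Real.rpow_add (by positivity)]; congr 3; ring
  · -- truncation at the level `√(k + 1)`
    -- `α = 1` would mean `2 s - 1 ≤ s / 2`, against `s > 3 / 4`.
    have hα1 : α < 1 := by nlinarith
    have hτe : (1 + α) * s = 1 + τ := by linarith
    rw [hτe] at hstep
    -- At the critical exponent the weighted means are only `O(1 / k)`, so the remainder is split in
    -- three. The excess over the truncation level gains `(1 - α) / 2` from the second moment; the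
    -- centered truncated part is an L² martingale with summable weighted variances since `α < 1`;
    -- the conditional mean is `O(k ^ (-(1 + τ)))`, and its tails are estimated directly, without
    -- weights.
    obtain ⟨u, hu⟩ : ∃ u : ℕ → Vec d → Vec m → ℝ,
        u = fun (k : ℕ) x y => min ‖g x y‖ (((k : ℝ) + 1) ^ (1 / 2 : ℝ)) ^ (1 + α) := ⟨_, rfl⟩
    have hu0 : ∀ k x y, 0 ≤ u k x y := fun k x y => by rw [hu]; positivity
    have hum : ∀ k, Measurable (Function.uncurry (u k)) := fun k => by
      rw [hu]; exact (M.measurable_g.norm.min measurable_const).pow_const _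
    have hule : ∀ k x y, u k x y ≤ ‖g x y‖ ^ (1 + α) := fun k x y => by
      rw [hu]; exact Real.rpow_le_rpow (by positivity) (min_le_left _ _) (by linarith)
    have hui : ∀ k y, Integrable (fun x => u k x y) μ := fun k y => by
      refine (M.integrable_rpow y).1.mono'
        ((hum k).comp (measurable_id.prodMk measurable_const)).aestronglyMeasurable
        (Eventually.of_forall fun x => ?_)
      rw [Real.norm_of_nonneg (hu0 k x y)]
      exact hule k x y
    have hrest : ∀ᵐ ω ∂P, HasTail (fun k => a k ^ (1 + α) *
        (‖g (ξ k ω) (θ k ω)‖ ^ (1 + α) - u k (ξ k ω) (θ k ω))) τ := by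
      refine hser (f := fun k x y => a k ^ (1 + α) * (‖g x y‖ ^ (1 + α) - u k x y))
        (r := fun k => c₂ ^ (1 + α) * C₀ * ((k : ℝ) + 1) ^ (-(1 + (1 - α) / 2)))
        (fun k => measurable_const.mul ((M.measurable_g.norm.pow_const _).sub (hum k)))
        (fun k x y => mul_nonneg (ha0 k) (sub_nonneg.2 (hule k x y))) (fun k y => ?_)
        (fun k => by have := M.hC₀; positivity)
        ((summable_add_one_rpow_neg (by linarith)).mul_left _)
      have hi : Integrable (fun x => a k ^ (1 + α) * (‖g x y‖ ^ (1 + α) - u k x y)) μ :=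
        ((M.integrable_rpow y).1.sub (hui k y)).const_mul _
      refine ⟨hi, ?_⟩
      have hpt : ∀ x, ‖g x y‖ ^ (1 + α) - u k x y ≤
          ((k : ℝ) + 1) ^ (-((1 - α) / 2)) * ‖g x y‖ ^ 2 := fun x => by
        rcases le_total ‖g x y‖ (((k : ℝ) + 1) ^ (1 / 2 : ℝ)) with h | h
        · rw [hu]; dsimp only; rw [min_eq_left h, sub_self]; positivity
        · have hg0 : 0 < ‖g x y‖ := (Real.rpow_pos_of_pos (by positivity) _).trans_le h
          have e1 : ‖g x y‖ ^ (1 + α) = ‖g x y‖ ^ (-(1 - α)) * ‖g x y‖ ^ 2 := by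
            rw [← Real.rpow_two, ← Real.rpow_add hg0]; congr 1; ring
          have e2 : ‖g x y‖ ^ (-(1 - α)) ≤ ((k : ℝ) + 1) ^ (-((1 - α) / 2)) := by
            refine (Real.rpow_le_rpow_of_nonpos (Real.rpow_pos_of_pos (by positivity) _) h
              (by linarith)).trans (le_of_eq ?_)
            rw [← Real.rpow_mul (by positivity)]; congr 1; ring
          have := hu0 k x y
          rw [e1]
          nlinarith [mul_le_mul_of_nonneg_right e2 (sq_nonneg ‖g x y‖)]
      have hpt2 : ∀ x, ((k : ℝ) + 1) ^ τ * (a k ^ (1 + α) * (‖g x y‖ ^ (1 + α) - u k x y)) ≤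
          c₂ ^ (1 + α) * ((k : ℝ) + 1) ^ (-(1 + (1 - α) / 2)) * ‖g x y‖ ^ 2 := fun x => by
        have := sub_nonneg.2 (hule k x y)
        calc _ ≤ ((k : ℝ) + 1) ^ τ * (c₂ ^ (1 + α) * ((k : ℝ) + 1) ^ (-(1 + τ)) *
              (((k : ℝ) + 1) ^ (-((1 - α) / 2)) * ‖g x y‖ ^ 2)) := by
              gcongr
              · exact hstep k
              · exact hpt x
          _ = c₂ ^ (1 + α) * (((k : ℝ) + 1) ^ τ * ((k : ℝ) + 1) ^ (-(1 + τ)) *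
              ((k : ℝ) + 1) ^ (-((1 - α) / 2))) * ‖g x y‖ ^ 2 := by ring
          _ = _ := by
              rw [← Real.rpow_add (by positivity), ← Real.rpow_add (by positivity)]
              congr 3; ring
      calc _ ≤ ∫ x, c₂ ^ (1 + α) * ((k : ℝ) + 1) ^ (-(1 + (1 - α) / 2)) * ‖g x y‖ ^ 2 ∂μ :=
            integral_mono (hi.const_mul _) ((M.integrable_sq y).const_mul _) hpt2
        _ ≤ c₂ ^ (1 + α) * ((k : ℝ) + 1) ^ (-(1 + (1 - α) / 2)) * (C₀ * (gap F y + 1)) := by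
            rw [integral_const_mul]
            exact mul_le_mul_of_nonneg_left (M.sq_le y) (by positivity)
        _ = _ := by ring
    have hcent : ∀ᵐ ω ∂P, HasTail (fun k =>
        centered μ ξ θ (fun k x y => a k ^ (1 + α) * u k x y) k ω) τ := by
      refine M.ae_hasTail_centered
        (G := fun k _ => (c₂ ^ (1 + α)) ^ 2 * ((k : ℝ) + 1) ^ (-(2 - α))) hτ0
        (fun k => measurable_const.mul (hum k)) (fun k y => by positivity) (fun k x y => ?_)
        (fun k => integrable_const _) ?_
      · have h1 : ((k : ℝ) + 1) ^ τ * a k ^ (1 + α) ≤ c₂ ^ (1 + α) * ((k : ℝ) + 1) ^ (-1 : ℝ) := by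
          calc _ ≤ ((k : ℝ) + 1) ^ τ * (c₂ ^ (1 + α) * ((k : ℝ) + 1) ^ (-(1 + τ))) := by
                gcongr; exact hstep k
            _ = c₂ ^ (1 + α) * (((k : ℝ) + 1) ^ τ * ((k : ℝ) + 1) ^ (-(1 + τ))) := by ring
            _ = _ := by rw [← Real.rpow_add (by positivity)]; congr 2; ring
        have h2 : u k x y ≤ ((k : ℝ) + 1) ^ (α / 2) * ‖g x y‖ := by
          obtain ⟨v, hv⟩ : ∃ v, v = min ‖g x y‖ (((k : ℝ) + 1) ^ (1 / 2 : ℝ)) := ⟨_, rfl⟩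
          have hv0 : 0 ≤ v := by rw [hv]; positivity
          have e0 : u k x y = v ^ α * v := by
            rw [hu]; dsimp only
            rw [← hv, add_comm, Real.rpow_add_one' hv0 (by linarith)]
          have e1 : v ^ α ≤ ((k : ℝ) + 1) ^ (α / 2) := by
            refine (Real.rpow_le_rpow hv0 (hv ▸ min_le_right _ _) hα.le).trans (le_of_eq ?_)
            rw [← Real.rpow_mul (by positivity)]; congr 1; ring
          rw [e0]
          exact mul_le_mul e1 (hv ▸ min_le_left _ _) hv0 (hk0 _ _)
        have h3 := hu0 k x y
        have h4 := ha0 k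
        calc _ = (((k : ℝ) + 1) ^ τ * a k ^ (1 + α) * u k x y) ^ 2 := by ring
          _ ≤ (c₂ ^ (1 + α) * ((k : ℝ) + 1) ^ (-1 : ℝ) *
              (((k : ℝ) + 1) ^ (α / 2) * ‖g x y‖)) ^ 2 := by gcongr
          _ = (c₂ ^ (1 + α)) ^ 2 * (((k : ℝ) + 1) ^ (-1 : ℝ) * ((k : ℝ) + 1) ^ (α / 2)) ^ 2 *
              ‖g x y‖ ^ 2 := by ring
          _ = _ := by
              rw [← Real.rpow_add (by positivity), ← Real.rpow_natCast (_ ^ (-1 + α / 2)),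
                ← Real.rpow_mul (by positivity)]
              congr 3; push_cast; ring
      · simpa using (summable_add_one_rpow_neg (p := 2 - α) (by linarith)).mul_left
          ((c₂ ^ (1 + α)) ^ 2)
    filter_upwards [hrest, hcent, M.ae_exists_gap_le] with ω h1 h2 ⟨B, hB⟩
    have h3 : HasTail (fun k => ∫ x, a k ^ (1 + α) * u k x (θ k ω) ∂μ) τ := by
      refine HasTail.of_abs_le hτ0
        ((hasTail_rpow hτ0).const_mul (c₂ ^ (1 + α) * ((1 + C₀) * (B + 1)))) fun k => ?_
      have hC₀ := M.hC₀
      have h0 : 0 ≤ ∫ x, u k x (θ k ω) ∂μ := integral_nonneg fun x => hu0 k x _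
      have h4 : ∫ x, u k x (θ k ω) ∂μ ≤ (1 + C₀) * (B + 1) :=
        (integral_mono (hui k _) (M.integrable_rpow _).1 fun x => hule k x _).trans
          ((M.integrable_rpow _).2.trans (by gcongr; exact hB k))
      rw [integral_const_mul, abs_of_nonneg (mul_nonneg (ha0 k) h0)]
      calc _ ≤ c₂ ^ (1 + α) * ((k : ℝ) + 1) ^ (-(1 + τ)) * ((1 + C₀) * (B + 1)) :=
            mul_le_mul (hstep k) h4 h0 (by positivity)
        _ = _ := by ring
    convert (h1.add h2).add h3 using 2 with k
    simp only [centered]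
    ring

/-- Displacements of the trajectory are controlled by gradients and by noise. -/
lemma norm_sub_le (M : MODEL) {n l : ℕ} (hnl : n ≤ l) (ω : Ω) :
    ‖θ l ω - θ n ω‖ ≤ c * ∑ k ∈ Finset.Ico n l, a k * ‖gradient F (θ k ω)‖ +
      ∑ i, |∑ k ∈ Finset.Ico n l, centered μ ξ θ (fun k x y => a k * g x y i) k ω| := by
  have hsum : θ l ω - θ n ω = -∑ k ∈ Finset.Ico n l, a k • ∫ x, g x (θ k ω) ∂μ -
      ∑ k ∈ Finset.Ico n l, a k • (g (ξ k ω) (θ k ω) - ∫ x, g x (θ k ω) ∂μ) := by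
    induction l, hnl using Nat.le_induction with
    | base => simp
    | succ l hl ih =>
      rw [Finset.sum_Ico_succ_top hl, Finset.sum_Ico_succ_top hl, M.succ_eq,
        sub_right_comm, ih, smul_sub]
      abel
  rw [hsum]
  refine (_root_.norm_sub_le _ _).trans (add_le_add ?_ ?_)
  · rw [norm_neg, Finset.mul_sum]
    refine (norm_sum_le _ _).trans (Finset.sum_le_sum fun k _ => ?_)
    rw [norm_smul, Real.norm_of_nonneg (M.steps.step_pos k).le]
    have := mul_le_mul_of_nonneg_left (M.mean_le (θ k ω)) (M.steps.step_pos k).le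
    linarith
  · refine (norm_le_sum_abs _).trans (le_of_eq (Finset.sum_congr rfl fun i _ => ?_))
    rw [WithLp.ofLp_sum, Finset.sum_apply]
    congr 1
    refine Finset.sum_congr rfl fun k _ => ?_
    have := (EuclideanSpace.proj i : Vec m →L[ℝ] ℝ).integral_comp_comm (M.integrable_oracle (θ k ω))
    simp only [centered, integral_const_mul]
    rw [← mul_sub]
    exact congrArg (fun r => a k * (g (ξ k ω) (θ k ω) i - r)) this.symm

/-- The almost sure inputs of the deterministic analysis. -/
lemma ae_path (M : MODEL) (hco : Coercive F) {τ : ℝ} (hτ0 : 0 < τ) (hτs : τ ≤ s / 2)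
    (hτ : τ ≤ (1 + α) * s - 1) :
    ∀ᵐ ω ∂P, ∃ e : ℕ → ℝ, HasTail e τ ∧
      (∀ k, F (θ (k + 1) ω) ≤ F (θ k ω) - κ * (a k * ‖gradient F (θ k ω)‖ ^ 2) + e k) ∧
      (∃ R, ∀ k, ‖θ k ω‖ ≤ R) ∧
      ∃ D, 0 ≤ D ∧ ∀ n l : ℕ, n ≤ l → ‖θ l ω - θ n ω‖ ≤
        c * ∑ k ∈ Finset.Ico n l, a k * ‖gradient F (θ k ω)‖ +
          D * ((n : ℝ) + 1) ^ (-(s - 3 / 4)) := by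
  have hs := M.hs
  filter_upwards [M.ae_hasTail_gradient_noise, ae_all_iff.2 M.ae_hasTail_noise,
    M.ae_hasTail_remainder hτ0 hτs hτ, M.ae_exists_gap_le] with ω h1 h2 h3 ⟨B, hB⟩
  refine ⟨_, ((h1.mono hτs).const_mul (-1)).add (h3.const_mul L), fun k => ?_, ?_, ?_⟩
  · have e1 := M.value_step_le (M.steps.step_pos k) (ξ k ω) (θ k ω)
    have e2 := mul_le_mul_of_nonneg_left (M.drift (θ k ω)) (M.steps.step_pos k).le
    rw [M.succ_eq, inner_sub_left]
    linarith
  · obtain ⟨R, hR⟩ := (hco.isBounded_sublevel (B + ⨅ z, F z)).exists_norm_le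
    refine ⟨R, fun k => hR _ ?_⟩
    have := hB k
    simp only [gap] at this
    show F (θ k ω) ≤ _
    linarith
  · choose C hC0 hC using fun i => (h2 i).abs_sum_Ico_le (by linarith)
    refine ⟨∑ i, C i, Finset.sum_nonneg fun i _ => (hC0 i).le, fun n l hnl => ?_⟩
    refine (M.norm_sub_le hnl ω).trans (add_le_add le_rfl ?_)
    rw [Finset.sum_mul]
    exact Finset.sum_le_sum fun i _ => hC i n l hnl

end Model

end

section

/-! ### Rates in the mean -/

lemma sq_integral_le {Ω : Type*} [MeasurableSpace Ω] {P : Measure Ω} [IsProbabilityMeasure P]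
    {f : Ω → ℝ} (hf : Integrable f P) (hf2 : Integrable (fun ω => f ω ^ 2) P) :
    (∫ ω, f ω ∂P) ^ 2 ≤ ∫ ω, f ω ^ 2 ∂P :=
  (even_two.convexOn_pow (𝕜 := ℝ)).map_integral_le (continuous_pow 2).continuousOn isClosed_univ
    (Eventually.of_forall fun _ => mem_univ _) hf hf2

namespace Model

variable {Ω : Type*} [mΩ : MeasurableSpace Ω] {d m : ℕ} {P : Measure Ω} [IsProbabilityMeasure P]
  {ℱ : Filtration ℕ mΩ} {ξ : ℕ → Ω → Vec d} {θ : ℕ → Ω → Vec m} {μ : Measure (Vec d)}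
  {g : Vec d → Vec m → Vec m} {F : Vec m → ℝ} {a : ℕ → ℝ} {L α C₀ κ c s c₁ c₂ : ℝ}

local notation "MODEL" => Model P ℱ ξ θ μ g F a L α C₀ κ c s c₁ c₂

/-- In the mean the martingale terms disappear and the errors are deterministic, so the tail
exponent is `(1 + α) s - 1` without the cap `s / 2`. `W` is the mean gap plus the tail of a
nonnegative error series. -/
lemma exists_lyapunov_mean (M : MODEL) :
    ∃ W T A, Lyapunov a (fun k => √(∫ ω, ‖gradient F (θ k ω)‖ ^ 2 ∂P)) W T κ
      ((1 + α) * s - 1) A ∧ ∀ k, W k - T k = ∫ ω, gap F (θ k ω) ∂P := by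
  have hα := M.hα.1
  have hτ : 0 < (1 + α) * s - 1 := by linarith [M.one_lt]
  obtain ⟨B, hB0, hB⟩ := M.exists_integral_gap_le
  set τ := (1 + α) * s - 1 with hτdef
  set e : ℕ → ℝ := fun k => L * (1 + C₀) * a k ^ (1 + α) * (B + 1) with he
  have he0 : ∀ k, 0 ≤ e k := fun k => mul_nonneg (M.coeff_nonneg k) (by linarith)
  have htail : HasTail e τ := by
    refine HasTail.of_abs_le hτ ((hasTail_rpow hτ).const_mul
      (L * (1 + C₀) * c₂ ^ (1 + α) * (B + 1))) fun k => ?_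
    rw [abs_of_nonneg (he0 k)]
    have h1 := M.steps.rpow_le (p := 1 + α) (by linarith) k
    have h2 : -((1 + α) * s) = -(1 + τ) := by rw [hτdef]; ring
    rw [h2] at h1
    have hL := M.hL
    have hC₀ := M.hC₀
    calc e k ≤ L * (1 + C₀) * (c₂ ^ (1 + α) * ((k : ℝ) + 1) ^ (-(1 + τ))) * (B + 1) := by
          rw [he]; dsimp only; gcongr
      _ = _ := by ring
  obtain ⟨l, C, hC⟩ := htail
  have hl : Tendsto (fun k => ∑ i ∈ Finset.range k, e i) atTop (𝓝 l) := by
    rw [tendsto_iff_norm_sub_tendsto_zero]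
    have h0 : Tendsto (fun n : ℕ => C * ((n : ℝ) + 1) ^ (-τ)) atTop (𝓝 0) := by
      simpa using (tendsto_add_one_rpow_neg hτ).const_mul C
    exact squeeze_zero (fun _ => norm_nonneg _) hC h0
  have hT0 : ∀ k, 0 ≤ l - ∑ i ∈ Finset.range k, e i := fun k => by
    have hm : Monotone fun k => ∑ i ∈ Finset.range k, e i :=
      monotone_nat_of_le_succ fun n => by
        rw [Finset.sum_range_succ]; linarith [he0 n]
    linarith [hm.ge_of_tendsto hl k]
  refine ⟨fun k => ∫ ω, gap F (θ k ω) ∂P + (l - ∑ i ∈ Finset.range k, e i),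
    fun k => l - ∑ i ∈ Finset.range k, e i, |C| + 1, ⟨by positivity, fun k => ?_, fun k => ?_,
      fun k => ?_⟩, fun k => by ring⟩
  · exact add_nonneg (M.integral_gap_nonneg k) (hT0 k)
  · have h1 := M.integral_gap_succ_le k
    have h2 : L * (1 + C₀) * a k ^ (1 + α) * (∫ ω, gap F (θ k ω) ∂P + 1) ≤ e k :=
      mul_le_mul_of_nonneg_left (by linarith [hB k]) (M.coeff_nonneg k)
    rw [Real.sq_sqrt (integral_nonneg fun _ => sq_nonneg _), Finset.sum_range_succ]
    linarith
  · rw [abs_sub_comm]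
    refine (hC k).trans (mul_le_mul_of_nonneg_right ?_ (Real.rpow_nonneg (by positivity) _))
    linarith [le_abs_self C]

/-- Rates for the mean square gradients under global Łojasiewicz inequalities. -/
lemma tailBounds_mean (M : MODEL) :
    (∀ Q g : ℝ, 0 < Q → (∀ y, gap F y ≤ Q * ‖gradient F y‖ ^ 2) →
      (s = 1 → Tendsto (fun k : ℕ => ((k : ℝ) + 1) * a k) atTop (𝓝 g) ∧ α < κ / Q * g) →
      TailBound a (fun k => √(∫ ω, ‖gradient F (θ k ω)‖ ^ 2 ∂P)) (fun k => (k : ℝ) + 1)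
        (((1 + α) * s - 1 - (1 - s)) / 2)) ∧
    ∀ β ζ, 1 / 2 < β → β < 1 → 0 < ζ → GlobalLojasiewiczIneq F β ζ →
      (s < 1 → TailBound a (fun k => √(∫ ω, ‖gradient F (θ k ω)‖ ^ 2 ∂P)) (fun k => (k : ℝ) + 1)
        ((min ((1 + α) * s - 1) ((1 - s) / (2 * β - 1)) - (1 - s)) / 2)) ∧
      (s = 1 → TailBound a (fun k => √(∫ ω, ‖gradient F (θ k ω)‖ ^ 2 ∂P))
        (fun k => Real.log ((k : ℝ) + 2)) ((1 / (2 * β - 1) - 1) / 2)) := by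
  have hs := M.hs
  have hs1 := M.hs1
  have hα := M.hα.1
  have hτ : 1 - s < (1 + α) * s - 1 := by linarith [M.hαs]
  have hsq : ∀ k, √(∫ ω, ‖gradient F (θ k ω)‖ ^ 2 ∂P) ^ 2 =
      ∫ ω, ‖gradient F (θ k ω)‖ ^ 2 ∂P := fun k =>
    Real.sq_sqrt (integral_nonneg fun _ => sq_nonneg _)
  obtain ⟨W, T, A, hW, hWT⟩ := M.exists_lyapunov_mean
  refine ⟨fun Q g hQ hle hg => ?_, fun β ζ hβ2 hβ1 hζ hG => ?_⟩
  · refine hW.tailBound_of_linear (g := g) M.hκ M.steps (by linarith) hs1 hτ hQ (fun h => ?_)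
      (Eventually.of_forall fun k => ?_)
    · refine ⟨(hg h).1, ?_⟩
      have := (hg h).2
      rw [h]; linarith
    · rw [hWT, abs_of_nonneg (M.integral_gap_nonneg k), hsq, ← integral_const_mul]
      exact integral_mono (M.integrable_gap k) ((M.integrable_sq_gradient k).const_mul Q)
        fun ω => hle _
  · have hpt : ∀ y, gap F y ^ (2 * β) ≤ ζ ^ 2 * ‖gradient F y‖ ^ 2 := fun y => by
      rw [mul_comm, Real.rpow_mul (M.gap_nonneg y), Real.rpow_two, ← mul_pow]
      exact pow_le_pow_left₀ (Real.rpow_nonneg (M.gap_nonneg y) _) (hG y) 2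
    have hpow : ∀ᶠ k in atTop, |W k - T k| ^ (2 * β) ≤
        ζ ^ 2 * √(∫ ω, ‖gradient F (θ k ω)‖ ^ 2 ∂P) ^ 2 := by
      refine Eventually.of_forall fun k => ?_
      rw [hWT, abs_of_nonneg (M.integral_gap_nonneg k), hsq, ← integral_const_mul]
      have hi2 := (M.integrable_sq_gradient k).const_mul (ζ ^ 2)
      have hi : Integrable (fun ω => gap F (θ k ω) ^ (2 * β)) P := by
        refine hi2.mono' ((M.measurable_gap.comp
          (M.innovation.measurable_state k)).pow_const _).aestronglyMeasurable
          (Eventually.of_forall fun ω => ?_)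
        rw [Real.norm_of_nonneg (Real.rpow_nonneg (M.gap_nonneg _) _)]
        exact hpt _
      refine le_trans ?_ (integral_mono hi hi2 fun ω => hpt _)
      -- Jensen's inequality for the convex function `t ^ (2 β)` transfers the pointwise inequality
      -- to the means.
      exact (convexOn_rpow (p := 2 * β) (by linarith)).map_integral_le
        (Real.continuous_rpow_const (by linarith)).continuousOn isClosed_Ici
        (Eventually.of_forall fun ω => M.gap_nonneg _) (M.integrable_gap k) hi
    refine ⟨fun hs => ?_, fun hs => ?_⟩
    · exact hW.tailBound_of_pow M.hκ M.steps (by linarith) hs hτ (by linarith) (by linarith)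
        (by positivity) hpow
    · subst hs
      exact hW.tailBound_log M.hκ M.steps (by linarith) (by linarith) (by linarith)
        (by positivity) hpow

/-- Displacements in the mean. -/
lemma exists_integral_norm_sub_le (M : MODEL) : ∃ D, 0 ≤ D ∧ ∀ n l : ℕ, n ≤ l →
    ∫⁻ ω, ‖θ l ω - θ n ω‖ₑ ∂P ≤ ENNReal.ofReal
      (c * ∑ k ∈ Finset.Ico n l, a k * √(∫ ω, ‖gradient F (θ k ω)‖ ^ 2 ∂P) +
        D * ((n : ℝ) + 1) ^ (-(s - 3 / 4))) := by
  have hs := M.hs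
  have hC₀ := M.hC₀
  have hc₂ := M.steps.upper_pos
  obtain ⟨B, hB0, hB⟩ := M.exists_integral_gap_le
  have hgm : ∀ i, Measurable fun z : Vec d × Vec m => g z.1 z.2 i := fun i =>
    (EuclideanSpace.proj i : Vec m →L[ℝ] ℝ).continuous.measurable.comp M.measurable_g
  have hfm : ∀ i k, Measurable (Function.uncurry fun (x : Vec d) (y : Vec m) => a k * g x y i) :=
    fun i k => (hgm i).const_mul _
  have hsqle : ∀ (v : Vec m) i, (v i) ^ 2 ≤ ‖v‖ ^ 2 := fun v i => by
    rw [← sq_abs]; exact pow_le_pow_left₀ (abs_nonneg _) (PiLp.norm_apply_le v i) 2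
  -- second moments of the noise
  have hint : ∀ i k, Integrable (fun ω => (a k * g (ξ k ω) (θ k ω) i) ^ 2) P ∧
      ∫ ω, (a k * g (ξ k ω) (θ k ω) i) ^ 2 ∂P ≤
        c₂ ^ 2 * C₀ * (B + 1) * ((k : ℝ) + 1) ^ (-(1 + (2 * s - 1))) := by
    intro i k
    have h := M.innovation.integrable_of_le k (f := fun x y => (a k * g x y i) ^ 2)
      ((hfm i k).pow_const 2) (fun x y => sq_nonneg _)
      (D := fun y => a k ^ 2 * (C₀ * (gap F y + 1)))
      (fun y => by
        have hle : ∀ x, (a k * g x y i) ^ 2 ≤ a k ^ 2 * ‖g x y‖ ^ 2 := fun x => by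
          rw [mul_pow]; exact mul_le_mul_of_nonneg_left (hsqle _ i) (sq_nonneg _)
        have hi2 := (M.integrable_sq y).const_mul (a k ^ 2)
        have hi : Integrable (fun x => (a k * g x y i) ^ 2) μ := by
          refine hi2.mono' (((hfm i k).comp
            (measurable_id.prodMk measurable_const)).pow_const 2).aestronglyMeasurable
            (Eventually.of_forall fun x => ?_)
          rw [Real.norm_of_nonneg (sq_nonneg _)]
          exact hle x
        refine ⟨hi, (integral_mono hi hi2 hle).trans ?_⟩
        rw [integral_const_mul]
        exact mul_le_mul_of_nonneg_left (M.sq_le y) (sq_nonneg _))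
      ((((M.integrable_gap k).add (integrable_const _)).const_mul _).const_mul _)
    refine ⟨h.1, h.2.trans ?_⟩
    rw [integral_const_mul, integral_const_mul,
      integral_add (M.integrable_gap k) (integrable_const _)]
    simp only [integral_const, probReal_univ, smul_eq_mul, mul_one]
    have h1 := M.steps.rpow_le (p := 2) (by norm_num) k
    rw [Real.rpow_two, Real.rpow_two, show -(2 * s) = -(1 + (2 * s - 1)) by ring] at h1
    have hu := M.integral_gap_nonneg k
    calc _ ≤ c₂ ^ 2 * ((k : ℝ) + 1) ^ (-(1 + (2 * s - 1))) * (C₀ * (B + 1)) := by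
          gcongr
          exact hB k
      _ = _ := by ring
  have hL : ∀ i k, MemLp (fun ω => a k * g (ξ k ω) (θ k ω) i) 2 P := fun i k => by
    refine (memLp_two_iff_integrable_sq ?_).2 (hint i k).1
    exact ((hfm i k).comp ((M.innovation.measurable k).prodMk
      (M.innovation.measurable_state k))).aestronglyMeasurable
  obtain ⟨K, hK, hKb⟩ := ((hasTail_rpow (τ := 2 * s - 1) (by linarith)).const_mul
    (c₂ ^ 2 * C₀ * (B + 1))).abs_sum_Ico_le (by linarith)
  have hnoise : ∀ i (n l : ℕ), n ≤ l →
      Integrable (fun ω => |∑ k ∈ Finset.Ico n l,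
        centered μ ξ θ (fun k x y => a k * g x y i) k ω|) P ∧
      ∫ ω, |∑ k ∈ Finset.Ico n l, centered μ ξ θ (fun k x y => a k * g x y i) k ω| ∂P ≤
        √K * ((n : ℝ) + 1) ^ (-(s - 3 / 4)) := by
    intro i n l hnl
    obtain ⟨h1, h2⟩ := M.innovation.integral_sq_sum_centered_le
      (f := fun k x y => a k * g x y i) (hfm i) (hL i) hnl
    have hi := (h1.integrable one_le_two).abs
    refine ⟨hi, ?_⟩
    have h3 := sq_integral_le hi (by simpa only [sq_abs] using h1.integrable_sq)
    simp only [sq_abs] at h3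
    have h4 : ∑ k ∈ Finset.Ico n l, ∫ ω, (a k * g (ξ k ω) (θ k ω) i) ^ 2 ∂P ≤
        K * ((n : ℝ) + 1) ^ (-(2 * s - 1)) :=
      (Finset.sum_le_sum fun k _ => (hint i k).2).trans ((le_abs_self _).trans (hKb n l hnl))
    -- Orthogonality provides the exponent `s - 1 / 2`; only `s - 3 / 4` is needed.
    have h5 : ((n : ℝ) + 1) ^ (-(2 * s - 1)) ≤ (((n : ℝ) + 1) ^ (-(s - 3 / 4))) ^ 2 := by
      rw [← Real.rpow_natCast, ← Real.rpow_mul (by positivity)]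
      refine Real.rpow_le_rpow_of_exponent_le (by simp) ?_
      push_cast; linarith
    refine le_of_sq_le_sq ?_ (by positivity)
    rw [mul_pow, Real.sq_sqrt hK.le]
    exact ((h3.trans h2).trans h4).trans (mul_le_mul_of_nonneg_left h5 hK.le)
  have hgrad : ∀ k, Integrable (fun ω => ‖gradient F (θ k ω)‖) P ∧
      ∫ ω, ‖gradient F (θ k ω)‖ ∂P ≤ √(∫ ω, ‖gradient F (θ k ω)‖ ^ 2 ∂P) := by
    intro k
    have hm : Measurable fun ω => gradient F (θ k ω) :=
      M.measurable_gradient.comp (M.innovation.measurable_state k)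
    have hi := ((memLp_two_iff_integrable_sq_norm hm.aestronglyMeasurable).2
      (M.integrable_sq_gradient k)).integrable one_le_two |>.norm
    exact ⟨hi, Real.le_sqrt_of_sq_le (sq_integral_le hi (M.integrable_sq_gradient k))⟩
  refine ⟨∑ _i : Fin m, √K, by positivity, fun n l hnl => ?_⟩
  have hi1 : Integrable (fun ω => c * ∑ k ∈ Finset.Ico n l, a k * ‖gradient F (θ k ω)‖) P :=
    (integrable_finsetSum _ fun k _ => (hgrad k).1.const_mul _).const_mul _
  have hi2 : Integrable (fun ω => ∑ i, |∑ k ∈ Finset.Ico n l,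
      centered μ ξ θ (fun k x y => a k * g x y i) k ω|) P :=
    integrable_finsetSum _ fun i _ => (hnoise i n l hnl).1
  calc ∫⁻ ω, ‖θ l ω - θ n ω‖ₑ ∂P ≤ ∫⁻ ω, ENNReal.ofReal
        (c * ∑ k ∈ Finset.Ico n l, a k * ‖gradient F (θ k ω)‖ + ∑ i, |∑ k ∈ Finset.Ico n l,
          centered μ ξ θ (fun k x y => a k * g x y i) k ω|) ∂P := by
        refine lintegral_mono fun ω => ?_
        rw [← ofReal_norm]
        exact ENNReal.ofReal_le_ofReal (M.norm_sub_le hnl ω)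
    _ = ENNReal.ofReal (∫ ω, (c * ∑ k ∈ Finset.Ico n l, a k * ‖gradient F (θ k ω)‖ +
          ∑ i, |∑ k ∈ Finset.Ico n l,
          centered μ ξ θ (fun k x y => a k * g x y i) k ω|) ∂P) :=
        (ofReal_integral_eq_lintegral_ofReal (hi1.add hi2) (Eventually.of_forall fun ω =>
          (norm_nonneg _).trans (M.norm_sub_le hnl ω))).symm
    _ ≤ _ := by
        refine ENNReal.ofReal_le_ofReal ?_
        rw [integral_add hi1 hi2, integral_const_mul,
          integral_finsetSum _ fun k _ => (hgrad k).1.const_mul _,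
          integral_finsetSum _ fun i _ => (hnoise i n l hnl).1, Finset.sum_mul]
        refine add_le_add (mul_le_mul_of_nonneg_left (Finset.sum_le_sum fun k _ => ?_) M.hc)
          (Finset.sum_le_sum fun i _ => (hnoise i n l hnl).2)
        rw [integral_const_mul]
        exact mul_le_mul_of_nonneg_left (hgrad k).2 (M.steps.step_pos k).le

/-- Rates of convergence in the mean. -/
lemma exists_lintegral_le (M : MODEL) {θs : Ω → Vec m}
    (hlim : ∀ᵐ ω ∂P, Tendsto (fun n => θ n ω) atTop (𝓝 (θs ω))) {φ : ℕ → ℝ} {X Y B : ℝ}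
    (htail : TailBound a (fun k => √(∫ ω, ‖gradient F (θ k ω)‖ ^ 2 ∂P)) φ X)
    (hφ0 : ∀ n, 0 < φ n) (hφ : ∀ᶠ n in atTop, 1 ≤ φ n) (hYX : Y ≤ X)
    (he : ∀ᶠ n : ℕ in atTop, ((n : ℝ) + 1) ^ (-(s - 3 / 4)) ≤ B * φ n ^ (-Y)) :
    ∃ C > 0, ∀ n, ∫⁻ ω, ‖θ n ω - θs ω‖ₑ ∂P ≤ ENNReal.ofReal (C * φ n ^ (-Y)) := by
  obtain ⟨D, hD0, hD⟩ := M.exists_integral_norm_sub_le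
  obtain ⟨C, N, hC0, hC⟩ := htail
  set x : ℕ → ℝ := fun k => √(∫ ω, ‖gradient F (θ k ω)‖ ^ 2 ∂P) with hx
  have hc := M.hc
  have hax : ∀ k, 0 ≤ a k * x k := fun k => mul_nonneg (M.steps.step_pos k).le (Real.sqrt_nonneg _)
  have hlimit : ∀ (n : ℕ) (R : ℝ), (∀ l, ∑ k ∈ Finset.Ico n l, a k * x k ≤ R) →
      ∫⁻ ω, ‖θ n ω - θs ω‖ₑ ∂P ≤
        ENNReal.ofReal (c * R + D * ((n : ℝ) + 1) ^ (-(s - 3 / 4))) := by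
    intro n R hR
    -- Fatou's lemma passes from mean displacements to the mean distance to the limit.
    have h1 : ∫⁻ ω, ‖θ n ω - θs ω‖ₑ ∂P =
        ∫⁻ ω, liminf (fun l => ‖θ l ω - θ n ω‖ₑ) atTop ∂P := by
      refine lintegral_congr_ae ?_
      filter_upwards [hlim] with ω hω
      have h2 : Tendsto (fun l => ‖θ l ω - θ n ω‖ₑ) atTop (𝓝 ‖θs ω - θ n ω‖ₑ) :=
        (hω.sub_const _).enorm
      rw [h2.liminf_eq, enorm_sub_rev]
    rw [h1]
    refine (lintegral_liminf_le fun l => ((M.innovation.measurable_state l).sub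
      (M.innovation.measurable_state n)).enorm).trans ?_
    refine liminf_le_of_frequently_le' (Eventually.frequently ?_)
    filter_upwards [eventually_ge_atTop n] with l hl
    refine (hD n l hl).trans (ENNReal.ofReal_le_ofReal ?_)
    have := hR l
    gcongr
  -- Finiteness at each fixed `n` makes the final constant valid for all `n`, not only eventually.
  have hfin : ∀ n, ∃ R, 0 ≤ R ∧
      ∫⁻ ω, ‖θ n ω - θs ω‖ₑ ∂P ≤ ENNReal.ofReal (R * φ n ^ (-Y)) := by
    intro n
    have hp : 0 < φ n ^ (-Y) := Real.rpow_pos_of_pos (hφ0 n) _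
    obtain ⟨R, hR0, hR⟩ : ∃ R, 0 ≤ R ∧ ∀ l, ∑ k ∈ Finset.Ico n l, a k * x k ≤ R := by
      have h0 : 0 ≤ ∑ k ∈ Finset.range N, a k * x k := Finset.sum_nonneg fun k _ => hax k
      have h1 : 0 ≤ C * φ N ^ (-X) := mul_nonneg hC0 (Real.rpow_nonneg (hφ0 N).le _)
      refine ⟨∑ k ∈ Finset.range N, a k * x k + C * φ N ^ (-X), by positivity, fun l => ?_⟩
      calc _ ≤ ∑ k ∈ Finset.range N ∪ Finset.Ico N l, a k * x k := by
            refine Finset.sum_le_sum_of_subset_of_nonneg (fun k hk => ?_) fun k _ _ => hax k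
            simp only [Finset.mem_union, Finset.mem_range, Finset.mem_Ico] at hk ⊢
            omega
        _ ≤ ∑ k ∈ Finset.range N, a k * x k + ∑ k ∈ Finset.Ico N l, a k * x k := by
            rw [Finset.sum_union (Finset.disjoint_left.2 fun k h1 h2 => by
              simp only [Finset.mem_range, Finset.mem_Ico] at h1 h2; omega)]
        _ ≤ _ := by gcongr; exact hC N le_rfl l
    refine ⟨(c * R + D * ((n : ℝ) + 1) ^ (-(s - 3 / 4))) / φ n ^ (-Y), by positivity, ?_⟩
    rw [div_mul_cancel₀ _ hp.ne']
    exact hlimit n R hR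
  choose R hR0 hR using hfin
  obtain ⟨N', hN'⟩ := eventually_atTop.1 ((eventually_ge_atTop N).and (hφ.and he))
  have hR0' : 0 ≤ ∑ n ∈ Finset.range N', R n := Finset.sum_nonneg fun n _ => hR0 n
  refine ⟨|c * C + D * B| + ∑ n ∈ Finset.range N', R n + 1, by positivity, fun n => ?_⟩
  have hp : 0 < φ n ^ (-Y) := Real.rpow_pos_of_pos (hφ0 n) _
  rcases lt_or_ge n N' with hn | hn
  · refine (hR n).trans (ENNReal.ofReal_le_ofReal (mul_le_mul_of_nonneg_right ?_ hp.le))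
    have := Finset.single_le_sum (f := R) (fun n _ => hR0 n) (Finset.mem_range.2 hn)
    linarith [abs_nonneg (c * C + D * B)]
  · obtain ⟨h1, h2, h3⟩ := hN' n hn
    refine (hlimit n _ (hC n h1)).trans (ENNReal.ofReal_le_ofReal ?_)
    calc _ ≤ c * (C * φ n ^ (-Y)) + D * (B * φ n ^ (-Y)) := by
          gcongr
      _ = (c * C + D * B) * φ n ^ (-Y) := by ring
      _ ≤ _ := mul_le_mul_of_nonneg_right (by linarith [le_abs_self (c * C + D * B)]) hp.le

end Model

/-- Markov's inequality for the rates. -/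
lemma one_sub_le_of_lintegral_le {Ω : Type*} [MeasurableSpace Ω] {P : Measure Ω}
    [IsProbabilityMeasure P] {E : Type*} [NormedAddCommGroup E] [MeasurableSpace E] [BorelSpace E]
    {v : Ω → E} (hv : Measurable v) {C q δ : ℝ} (hC : 0 < C)
    (hq : 0 < q) (hδ : 0 < δ) (h : ∫⁻ ω, ‖v ω‖ₑ ∂P ≤ ENNReal.ofReal (C * q)) :
    1 - δ ≤ P.real {ω | ‖v ω‖ ≤ C / δ * q} := by
  have hb : 0 < C / δ * q := by positivity
  have hms : MeasurableSet {ω | ‖v ω‖ ≤ C / δ * q} := measurableSet_le hv.norm measurable_const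
  have h1 : P {ω | ‖v ω‖ ≤ C / δ * q}ᶜ ≤ ENNReal.ofReal δ := by
    calc _ ≤ P {ω | ENNReal.ofReal (C / δ * q) ≤ ‖v ω‖ₑ} := by
          refine measure_mono fun ω hω => ?_
          simp only [mem_compl_iff, mem_ofPred_eq, not_le] at hω ⊢
          rw [← ofReal_norm]
          exact ENNReal.ofReal_le_ofReal hω.le
      _ ≤ (∫⁻ ω, ‖v ω‖ₑ ∂P) / ENNReal.ofReal (C / δ * q) :=
          meas_ge_le_lintegral_div hv.enorm.aemeasurable
            (by simpa using hb) ENNReal.ofReal_ne_top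
      _ ≤ ENNReal.ofReal (C * q) / ENNReal.ofReal (C / δ * q) := by gcongr
      _ = ENNReal.ofReal δ := by
          rw [← ENNReal.ofReal_div_of_pos hb]
          congr 1
          field_simp
  have h2 : P.real {ω | ‖v ω‖ ≤ C / δ * q}ᶜ ≤ δ := ENNReal.toReal_le_of_le_ofReal hδ.le h1
  rw [probReal_compl_eq_one_sub hms] at h2
  linarith

end

section

/-! ### The model of the iterates -/

section

variable {Ω E S : Type*} [mΩ : MeasurableSpace Ω] [MeasurableSpace E] [MeasurableSpace S]

/-- The initial value and the first `n` innovations. -/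
def history (Y : Ω → S) (ξ : ℕ → Ω → E) (n : ℕ) (ω : Ω) : S × (Finset.range n → E) :=
  (Y ω, fun j => ξ j ω)

lemma measurable_history {Y : Ω → S} {ξ : ℕ → Ω → E} (hY : Measurable Y)
    (hξ : ∀ n, Measurable (ξ n)) (n : ℕ) : Measurable (history Y ξ n) :=
  hY.prodMk (measurable_pi_lambda _ fun _ => hξ _)

/-- The filtration generated by the histories. -/
def historyFiltration {Y : Ω → S} {ξ : ℕ → Ω → E} (hY : Measurable Y)
    (hξ : ∀ n, Measurable (ξ n)) : Filtration ℕ mΩ where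
  seq n := MeasurableSpace.comap (history Y ξ n) inferInstance
  mono' n l hnl := by
    have hφ : Measurable fun z : S × (Finset.range l → E) =>
        ((z.1, fun j : Finset.range n => z.2 ⟨j, Finset.range_mono hnl j.2⟩) :
          S × (Finset.range n → E)) :=
      measurable_fst.prodMk
        (measurable_pi_lambda _ fun _ => (measurable_pi_apply _).comp measurable_snd)
    exact measurable_iff_comap_le.1 (hφ.comp (comap_measurable (history Y ξ l)))
  le' n := (measurable_history hY hξ n).comap_le

/-- The joint law of `Y`, the first `n` innovations and the next one is a triple product;
associating its factors the other way isolates the last one. -/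
lemma indepFun_history {P : Measure Ω} [IsProbabilityMeasure P] {Y : Ω → S} {ξ : ℕ → Ω → E}
    (hY : Measurable Y) (hξ : ∀ n, Measurable (ξ n)) (hi : iIndepFun ξ P)
    (hYξ : IndepFun Y (fun ω n => ξ n ω) P) (n : ℕ) : IndepFun (history Y ξ n) (ξ n) P := by
  set U : Ω → (Finset.range n → E) := fun ω j => ξ j ω with hU
  have hUm : Measurable U := measurable_pi_lambda _ fun _ => hξ _
  have h1 : IndepFun U (ξ n) P :=
    (hi.indepFun_finset (Finset.range n) {n} (by simp) hξ).comp (φ := id)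
      (ψ := fun v : (({n} : Finset ℕ) → E) => v ⟨n, Finset.mem_singleton_self n⟩) measurable_id
      (measurable_pi_apply _)
  have h2 : IndepFun Y (fun ω => (U ω, ξ n ω)) P :=
    hYξ.comp (φ := id) (ψ := fun v : ℕ → E => ((fun j : Finset.range n => v j), v n))
      measurable_id ((measurable_pi_lambda _ fun _ => measurable_pi_apply _).prodMk
        (measurable_pi_apply _))
  have h3 : IndepFun Y U P := h2.comp (φ := id) (ψ := Prod.fst) measurable_id measurable_fst
  have e1 := (indepFun_iff_map_prod_eq_prod_map_map hUm.aemeasurable (hξ n).aemeasurable).1 h1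
  have e2 := (indepFun_iff_map_prod_eq_prod_map_map hY.aemeasurable
    (hUm.prodMk (hξ n)).aemeasurable).1 h2
  have e3 := (indepFun_iff_map_prod_eq_prod_map_map hY.aemeasurable hUm.aemeasurable).1 h3
  have := Measure.isProbabilityMeasure_map (μ := P) hY.aemeasurable
  have := Measure.isProbabilityMeasure_map (μ := P) hUm.aemeasurable
  have := Measure.isProbabilityMeasure_map (μ := P) (hξ n).aemeasurable
  rw [indepFun_iff_map_prod_eq_prod_map_map (measurable_history hY hξ n).aemeasurable
    (hξ n).aemeasurable]
  change P.map (fun ω => ((Y ω, U ω), ξ n ω)) = (P.map fun ω => (Y ω, U ω)).prod _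
  rw [e3, ← MeasurableEquiv.map_measurableEquiv_injective (MeasurableEquiv.prodAssoc) |>.eq_iff,
    Measure.prodAssoc_prod, ← e1, ← e2,
    Measure.map_map (MeasurableEquiv.measurable _) ((hY.prodMk hUm).prodMk (hξ n))]
  rfl

end

variable {Ω : Type*} [MeasurableSpace Ω] {P : Measure Ω} [IsProbabilityMeasure P] {d m : ℕ}

/-- With `ξ n = Xs (n + 1)`, the iterate at time `n` depends only on the initial value and `ξ 0, …,
ξ (n - 1)`. -/
lemma exists_innovation {X : Ω → Vec d} {g : Vec d → Vec m → Vec m}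
    (hg : Measurable (Function.uncurry g)) {Xs : ℕ → Ω → Vec d}
    (hlaw : ∀ n ≥ 1, IdentDistrib (Xs n) X P P) (hmeas : ∀ n ≥ 1, Measurable (Xs n))
    (hindep : iIndepFun (fun n : ℕ => Xs (n + 1)) P) {θ₀ : Ω → Vec m} (hθ₀ : Measurable θ₀)
    (hθ₀i : IndepFun θ₀ (fun ω (n : ℕ) => Xs (n + 1) ω) P) (γ : ℕ → ℝ) :
    ∃ ℱ, Innovation P ℱ (fun n => Xs (n + 1)) (sgd γ g Xs θ₀) (P.map X) := by
  have hξ : ∀ n, Measurable (Xs (n + 1)) := fun n => hmeas _ (by omega)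
  have hpast : ∀ n, Measurable[historyFiltration hθ₀ hξ (n + 1)] (Xs (n + 1)) := fun n => by
    have hφ : Measurable fun z : Vec m × (Finset.range (n + 1) → Vec d) =>
        z.2 ⟨n, Finset.self_mem_range_succ n⟩ := (measurable_pi_apply _).comp measurable_snd
    exact hφ.comp (comap_measurable (history θ₀ (fun n => Xs (n + 1)) (n + 1)))
  refine ⟨historyFiltration hθ₀ hξ, hξ, fun n => (hlaw _ (by omega)).map_eq,
    fun n => indepFun_history hθ₀ hξ hindep hθ₀i n, fun n => ?_, hpast⟩
  induction n with
  | zero => exact measurable_fst.comp (comap_measurable (history θ₀ (fun n => Xs (n + 1)) 0))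
  | succ n ih =>
    have h1 : Measurable[historyFiltration hθ₀ hξ (n + 1)] (sgd γ g Xs θ₀ n) :=
      ih.mono ((historyFiltration hθ₀ hξ).mono n.le_succ) le_rfl
    exact h1.sub ((hg.comp ((hpast n).prodMk h1)).const_smul (γ (n + 1)))

lemma exists_model {X : Ω → Vec d} (hX : Measurable X) {F : Vec m → ℝ}
    {g : Vec d → Vec m → Vec m}
    (hg : Measurable (Function.uncurry g)) {Xs : ℕ → Ω → Vec d}
    (hlaw : ∀ n ≥ 1, IdentDistrib (Xs n) X P P) (hmeas : ∀ n ≥ 1, Measurable (Xs n))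
    (hindep : iIndepFun (fun n : ℕ => Xs (n + 1)) P) {θ₀ : Ω → Vec m} (hθ₀ : Measurable θ₀)
    (hθ₀L : MemLp θ₀ 2 P)
    (hθ₀i : IndepFun θ₀ (fun ω (n : ℕ) => Xs (n + 1) ω) P) {γ : ℕ → ℝ} {L α C₀ κ c ρ s : ℝ}
    (hL : 0 < L) (hsmooth : HolderSmooth F L α) (hC1 : ContDiff ℝ 1 F) (hC₀ : 0 < C₀)
    (hκ : 0 < κ) (hc : 0 ≤ c) (ho : OracleCondition P X g F C₀ κ c) (hγ : ∀ n ≥ 1, 0 < γ n)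
    (htheta : IsTheta atTop γ (fun n : ℕ => (n : ℝ) ^ (-s))) (hE : Exponents α ρ s) :
    ∃ ℱ c₁ c₂, Model P ℱ (fun n => Xs (n + 1)) (sgd γ g Xs θ₀) (P.map X) g F
      (fun k => γ (k + 1)) L α C₀ κ c s c₁ c₂ := by
  obtain ⟨ℱ, hℱ⟩ := exists_innovation hg hlaw hmeas hindep hθ₀ hθ₀i γ
  obtain ⟨c₁, c₂, hb⟩ := exists_stepBounds hγ htheta
  have hgy : ∀ y, Measurable fun x => g x y := fun y =>
    hg.comp (measurable_id.prodMk measurable_const)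
  have hmean : ∀ y, ∫ x, g x y ∂(P.map X) = meanOracle P X g y := fun y =>
    integral_map hX.aemeasurable (hgy y).aestronglyMeasurable
  refine ⟨ℱ, c₁, c₂, hℱ, hE.hα, hL, hC₀, hκ, hc, hE.three_fourths_lt, hE.le_one, hE.two_lt_mul,
    hsmooth, hC1, hg, fun k ω => rfl, fun y => ?_, fun y => ?_, fun y => ?_, fun y => ?_, hθ₀L, hb⟩
  · exact (memLp_map_measure_iff (hgy y).aestronglyMeasurable hX.aemeasurable).2 (ho y).1
  · rw [integral_map hX.aemeasurable ((hgy y).norm.pow_const 2).aestronglyMeasurable]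
    exact (ho y).2.1
  · rw [hmean]; exact (ho y).2.2.1
  · rw [hmean]; exact (ho y).2.2.2

lemma tendsto_sum_steps {γ : ℕ → ℝ} (h : Tendsto (stepSum γ) atTop atTop) :
    Tendsto (fun n => ∑ k ∈ Finset.range n, γ (k + 1)) atTop atTop := by
  refine h.congr fun n => ?_
  rw [stepSum, Finset.range_eq_Ico, Finset.sum_Ico_add' γ 0 n 1, zero_add]
  rfl

/-! ### Almost sure convergence and local rates -/

/-- Continuity of the measure from below; the room `δ - ε` is what the passage to a finite index
costs. -/
lemma exists_forall_le_measureReal {A : ℕ → Set Ω} {S : Set Ω} (hA : Monotone A) {ε δ : ℝ}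
    (hεδ : ε < δ) (hS : 1 - ε ≤ P.real S) (h : ∀ᵐ ω ∂P, ω ∈ S → ∃ k, ω ∈ A k) :
    ∃ K, ∀ k ≥ K, 1 - δ ≤ P.real (A k) := by
  have h1 : P S ≤ P (⋃ k, A k) := measure_mono_ae (h.mono fun ω hω hS => mem_iUnion.2 (hω hS))
  have h2 : Tendsto (fun k => P.real (A k)) atTop (𝓝 (P.real (⋃ k, A k))) :=
    (ENNReal.tendsto_toReal (measure_ne_top _ _)).comp (tendsto_measure_iUnion_atTop hA)
  have h3 : P.real S ≤ P.real (⋃ k, A k) := ENNReal.toReal_mono (measure_ne_top _ _) h1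
  obtain ⟨K, hK⟩ := eventually_atTop.1
    (h2.eventually (lt_mem_nhds (show 1 - δ < P.real (⋃ k, A k) by linarith)))
  exact ⟨K, fun k hk => (hK k hk).le⟩

/-- A random constant that is almost surely finite on `S` is below a fixed integer except on a part
of `S` of small probability; the same integer serves all `n`. -/
lemma exists_rate_of_ae {err : ℕ → Ω → ℝ} {q : ℕ → ℝ} (hq : ∀ n, 0 ≤ q n) {S : Set Ω} {ε δ : ℝ}
    (hεδ : ε < δ) (hS : 1 - ε ≤ P.real S)
    (h : ∀ᵐ ω ∂P, ω ∈ S → ∃ C, ∀ n, err n ω ≤ C * q n) :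
    ∃ C > 0, ∀ n, 1 - δ ≤ P.real {ω | err n ω ≤ C * q n} := by
  obtain ⟨K, hK⟩ := exists_forall_le_measureReal (A := fun k : ℕ => {ω | ∀ n, err n ω ≤ k * q n})
    (fun k l hkl ω hω n => (hω n).trans
      (mul_le_mul_of_nonneg_right (by exact_mod_cast hkl) (hq n))) hεδ hS (by
    filter_upwards [h] with ω hω hωS
    obtain ⟨C, hC⟩ := hω hωS
    obtain ⟨k, hk⟩ := exists_nat_ge C
    exact ⟨k, fun n => (hC n).trans (mul_le_mul_of_nonneg_right hk (hq n))⟩)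
  refine ⟨(K + 1 : ℕ), by positivity, fun n => (hK (K + 1) (by omega)).trans ?_⟩
  exact measureReal_mono (fun ω hω => hω n) (measure_ne_top _ _)

namespace Model

variable {ℱ : Filtration ℕ ‹MeasurableSpace Ω›} {ξ : ℕ → Ω → Vec d} {θ : ℕ → Ω → Vec m}
  {μ : Measure (Vec d)} {g : Vec d → Vec m → Vec m} {F : Vec m → ℝ} {a : ℕ → ℝ}
  {L α C₀ κ c s c₁ c₂ : ℝ}

local notation "MODEL" => Model P ℱ ξ θ μ g F a L α C₀ κ c s c₁ c₂

/-- Almost every path satisfies the hypotheses of `exists_tendsto_critical`; the pathwise limits are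
then represented by a measurable map. -/
lemma exists_limit (M : MODEL) (hco : Coercive F) (hLoj : Lojasiewicz F)
    (hsum : Tendsto (fun n => ∑ k ∈ Finset.range n, a k) atTop atTop) :
    ∃ θs : Ω → Vec m, Measurable θs ∧ ∀ᵐ ω ∂P,
      Tendsto (fun n => θ n ω) atTop (𝓝 (θs ω)) ∧ gradient F (θs ω) = 0 := by
  have hs := M.hs
  have hs1 := M.hs1
  have h : ∀ᵐ ω ∂P, ∃ θs, Tendsto (fun n => θ n ω) atTop (𝓝 θs) ∧ gradient F θs = 0 := by
    filter_upwards [M.ae_path hco (by linarith [M.sub_lt]) (min_le_left _ _) (min_le_right _ _)]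
      with ω ⟨e, he, hdesc, hbdd, D, hD, hmove⟩
    exact exists_tendsto_critical hLoj M.steps (by linarith) hs1 M.sub_lt M.hκ M.hc
      (by linarith) hsum hdesc he hbdd hmove
  obtain ⟨θs, hθs, hlim⟩ := measurable_limit_of_tendsto_metrizable_ae
    (fun n => (M.innovation.measurable_state n).aemeasurable)
    (h.mono fun ω ⟨l, hl, _⟩ => ⟨l, hl⟩)
  refine ⟨θs, hθs, ?_⟩
  filter_upwards [h, hlim] with ω ⟨l, hl, hc⟩ hω
  exact ⟨hω, tendsto_nhds_unique hl hω ▸ hc⟩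

/-- Rates in probability from tail bounds along the trajectories. -/
lemma exists_rate_of_tailBound (M : MODEL) (hco : Coercive F) {θs : Ω → Vec m}
    (hlim : ∀ᵐ ω ∂P, Tendsto (fun n => θ n ω) atTop (𝓝 (θs ω)) ∧ gradient F (θs ω) = 0)
    {φ : ℕ → ℝ} {X Y B ε δ : ℝ} {S : Set Ω} (hεδ : ε < δ) (hS : 1 - ε ≤ P.real S)
    (htail : ∀ ω ∈ S, ∀ e, HasTail e (min (s / 2) ((1 + α) * s - 1)) →
      (∀ k, F (θ (k + 1) ω) ≤ F (θ k ω) - κ * (a k * ‖gradient F (θ k ω)‖ ^ 2) + e k) →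
      Tendsto (fun n => θ n ω) atTop (𝓝 (θs ω)) → gradient F (θs ω) = 0 →
      TailBound a (fun k => ‖gradient F (θ k ω)‖) φ X)
    (hφ0 : ∀ n, 0 < φ n) (hφ : ∀ᶠ n in atTop, 1 ≤ φ n) (hYX : Y ≤ X)
    (he : ∀ᶠ n : ℕ in atTop, ((n : ℝ) + 1) ^ (-(s - 3 / 4)) ≤ B * φ n ^ (-Y)) :
    ∃ C > 0, ∀ n, 1 - δ ≤ P.real {ω | ‖θ n ω - θs ω‖ ≤ C * φ n ^ (-Y)} := by
  have hp : ∀ n, 0 < φ n ^ (-Y) := fun n => Real.rpow_pos_of_pos (hφ0 n) _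
  refine exists_rate_of_ae (fun n => (hp n).le) hεδ hS ?_
  filter_upwards [M.ae_path hco (by linarith [M.sub_lt, M.hs1]) (min_le_left _ _)
    (min_le_right _ _), hlim] with ω ⟨e, het, hdesc, _, D, hD, hmove⟩ ⟨h1, h2⟩ hωS
  have h3 := (htail ω hωS e het hdesc h1 h2).norm_sub_le h1 M.hc hD hmove hφ hYX he
  obtain ⟨C, hC⟩ := (isBigO_nat_atTop_iff fun n h => absurd h (hp n).ne').1 h3
  exact ⟨C, fun n => by simpa only [Real.norm_of_nonneg (hp n).le] using hC n⟩

end Model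

end

section

/-! ### Families of rates -/

lemma LocalRates.of_imp {Ω : Type*} [MeasurableSpace Ω]
    {P : Measure Ω} {err : ℕ → Ω → ℝ} {α s ρ δ β K : ℝ} {p q : Prop}
    (h : LocalRates P err α s ρ δ β K p) (hpq : q → p) : LocalRates P err α s ρ δ β K q :=
  ⟨fun hβ hq => h.1 hβ (hpq hq), h.2⟩

variable {Ω : Type*} [MeasurableSpace Ω] {P : Measure Ω} [IsProbabilityMeasure P] {d m : ℕ}

lemma rateFamily_pow {err : ℕ → Ω → ℝ} {δ K σ e : ℝ} (hK : 0 < K) (he : 0 ≤ e) (hσ0 : 0 ≤ σ)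
    (hσ1 : σ < 1)
    (h : ∀ n : ℕ, 1 - δ ≤ P.real {ω | err n ω ≤ K * ((n : ℝ) + 1) ^ (-(e * (1 - σ)))}) :
    RateFamily P err δ K σ e 1 (fun n => (n : ℝ)) :=
  rateFamily_of_forall hK.le he hσ0 hσ1 (fun n _ => by positivity)
    (fun _ hx0 hx _ hn => add_one_rpow_neg_le hx0 hx hn) fun n _ => h n

lemma rateFamily_log {err : ℕ → Ω → ℝ} {δ K σ e : ℝ} (hK : 0 < K) (he : 0 ≤ e) (hσ0 : 0 ≤ σ)
    (hσ1 : σ < 1)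
    (h : ∀ n : ℕ, 1 - δ ≤ P.real {ω | err n ω ≤ K * Real.log ((n : ℝ) + 2) ^ (-(e * (1 - σ)))}) :
    RateFamily P err δ K σ e 2 (fun n => Real.log n) :=
  rateFamily_of_forall hK.le he hσ0 hσ1
    (fun n _ => Real.rpow_nonneg (Real.log_nonneg (by linarith [n.cast_nonneg (α := ℝ)])) _)
    (fun _ hx0 hx _ hn => log_add_two_rpow_neg_le hx0 hx hn) fun n _ => h n

lemma log_add_two_pos (n : ℕ) : 0 < Real.log ((n : ℝ) + 2) :=
  Real.log_pos (by linarith [n.cast_nonneg (α := ℝ)])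

lemma eventually_one_le_log : ∀ᶠ n : ℕ in atTop, 1 ≤ Real.log ((n : ℝ) + 2) :=
  eventually_atTop.2 ⟨1, fun n hn => isClock_log.one_le n hn⟩

lemma eventually_pow_le {x Y : ℝ} (h : Y ≤ x) :
    ∀ᶠ n : ℕ in atTop, ((n : ℝ) + 1) ^ (-x) ≤ 1 * ((n : ℝ) + 1) ^ (-Y) :=
  Eventually.of_forall fun n => by
    rw [one_mul]
    exact Real.rpow_le_rpow_of_exponent_le (by simp) (by linarith)

namespace Model

variable {ℱ : Filtration ℕ ‹MeasurableSpace Ω›} {ξ : ℕ → Ω → Vec d} {θ : ℕ → Ω → Vec m}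
  {μ : Measure (Vec d)} {g : Vec d → Vec m → Vec m} {F : Vec m → ℝ} {a : ℕ → ℝ}
  {L α C₀ κ c s c₁ c₂ : ℝ}

local notation "MODEL" => Model P ℱ ξ θ μ g F a L α C₀ κ c s c₁ c₂

theorem localRates (M : MODEL) (hco : Coercive F) {θs : Ω → Vec m}
    (hlim : ∀ᵐ ω ∂P, Tendsto (fun n => θ n ω) atTop (𝓝 (θs ω)) ∧ gradient F (θs ω) = 0)
    {ρ γs ℓ β ζ ε δ : ℝ} (hE : Exponents α ρ s) (hεδ : ε < δ)
    (hS : 1 - ε ≤ P.real {ω | F (θs ω) ≤ ℓ}) (hβ : β ∈ Ioo (0 : ℝ) 1) (hζ : 0 < ζ)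
    (hU : UniformLojasiewiczOn F (sublevel F ℓ) β ζ)
    (hγs : s = 1 → Tendsto (fun k : ℕ => ((k : ℝ) + 1) * a k) atTop (𝓝 γs)) :
    ∃ C > 0, LocalRates P (fun n ω => ‖θ n ω - θs ω‖) α s ρ δ β C
      (s = 1 → ζ ^ (1 / β) * max α (1 / 2) < κ * γs) := by
  have hs := M.hs
  have hs1 := M.hs1
  have htail := fun (ω : Ω) (hω : F (θs ω) ≤ ℓ) e
      (he : HasTail e (min (s / 2) ((1 + α) * s - 1)))
      (hdesc : ∀ k, F (θ (k + 1) ω) ≤ F (θ k ω) - κ * (a k * ‖gradient F (θ k ω)‖ ^ 2) + e k)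
      (h1 : Tendsto (fun n => θ n ω) atTop (𝓝 (θs ω))) (h2 : gradient F (θs ω) = 0) =>
    tailBounds_of_lojasiewicz (g := γs) M.contDiff M.steps (by linarith) hs1 M.sub_lt M.hκ hdesc
      he h1 h2 hβ hζ (hU.eventually hω h2)
  rcases le_or_gt β (1 / 2) with hβ2 | hβ2
  -- The constant has to be produced before the condition on the steps is assumed; when the
  -- condition fails, any constant will do.
  · by_cases hsmall : s = 1 → ζ ^ (1 / β) * max α (1 / 2) < κ * γs
    · obtain ⟨hσ0, hσ1, he, hY1, hY2⟩ := hE.local_linear rfl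
      obtain ⟨C, hC, h⟩ := M.exists_rate_of_tailBound hco hlim
        (φ := fun n : ℕ => (n : ℝ) + 1) hεδ hS
        (fun ω hω e he hd h1 h2 => (htail ω hω e he hd h1 h2).1 hβ2 fun h => ⟨hγs h, by
          have h3 := hsmall h
          have h4 : min (s / 2) ((1 + α) * s - 1) ≤ max α (1 / 2) := by
            refine (min_le_right _ _).trans (le_trans (le_of_eq ?_) (le_max_left _ _))
            rw [h]; ring
          rw [div_mul_eq_mul_div, lt_div_iff₀ (Real.rpow_pos_of_pos hζ _), mul_comm]
          exact (mul_le_mul_of_nonneg_left h4 (Real.rpow_nonneg hζ.le _)).trans_lt h3⟩)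
        (fun n => by positivity) (Eventually.of_forall fun n => by simp) hY2
        (eventually_pow_le hY1)
      exact ⟨C, hC, fun _ _ => rateFamily_pow hC he hσ0 hσ1 h, fun h => absurd hβ2 h.not_ge,
        fun h => absurd hβ2 h.not_ge⟩
    · exact ⟨1, one_pos, fun _ h => absurd h hsmall, fun h => absurd hβ2 h.not_ge,
        fun h => absurd hβ2 h.not_ge⟩
  · have hr := hE.one_lt_rLocal hβ2 hβ.2
    have hrβ : rLocal α ρ β ≤ 1 / (2 * β - 1) := min_le_left _ _
    rcases hs1.lt_or_eq with hs' | hs'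
    · obtain ⟨hσ0, hσ1, he, hY1, hY2⟩ := hE.pow_case hr rfl hrβ
        (Or.inr ⟨rfl, (min_le_right _ _).trans (min_le_right _ _)⟩)
      obtain ⟨C, hC, h⟩ := M.exists_rate_of_tailBound hco hlim
        (φ := fun n : ℕ => (n : ℝ) + 1) hεδ hS
        (fun ω hω e he hd h1 h2 => (htail ω hω e he hd h1 h2).2.1 hβ2 hs')
        (fun n => by positivity) (Eventually.of_forall fun n => by simp) hY2
        (eventually_pow_le hY1)
      exact ⟨C, hC, fun h => absurd hβ2 h.not_gt,
        fun _ _ => ⟨hr, rateFamily_pow hC he hσ0 hσ1 h⟩, fun _ h => absurd h hs'.ne⟩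
    · obtain ⟨hσ0, hσ1, hY1, hY2⟩ := Exponents.log_case hr hrβ
      -- The noise tail is a power of `n`, negligible on the logarithmic clock, which is why neither
      -- `sigmaBase` nor `expBase` appears in this rate.
      obtain ⟨B, -, hB⟩ := exists_rpow_neg_le_log (τ := s - 3 / 4)
        (w := rLocal α ρ β * (1 - (1 + rLocal α ρ β) / (2 * rLocal α ρ β))) (by linarith)
        (by rw [hY1]; linarith)
      obtain ⟨C, hC, h⟩ := M.exists_rate_of_tailBound hco hlim
        (φ := fun n : ℕ => Real.log ((n : ℝ) + 2)) hεδ hS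
        (fun ω hω e he hd h1 h2 => (htail ω hω e he hd h1 h2).2.2 hβ2 hs')
        log_add_two_pos eventually_one_le_log (hY1.trans_le hY2) (Eventually.of_forall hB)
      exact ⟨C, hC, fun h => absurd hβ2 h.not_gt, fun _ h => absurd hs' h.ne,
        fun _ _ => ⟨hr, rateFamily_log hC (by linarith) hσ0 hσ1 h⟩⟩

/-- The rates are proved for the mean distance, with a constant that does not involve `δ`, and
Markov's inequality converts them for all `δ` at once. -/
theorem globalRates (M : MODEL) {θs : Ω → Vec m} (hθs : Measurable θs)
    (hlim : ∀ᵐ ω ∂P, Tendsto (fun n => θ n ω) atTop (𝓝 (θs ω)))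
    {ρ γs β ζ : ℝ} (hE : Exponents α ρ s) (hβ : β ∈ Ioo (α / (1 + α)) 1 ∪ {1 / 2}) (hζ : 0 < ζ)
    (hG : GlobalLojasiewiczIneq F β ζ)
    (hγs : s = 1 → Tendsto (fun k : ℕ => ((k : ℝ) + 1) * a k) atTop (𝓝 γs)) :
    ∃ C > 0, ∀ δ ∈ Ioo (0 : ℝ) 1, GlobalRates P (fun n ω => ‖θ n ω - θs ω‖) α s ρ δ β (C / δ)
      (s = 1 → ζ ^ (2 + lam α β * ((1 + α) / α)) *
        ((1 + α) * L ^ (1 / α) / α) ^ lam α β * α < κ * γs) := by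
  have hs := M.hs
  have hs1 := M.hs1
  have hα := M.hα.1
  have hL := M.hL
  have hβ1 : β < 1 := by
    rcases hβ with h | h
    · exact h.2
    · rw [mem_singleton_iff] at h; rw [h]; norm_num
  have hmarkov : ∀ {C q : ℝ} {δ : ℝ} {n : ℕ}, 0 < C → 0 < q → δ ∈ Ioo (0 : ℝ) 1 →
      ∫⁻ ω, ‖θ n ω - θs ω‖ₑ ∂P ≤ ENNReal.ofReal (C * q) →
      1 - δ ≤ P.real {ω | ‖θ n ω - θs ω‖ ≤ C / δ * q} := fun {C q δ n} hC hq hδ h =>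
    one_sub_le_of_lintegral_le ((M.innovation.measurable_state n).sub hθs) hC hq hδ.1 h
  have hpow : ∀ (n : ℕ) (Y : ℝ), 0 < ((n : ℝ) + 1) ^ Y := fun n Y => by positivity
  obtain ⟨hlin, htail⟩ := M.tailBounds_mean
  rcases le_or_gt β (1 / 2) with hβ2 | hβ2
  · by_cases hsmall : s = 1 → ζ ^ (2 + lam α β * ((1 + α) / α)) *
        ((1 + α) * L ^ (1 / α) / α) ^ lam α β * α < κ * γs
    · have hσ1 := hE.sigmaBase_lt_one
      have hσ0 : 0 ≤ sigmaBase α s := by linarith [hE.half_le_sigmaBase]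
      have he : 0 ≤ min (α * s) (expBase α s) :=
        le_min (mul_nonneg hα.le (by linarith)) hE.expBase_nonneg
      obtain ⟨hY1, hY2⟩ := hE.expBase_mul_le le_rfl hσ1 (min_le_right (α * s) _)
      have hQ : 0 < ζ ^ (2 + lam α β * ((1 + α) / α)) *
          ((1 + α) * L ^ (1 / α) / α) ^ lam α β := by positivity
      obtain ⟨C, hC, h⟩ := M.exists_lintegral_le hlim
        (hlin _ γs hQ (hG.le_mul_sq M.smooth M.hα hL hζ hβ hβ2) fun h => ⟨hγs h, by
          rw [div_mul_eq_mul_div, lt_div_iff₀ hQ, mul_comm]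
          exact hsmall h⟩)
        (fun n => by positivity) (Eventually.of_forall fun n => by simp) hY2
        (eventually_pow_le hY1)
      exact ⟨C, hC, fun δ hδ => ⟨fun _ _ => rateFamily_pow (div_pos hC hδ.1) he hσ0 hσ1
        fun n => hmarkov hC (hpow n _) hδ (h n), fun h => absurd hβ2 h.not_ge,
        fun h => absurd hβ2 h.not_ge⟩⟩
    · exact ⟨1, one_pos, fun δ _ => ⟨fun _ h => absurd h hsmall, fun h => absurd hβ2 h.not_ge,
        fun h => absurd hβ2 h.not_ge⟩⟩
  · have hr := hE.one_lt_rGlobal hβ2 hβ1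
    have hrβ : rGlobal α ρ β ≤ 1 / (2 * β - 1) := min_le_left _ _
    obtain ⟨htail1, htail2⟩ := htail β ζ hβ2 hβ1 hζ hG
    rcases hs1.lt_or_eq with hs' | hs'
    · obtain ⟨hσ0, hσ1, he, hY1, hY2⟩ := hE.pow_case hr rfl hrβ (Or.inl rfl)
      obtain ⟨C, hC, h⟩ := M.exists_lintegral_le hlim (htail1 hs')
        (fun n => by positivity) (Eventually.of_forall fun n => by simp) hY2
        (eventually_pow_le hY1)
      exact ⟨C, hC, fun δ hδ => ⟨fun h => absurd hβ2 h.not_gt,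
        fun _ _ => ⟨hr, rateFamily_pow (div_pos hC hδ.1) he hσ0 hσ1
          fun n => hmarkov hC (hpow n _) hδ (h n)⟩, fun _ h => absurd h hs'.ne⟩⟩
    · obtain ⟨hσ0, hσ1, hY1, hY2⟩ := Exponents.log_case hr hrβ
      obtain ⟨B, -, hB⟩ := exists_rpow_neg_le_log (τ := s - 3 / 4)
        (w := rGlobal α ρ β * (1 - (1 + rGlobal α ρ β) / (2 * rGlobal α ρ β))) (by linarith)
        (by rw [hY1]; linarith)
      obtain ⟨C, hC, h⟩ := M.exists_lintegral_le hlim (htail2 hs') log_add_two_pos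
        eventually_one_le_log (hY1.trans_le hY2) (Eventually.of_forall hB)
      exact ⟨C, hC, fun δ hδ => ⟨fun h => absurd hβ2 h.not_gt, fun _ h => absurd hs' h.ne,
        fun _ _ => ⟨hr, rateFamily_log (div_pos hC hδ.1) (by linarith) hσ0 hσ1
          fun n => hmarkov hC (Real.rpow_pos_of_pos (log_add_two_pos n) _) hδ (h n)⟩⟩⟩

/-- The limit lies in a sublevel set with high probability. -/
lemma exists_level (θs : Ω → Vec m) {ε : ℝ} (hε : 0 < ε) :
    ∃ ℓ > ⨅ y, F y, 1 - ε ≤ P.real {ω | F (θs ω) ≤ ℓ} := by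
  obtain ⟨K, hK⟩ := exists_forall_le_measureReal (P := P) (S := univ)
    (A := fun k : ℕ => {ω | F (θs ω) ≤ k})
    (fun k l hkl ω hω => le_trans (show F (θs ω) ≤ k from hω) (by exact_mod_cast hkl)) hε
    (by simp) (Eventually.of_forall fun ω _ => exists_nat_ge (F (θs ω)))
  obtain ⟨N, hN⟩ := exists_nat_gt (⨅ y, F y)
  exact ⟨(max K N : ℕ), hN.trans_le (by exact_mod_cast le_max_right K N), hK _ (le_max_left _ _)⟩

end Model

lemma accPoints_eq_singleton {u : ℕ → Vec m} {x : Vec m} (h : Tendsto u atTop (𝓝 x)) :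
    accPoints u = {x} := by
  ext y
  refine ⟨fun hy => ?_, fun hy => ?_⟩
  · by_contra hne
    exact (hy.neBot.mono (inf_le_inf_left _ h)).ne
      (disjoint_nhds_nhds.2 (show y ≠ x from hne)).eq_bot
  · rw [mem_singleton_iff.1 hy]
    exact h.mapClusterPt

end

end BiasedSGD
end

/-! ### Assembly of the theorem -/

open BiasedSGD

theorem mainTheorem8 {Ω : Type*} [MeasurableSpace Ω] (P : Measure Ω) [IsProbabilityMeasure P]
    {d m : ℕ} (hd : 1 ≤ d) (hm : 1 ≤ m)
    -- the optimization problem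
    (X : Ω → BiasedSGD.Vec d) (hX : Measurable X)
    (f : BiasedSGD.Vec d → BiasedSGD.Vec m → ℝ)
    (hf : ∀ θ, Integrable (fun ω => f (X ω) θ) P)
    (F : BiasedSGD.Vec m → ℝ) (hF : F = BiasedSGD.objective P X f)
    -- the oracle, the innovations, the initialization, the steps
    (g : BiasedSGD.Vec d → BiasedSGD.Vec m → BiasedSGD.Vec m)
    (hg : Measurable (Function.uncurry g))
    (Xs : ℕ → Ω → BiasedSGD.Vec d)
    (hXs_law : ∀ n ≥ 1, IdentDistrib (Xs n) X P P)
    (hXs_meas : ∀ n ≥ 1, Measurable (Xs n))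
    (hXs_indep : iIndepFun (fun n : ℕ => Xs (n + 1)) P)
    (θ₀ : Ω → BiasedSGD.Vec m) (hθ₀_meas : Measurable θ₀) (hθ₀ : MemLp θ₀ 2 P)
    (hθ₀_indep : IndepFun θ₀ (fun ω (n : ℕ) => Xs (n + 1) ω) P)
    (γ : ℕ → ℝ)
    -- the assumptions
    (L α : ℝ) (hL : 0 < L) (hα : α ∈ Ioc (0 : ℝ) 1)
    (hsmooth : BiasedSGD.HolderSmooth F L α)
    (C₀ κ c : ℝ) (hC₀ : 0 < C₀) (hκ : 0 < κ) (hκc : κ ≤ c)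
    (horacle : BiasedSGD.OracleCondition P X g F C₀ κ c)
    (hγ : BiasedSGD.StepSummability γ α)
    (hcoercive : BiasedSGD.Coercive F)
    (hLoj : BiasedSGD.Lojasiewicz F)
    (γs ρ s : ℝ) (hγs : 0 < γs)
    (hreg : BiasedSGD.StepRegularity γ γs ρ)
    (htheta : IsTheta atTop γ (fun n : ℕ => (n : ℝ) ^ (-s)))
    (hρ : max 3 (2 / α) < ρ) (hs : s ∈ Icc (ρ / (1 + ρ)) 1)
    (hκγ : s = 1 → max (1 / 2) α < κ * γs) :
    ∃ θs : Ω → BiasedSGD.Vec m, Measurable θs ∧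
      (∀ᵐ ω ∂P,
        Tendsto (fun n => BiasedSGD.sgd γ g Xs θ₀ n ω) atTop (𝓝 (θs ω)) ∧
        gradient F (θs ω) = 0 ∧
        Tendsto (fun n => F (BiasedSGD.sgd γ g Xs θ₀ n ω)) atTop (𝓝 (F (θs ω)))) ∧
      -- the local case
      (∀ δ ∈ Ioo (0 : ℝ) 1, ∃ ℓ > ⨅ θ, F θ,
        1 - δ ≤ P.real {ω | BiasedSGD.accPoints (fun n => BiasedSGD.sgd γ g Xs θ₀ n ω) ⊆
          BiasedSGD.sublevel F ℓ} ∧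
        -- a
        (∃ β ∈ Ioo (0 : ℝ) 1, ∃ ζ > 0,
          BiasedSGD.UniformLojasiewiczOn F (BiasedSGD.sublevel F ℓ) β ζ) ∧
        (∀ β ∈ Ioo (0 : ℝ) 1, ∀ ζ > 0,
          BiasedSGD.UniformLojasiewiczOn F (BiasedSGD.sublevel F ℓ) β ζ →
          ∃ C > 0, BiasedSGD.LocalRates P
            (fun n ω => ‖BiasedSGD.sgd γ g Xs θ₀ n ω - θs ω‖) α s ρ δ β C
            (s = 1 → ζ ^ (1 / β) * max α (1 / 2) < κ * γs)) ∧
        -- b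
        (∃ β ∈ Ioo (0 : ℝ) 1,
          BiasedSGD.UniformLojasiewiczOn F (BiasedSGD.sublevel F ℓ) β 1) ∧
        (∀ β ∈ Ioo (0 : ℝ) 1,
          BiasedSGD.UniformLojasiewiczOn F (BiasedSGD.sublevel F ℓ) β 1 →
          ∃ C > 0, BiasedSGD.LocalRates P
            (fun n ω => ‖BiasedSGD.sgd γ g Xs θ₀ n ω - θs ω‖) α s ρ δ β C True)) ∧
      -- the global case
      (BiasedSGD.GloballyLojasiewicz F →
        (∃ β ∈ Ico (α / (1 + α)) 1, ∃ ζ > 0, BiasedSGD.GlobalLojasiewiczIneq F β ζ) ∧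
        (∀ β ∈ Ioo (α / (1 + α)) 1 ∪ {1 / 2}, ∀ ζ > 0,
          BiasedSGD.GlobalLojasiewiczIneq F β ζ →
          ∃ C > 0, ∀ δ ∈ Ioo (0 : ℝ) 1, BiasedSGD.GlobalRates P
            (fun n ω => ‖BiasedSGD.sgd γ g Xs θ₀ n ω - θs ω‖) α s ρ δ β (C / δ)
            (s = 1 →
              ζ ^ (2 + BiasedSGD.lam α β * ((1 + α) / α)) *
                ((1 + α) * L ^ (1 / α) / α) ^ BiasedSGD.lam α β * α < κ * γs))) := by
  have hE := exponents hα hρ hs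
  have hc : 0 ≤ c := hκ.le.trans hκc
  obtain ⟨ℱ, c₁, c₂, M⟩ := exists_model hX hg hXs_law hXs_meas hXs_indep hθ₀_meas hθ₀ hθ₀_indep
    hL hsmooth hLoj.1 hC₀ hκ hc horacle hγ.1 htheta hE
  obtain ⟨θs, hθs, hlim⟩ := M.exists_limit hcoercive hLoj (tendsto_sum_steps hγ.2.1)
  have hstep : s = 1 → Tendsto (fun k : ℕ => ((k : ℝ) + 1) * γ (k + 1)) atTop (𝓝 γs) := by
    rintro rfl
    exact tendsto_mul_step hγs hreg.1 M.steps
  refine ⟨θs, hθs, hlim.mono fun ω h => ⟨h.1, h.2, (M.continuous.tendsto _).comp h.1⟩,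
    fun δ hδ => ?_, fun hG => ⟨hG.exists_ineq hm hsmooth hα hL hcoercive, fun β hβ ζ hζ h => ?_⟩⟩
  -- Half of `δ` is spent on keeping the limit in a sublevel set, the other half on making the
  -- random constant deterministic.
  · have hδ2 : 0 < δ / 2 := half_pos hδ.1
    obtain ⟨ℓ, hℓ, hS⟩ := Model.exists_level (P := P) (F := F) θs hδ2
    obtain ⟨β₁, hβ₁, hU₁⟩ := hLoj.exists_uniform (hcoercive.isCompact_sublevel M.continuous ℓ)
    have hrates := fun β (hβ : β ∈ Ioo (0 : ℝ) 1) ζ (hζ : 0 < ζ)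
        (hU : UniformLojasiewiczOn F (sublevel F ℓ) β ζ) =>
      M.localRates hcoercive hlim hE (half_lt_self hδ.1) hS hβ hζ hU hstep
    refine ⟨ℓ, hℓ, ?_, ⟨β₁, hβ₁, 1, one_pos, hU₁⟩, hrates, ⟨β₁, hβ₁, hU₁⟩, fun β hβ hU => ?_⟩
    · refine le_trans (by linarith) (hS.trans ?_)
      refine ENNReal.toReal_mono (measure_ne_top _ _) (measure_mono_ae ?_)
      filter_upwards [hlim] with ω hω hωℓ
      show accPoints _ ⊆ _
      rw [accPoints_eq_singleton hω.1]
      exact singleton_subset_iff.2 hωℓ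
    · obtain ⟨C, hC, h⟩ := hrates β hβ 1 one_pos hU
      -- For `ζ = 1` the condition on the steps reduces to the assumption on `κ * γs`.
      refine ⟨C, hC, h.of_imp fun _ hs1 => ?_⟩
      rw [Real.one_rpow, one_mul, max_comm]
      exact hκγ hs1
  · exact M.globalRates hθs (hlim.mono fun ω h => h.1) hE hβ hζ h hstep
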